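/- Let $d\ge 1$ and let $\mathcal P$ be one of the following inputs. (i) (finite-input continuum) $\mathcal P=\mathcal P_\tau$, $0<\tau<\infty$: a Poisson point process on $\mathbb R^d\times[0,\tau]$ whose intensity is Lebesgue measure. (ii) (infinite-input lattice) $\mathcal P=\mathcal Q$: independent rate-one Poisson processes on $[0,\infty)$, one for each $z\in\mathbb Z^d$, regarded as a point process on $\mathbb Z^d\times[0,\infty)\subset\mathbb R^d\times[0,\infty)$. A point $w=(x,t)$ of $\mathcal P$ is an open unit ball centred at $x$ that arrives at time $t$. Balls are treated in the order of arrival, and a ball is accepted if and only if it overlaps no ball accepted earlier, that is, no earlier accepted ball has its centre at distance $<2$ from $x$. Let $\alpha(\mathcal P)$ be the set of accepted points of $\mathcal P$. For distinct points $w_1,\dots,w_k$ of $W=\mathbb R^d\times[0,\infty)$ the $k$-point correlation function is the joint limit through positive $\epsilon_1,\dots,\epsilon_k$ $$r_k(w_1,\dots,w_k)=\lim_{\epsilon_1,\dots,\epsilon_k\to0}\frac{P\big[\alpha(\mathcal P)\cap(w_i+\epsilon_iU)\ne\emptyset\text{ for all }i\big]}{\prod_{i=1}^k\mathrm{vol}(\epsilon_iU)},$$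 where in case (i) $U$ is the Euclidean unit ball of $\mathbb R^{d+1}$, with $\mathrm{vol}(\epsilon U)=\epsilon^{d+1}\,\mathrm{vol}(U)$, and in case (ii) $U=\{0\}\times[-\tfrac12,\tfrac12]$, with $\mathrm{vol}(\epsilon U)=\epsilon$. Then, with $w_i=(x_i,t_i)$: the limit $r_k(w_1,\dots,w_k)$ exists for all $k\ge1$ and all distinct $w_1,\dots,w_k\in W$, provided in case (i) that $\|x_i-x_j\|\ne2$ for all $i\ne j$. Moreover, the functions $r_k$ cluster exponentially: for all $k,l\ge1$ there are constants $A_{k,l},C_{k,l}>0$ such that, for all distinct points $w_1,\dots,w_k,w_1',\dots,w_l'$ of $W$ at which the three limits exist, $$\big|r_{k+l}(w_1,\dots,w_k,w_1',\dots,w_l')-r_k(w_1,\dots,w_k)\,r_l(w_1',\dots,w_l')\big|\le A_{k,l}\exp\big(-C_{k,l}\min_{i,j}|w_i-w_j'|\big),$$ where $|\cdot|$ is the Euclidean norm of $\mathbb R^{d+1}$. -/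

import Mathlib

open MeasureTheory ProbabilityTheory Filter Topology Set

noncomputable section

namespace RSA

/-- Space-time `ℝ^d × ℝ`: a point `w = (x, t)` is a ball centre `x` with its arrival time `t`.
Only times `t ≥ 0` are ever used.  The product carries its usual Lebesgue measure `volume`. -/
abbrev SpaceTime (d : ℕ) : Type := EuclideanSpace ℝ (Fin d) × ℝ

/-- The Euclidean distance of two space-time points, as points of `ℝ^(d+1)`.
(The metric that Mathlib puts on a product is the sup metric, so it is not used.) -/
def euclDist {d : ℕ} (w w' : SpaceTime d) : ℝ :=
  √(dist w.1 w'.1 ^ 2 + (w.2 - w'.2) ^ 2)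

/-! ### The packing rule -/

/-- The ball of `w'` arrives before the ball of `w`, and the two open unit balls overlap. -/
def Blocks {d : ℕ} (w' w : SpaceTime d) : Prop :=
  w'.2 < w.2 ∧ dist w'.1 w.1 < 2

/-- The sequential packing rule on an input set `X`: `Decision X w true` says that the ball of
`w` is packed, `Decision X w false` that it is discarded.  A ball is packed once all earlier
overlapping balls are discarded; it is discarded as soon as one earlier overlapping ball is
packed. -/
inductive Decision {d : ℕ} (X : Set (SpaceTime d)) : SpaceTime d → Bool → Prop
  | pack (w : SpaceTime d) (hw : w ∈ X)
      (h : ∀ w' ∈ X, Blocks w' w → Decision X w' false) : Decision X w true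
  | discard (w w' : SpaceTime d) (hw : w ∈ X) (hw' : w' ∈ X) (hb : Blocks w' w)
      (h : Decision X w' true) : Decision X w false

/-- The set `α(X)` of the points of `X` that are accepted (packed), with their times. -/
def accepted {d : ℕ} (X : Set (SpaceTime d)) : Set (SpaceTime d) :=
  {w | Decision X w true}

theorem accepted_subset {d : ℕ} (X : Set (SpaceTime d)) : accepted X ⊆ X := by
  intro w hw
  cases hw with
  | pack _ hw _ => exact hw

/-- No ball is both packed and discarded. -/
theorem Decision.not_both {d : ℕ} {X : Set (SpaceTime d)} {w : SpaceTime d} {b : Bool}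
    (h : Decision X w b) : ¬ Decision X w (!b) := by
  induction h with
  | pack w hw h ih =>
    intro h'
    cases h' with
    | discard _ w' _ hw' hb h'' => exact ih w' hw' hb h''
  | discard w w' hw hw' hb h ih =>
    intro h'
    cases h' with
    | pack _ _ h'' => exact ih (h'' w' hw' hb)

/-- Where there is no infinite backward chain of overlapping balls, the accepted set obeys the
usual recursion: a ball is accepted iff it overlaps no ball accepted earlier. -/
theorem mem_accepted_iff {d : ℕ} {X : Set (SpaceTime d)}
    (hX : WellFounded fun w' w : SpaceTime d => w' ∈ X ∧ w ∈ X ∧ Blocks w' w)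
    (w : SpaceTime d) :
    w ∈ accepted X ↔ w ∈ X ∧ ∀ w' ∈ accepted X, ¬ Blocks w' w := by
  have key : ∀ w ∈ X, Decision X w true ∨ Decision X w false := by
    intro w
    induction w using hX.induction with
    | _ w ih =>
      intro hw
      by_cases h : ∃ w' ∈ X, Blocks w' w ∧ Decision X w' true
      · obtain ⟨w', hw', hb, h⟩ := h
        exact Or.inr (.discard w w' hw hw' hb h)
      · refine Or.inl (.pack w hw fun w' hw' hb => ?_)
        exact (ih w' ⟨hw', hw, hb⟩ hw').resolve_left fun h' => h ⟨w', hw', hb, h'⟩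
  constructor
  · intro h
    refine ⟨accepted_subset X h, fun w' h' hb => ?_⟩
    exact h.not_both (.discard w w' (accepted_subset X h) (accepted_subset X h') hb h')
  · rintro ⟨hw, h⟩
    refine .pack w hw fun w' hw' hb => ?_
    exact (key w' hw').resolve_left fun h' => h w' h' hb

/-! ### The Poisson input -/

/-- The random set `X` is a (simple) Poisson point process with intensity measure `μ`: the number
of its points in a measurable set `B` of finite intensity is Poisson with mean `μ B`, and the
numbers of points in pairwise disjoint sets are independent. -/
structure IsPoissonProcess {Ω S : Type*} [MeasurableSpace Ω] [MeasurableSpace S]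
    (P : Measure Ω) (μ : Measure S) (X : Ω → Set S) : Prop where
  measurable_count : ∀ B : Set S, MeasurableSet B → Measurable fun ω => (X ω ∩ B).encard
  count_law : ∀ B : Set S, MeasurableSet B → μ B ≠ ⊤ → ∀ n : ℕ,
    P.real {ω | (X ω ∩ B).encard = n} = Real.exp (-μ.real B) * μ.real B ^ n / n.factorial
  indep : ∀ (n : ℕ) (B : Fin n → Set S), (∀ i, MeasurableSet (B i)) →
    Pairwise (fun i j => Disjoint (B i) (B j)) → iIndepFun (fun i ω => (X ω ∩ B i).encard) P

/-- The intensity of the finite-input continuum process: Lebesgue measure on `ℝ^d × [0, τ]`. -/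
def continuumIntensity (d : ℕ) (τ : ℝ) : Measure (SpaceTime d) :=
  (volume : Measure (EuclideanSpace ℝ (Fin d))).prod (volume.restrict (Icc (0 : ℝ) τ))

/-- The lattice point `z ∈ ℤ^d` as a point of `ℝ^d`. -/
def latticePoint {d : ℕ} (z : Fin d → ℤ) : EuclideanSpace ℝ (Fin d) :=
  WithLp.toLp 2 fun i => (z i : ℝ)

/-- The intensity of the infinite-input lattice process: Lebesgue measure on `{z} × [0, ∞)` for
every `z ∈ ℤ^d`.  A Poisson process with this intensity is a family of independent rate-one
Poisson processes on `[0, ∞)`, one at each lattice point, embedded into `ℝ^d × [0, ∞)`. -/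
def latticeIntensity (d : ℕ) : Measure (SpaceTime d) :=
  Measure.sum fun z : Fin d → ℤ =>
    (Measure.dirac (latticePoint z)).prod (volume.restrict (Ici (0 : ℝ)))

/-! ### Correlation functions -/

/-- The probability that `α(X)` meets each of the sets `w i + ε i • U`. -/
def hitProb {Ω : Type*} [MeasurableSpace Ω] {d k : ℕ} (P : Measure Ω) (X : Ω → Set (SpaceTime d))
    (U : Set (SpaceTime d)) (w : Fin k → SpaceTime d) (ε : Fin k → ℝ) : ℝ :=
  P.real {ω | ∀ i, (accepted (X ω) ∩ (fun u => w i + ε i • u) '' U).Nonempty}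

/-- The Euclidean unit ball of `ℝ^(d+1)`. -/
def unitBall (d : ℕ) : Set (SpaceTime d) := {u | euclDist u 0 ≤ 1}

/-- The interval `{0} × [-1/2, 1/2]`. -/
def timeInterval (d : ℕ) : Set (SpaceTime d) := {u | u.1 = 0 ∧ u.2 ∈ Icc (-1 / 2 : ℝ) (1 / 2)}

/-- In the continuum, the `k`-point correlation function of `α(X)` has the value `r` at `w`:
the probability of an accepted point in each of the balls of radius `ε i` around `w i`, divided by
the product of their volumes, tends to `r` as `ε → 0`, jointly through positive radii. -/
def ContinuumCorrelation {Ω : Type*} [MeasurableSpace Ω] {d : ℕ} (P : Measure Ω)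
    (X : Ω → Set (SpaceTime d)) (k : ℕ) (w : Fin k → SpaceTime d) (r : ℝ) : Prop :=
  Tendsto (fun ε : Fin k → ℝ => hitProb P X (unitBall d) w ε /
      ∏ i, (ε i ^ (d + 1) * volume.real (unitBall d)))
    (𝓝[{ε | ∀ i, 0 < ε i}] 0) (𝓝 r)

/-- On the lattice, the same with vertical intervals of length `ε i` in place of the balls. -/
def LatticeCorrelation {Ω : Type*} [MeasurableSpace Ω] {d : ℕ} (P : Measure Ω)
    (X : Ω → Set (SpaceTime d)) (k : ℕ) (w : Fin k → SpaceTime d) (r : ℝ) : Prop :=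
  Tendsto (fun ε : Fin k → ℝ => hitProb P X (timeInterval d) w ε / ∏ i, ε i)
    (𝓝[{ε | ∀ i, 0 < ε i}] 0) (𝓝 r)

/-- The minimum of the pairwise Euclidean distances between two (nonempty) tuples. -/
def tupleDist {d k l : ℕ} (w : Fin k → SpaceTime d) (w' : Fin l → SpaceTime d) : ℝ :=
  ⨅ p : Fin k × Fin l, euclDist (w p.1) (w' p.2)

/-- Exponential clustering of correlation functions, where `R k w r` says that the `k`-point
function is defined at `w` with value `r`.  Correlation functions are taken at tuples of distinct
points with nonnegative times. -/
def ExponentiallyClusters {d : ℕ} (R : ∀ k : ℕ, (Fin k → SpaceTime d) → ℝ → Prop) : Prop :=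
  ∀ k l : ℕ, 1 ≤ k → 1 ≤ l → ∃ A > 0, ∃ C > 0,
    ∀ (w : Fin k → SpaceTime d) (w' : Fin l → SpaceTime d),
      (∀ i, 0 ≤ (w i).2) → (∀ j, 0 ≤ (w' j).2) → Function.Injective (Fin.append w w') →
      ∀ r r₁ r₂ : ℝ, R (k + l) (Fin.append w w') r → R k w r₁ → R l w' r₂ →
        |r - r₁ * r₂| ≤ A * Real.exp (-(C * tupleDist w w'))

end RSA

end

set_option linter.unusedSectionVars false

noncomputable section

namespace RSA

section

variable {d : ℕ}

/-! ### Deterministic properties of the packing rule -/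

/-! Whether a ball is accepted depends only on the balls reached from it along backward chains of
overlapping balls. The proof combines this with two facts about the Poisson input: its restrictions
to disjoint sets are independent, and long backward chains are factorially unlikely. Every error
estimate keeps the product of the intensities of the small sets (tiles) around the `w i` as a
factor, so it survives division by their volumes.

Existence. If two centres are at distance less than 2, the limit is 0: two accepted overlapping
balls would need equal arrival times. Otherwise small tiles stay at spatial distance at least 2 from
each other, and to leading order each tile that is hit contains exactly one point. Moving that point
to `w i` changes no blocking relation unless the input meets a thin set of points that arrive at
nearly the same time or, in the continuum, lie near the sphere of radius 2. After the move the event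
depends only on the input outside the tiles. So the hitting probability is the product of the tile
intensities times `g + o(1)`, where `g` is the probability that all `w i` are accepted when inserted
into the input (`accepted_replace`, `hit_accepted_approx`). The limit is `g` times the limits of
intensity over volume, which need not be 1 at the ends of the time window or off the lattice.

Clustering. Let `T` be the latest of the times and `δ` the distance of the two groups. A chain of `n
+ 1` balls before time `T` has decreasing times, which gives the bound `(7 ^ d * T) ^ (n + 1) / (n +
1)!` (`chain_le`). Without such chains the two groups are decided by the input in two disjoint
neighbourhoods, hence independently (`accepted_localize`, `cluster_approx`). This is useful when `T`
is small compared with `δ`. For large `T` all correlations involved are at most a constant times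
`exp (-T)`: on the lattice an accepted ball needs an empty past at its site, and in the continuum
the input stops at `τ`. `exists_exp_bound` balances the two regimes. -/

theorem Blocks.irrefl (w : SpaceTime d) : ¬ Blocks w w := fun h => lt_irrefl _ h.1

theorem Decision.mem {X : Set (SpaceTime d)} {w : SpaceTime d} {b : Bool} (h : Decision X w b) :
    w ∈ X := by
  cases h <;> assumption

/-- The rule sees a configuration only through the blocking relation. Injectivity of `f` is not
needed: surjectivity onto `X'` is enough to pull back the quantifier over blockers. -/
theorem Decision.map {X X' : Set (SpaceTime d)} {f : SpaceTime d → SpaceTime d}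
    (hf : ∀ w ∈ X, f w ∈ X') (hs : ∀ v ∈ X', ∃ w ∈ X, f w = v)
    (hb : ∀ w ∈ X, ∀ w' ∈ X, (Blocks w' w ↔ Blocks (f w') (f w)))
    {w : SpaceTime d} {b : Bool} (h : Decision X w b) : Decision X' (f w) b := by
  induction h with
  | pack w hw h ih =>
    refine .pack _ (hf w hw) fun v hv hvb => ?_
    obtain ⟨w', hw', rfl⟩ := hs v hv
    exact ih w' hw' ((hb w hw w' hw').2 hvb)
  | discard w w' hw hw' hbl h ih =>
    exact .discard _ (f w') (hf w hw) (hf w' hw') ((hb w hw w' hw').1 hbl) ih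

/-- Converse transfer. The preimage `w` is quantified after the decision, since the induction runs
over points of `X'`. -/
theorem Decision.of_map {X X' : Set (SpaceTime d)} {f : SpaceTime d → SpaceTime d}
    (hf : ∀ w ∈ X, f w ∈ X') (hs : ∀ v ∈ X', ∃ w ∈ X, f w = v)
    (hb : ∀ w ∈ X, ∀ w' ∈ X, (Blocks w' w ↔ Blocks (f w') (f w)))
    {v : SpaceTime d} {b : Bool} (h : Decision X' v b) :
    ∀ w ∈ X, f w = v → Decision X w b := by
  induction h with
  | pack v hv h ih =>
    rintro w hw rfl
    exact .pack _ hw fun w' hw' hbl =>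
      ih (f w') (hf w' hw') ((hb w hw w' hw').1 hbl) w' hw' rfl
  | discard v v' hv hv' hbl h ih =>
    rintro w hw rfl
    obtain ⟨w', hw', rfl⟩ := hs v' hv'
    exact .discard _ w' hw hw' ((hb w hw w' hw').2 hbl) (ih w' hw' rfl)

/-- Decisions only depend on a set of points that is closed under taking blockers. -/
theorem decision_iff_of_backwardClosed {X S : Set (SpaceTime d)} (hSX : S ⊆ X)
    (hS : ∀ y ∈ S, ∀ z ∈ X, Blocks z y → z ∈ S) {y : SpaceTime d} (hy : y ∈ S) (b : Bool) :
    Decision X y b ↔ Decision S y b := by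
  constructor
  · intro h
    induction h with
    | pack w hw h ih => exact .pack _ hy fun w' hw' hb => ih w' (hSX hw') hb hw'
    | discard w w' hw hw' hb h ih => exact .discard _ w' hy (hS w hy w' hw' hb) hb
                                       (ih (hS w hy w' hw' hb))
  · intro h
    induction h with
    | pack w hw h ih => exact .pack _ (hSX hw) fun w' hw' hb =>
                          ih w' (hS w hw w' hw' hb) hb (hS w hw w' hw' hb)
    | discard w w' hw hw' hb h ih => exact .discard _ w' (hSX hw) (hSX hw') hb (ih hw')

/-- A packed ball has no earlier ball at the same place. -/
theorem Decision.no_earlier_at_centre {X : Set (SpaceTime d)} {w y : SpaceTime d}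
    (h : Decision X w true) (hy : y ∈ X) (hc : y.1 = w.1) : ¬ y.2 < w.2 := by
  intro hlt
  cases h with
  | pack _ hw h =>
    have h1 := h y hy ⟨hlt, by simp [hc]⟩
    cases h1 with
    | discard _ z _ hz hb h2 =>
      have h3 := h z hz ⟨hb.1.trans hlt, by rw [← hc]; exact hb.2⟩
      exact h3.not_both h2

/-- Two packed balls that overlap have the same arrival time. -/
theorem accepted_time_eq {X : Set (SpaceTime d)} {w y : SpaceTime d} (hw : w ∈ accepted X)
    (hy : y ∈ accepted X) (hd : dist w.1 y.1 < 2) : w.2 = y.2 := by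
  have key : ∀ a b : SpaceTime d, Decision X a true → Decision X b true → dist a.1 b.1 < 2 →
      ¬ a.2 < b.2 := by
    intro a b ha hb hab hlt
    cases hb with
    | pack _ hw h => exact (h a ha.mem ⟨hlt, hab⟩).not_both ha
  exact le_antisymm (not_lt.1 (key y w hy hw (by rwa [dist_comm]))) (not_lt.1 (key w y hw hy hd))

/-- Local finiteness of a configuration of points. -/
def LocFin (Y : Set (SpaceTime d)) : Prop := ∀ r : ℝ, (Y ∩ Metric.closedBall 0 r).Finite

theorem LocFin.mono {Y Z : Set (SpaceTime d)} (h : LocFin Y) (hZ : Z ⊆ Y) : LocFin Z :=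
  fun r => (h r).subset (inter_subset_inter_left _ hZ)

theorem LocFin.union_finite {Y F : Set (SpaceTime d)} (h : LocFin Y) (hF : F.Finite) :
    LocFin (Y ∪ F) := fun r => by
  rw [union_inter_distrib_right]
  exact (h r).union (hF.subset inter_subset_left)

/-- Isolation by members of a countable basis turns statements about individual points into
countable unions of hitting events. -/
theorem LocFin.exists_isolating {Y : Set (SpaceTime d)} (h : LocFin Y) (y : SpaceTime d) :
    ∃ V ∈ TopologicalSpace.countableBasis (SpaceTime d), y ∈ V ∧ Y ∩ V ⊆ {y} := by
  set F := (Y ∩ Metric.closedBall 0 (‖y‖ + 1)) \ {y} with hF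
  have hfin : F.Finite := (h _).subset sdiff_subset
  have hopen : IsOpen (Metric.ball (0 : SpaceTime d) (‖y‖ + 1) ∩ Fᶜ) :=
    Metric.isOpen_ball.inter hfin.isClosed.isOpen_compl
  have hmem : y ∈ Metric.ball (0 : SpaceTime d) (‖y‖ + 1) ∩ Fᶜ := by
    refine ⟨by simp, fun hy' => hy'.2 rfl⟩
  obtain ⟨V, hV, hyV, hVs⟩ :=
    (TopologicalSpace.isBasis_countableBasis (SpaceTime d)).exists_subset_of_mem_open hmem hopen
  refine ⟨V, hV, hyV, fun z hz => ?_⟩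
  by_contra hne
  exact (hVs hz.2).2 ⟨⟨hz.1, Metric.ball_subset_closedBall (hVs hz.2).1⟩, hne⟩

theorem LocFin.finite_blockers {Y : Set (SpaceTime d)} (h : LocFin Y) (h0 : ∀ y ∈ Y, 0 ≤ y.2)
    (w : SpaceTime d) : {z ∈ Y | Blocks z w}.Finite := by
  refine (h (‖w.1‖ + 2 + |w.2|)).subset fun z hz => ⟨hz.1, ?_⟩
  have hz0 := h0 z hz.1
  have h1 := hz.2.1
  have h2 := hz.2.2
  rw [mem_closedBall_zero_iff, Prod.norm_def]
  have h3 : ‖z.1‖ ≤ ‖w.1‖ + 2 := by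
    have := norm_le_norm_add_norm_sub w.1 z.1
    rw [dist_eq_norm, norm_sub_rev] at h2
    linarith
  have h4 : ‖z.2‖ ≤ |w.2| := by
    rw [Real.norm_eq_abs, abs_of_nonneg hz0]
    exact h1.le.trans (le_abs_self _)
  have := abs_nonneg w.2
  have := norm_nonneg w.1
  exact max_le (by linarith) (by linarith)

/-- The points of `Y` that stand in the relation `R` to some point of `Z`. -/
def related (R : Set (SpaceTime d × SpaceTime d)) (Y Z : Set (SpaceTime d)) :
    Set (SpaceTime d) := {y ∈ Y | ∃ z ∈ Z, (z, y) ∈ R}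

theorem related_mono {R : Set (SpaceTime d × SpaceTime d)} {Y Y' Z Z' : Set (SpaceTime d)}
    (hY : Y ⊆ Y') (hZ : Z ⊆ Z') : related R Y Z ⊆ related R Y' Z' :=
  fun _ ⟨hy, z, hz, h⟩ => ⟨hY hy, z, hZ hz, h⟩

/-- The blocking relation as a set of pairs. -/
def blockSet (d : ℕ) : Set (SpaceTime d × SpaceTime d) := {p | Blocks p.1 p.2}

theorem isOpen_blockSet : IsOpen (blockSet d) := by
  have : blockSet d = {p | p.1.2 < p.2.2} ∩ {p | dist p.1.1 p.2.1 < 2} := rfl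
  rw [this]
  exact (isOpen_lt (by fun_prop) (by fun_prop)).inter (isOpen_lt (by fun_prop) (by fun_prop))

/-- The points whose acceptance is settled within `n` rounds. -/
def stage (Y : Set (SpaceTime d)) : ℕ → Set (SpaceTime d)
  | 0 => ∅
  | n + 1 => Y \ related (blockSet d) Y (Y \ related (blockSet d) Y (stage Y n))

theorem stage_subset (Y : Set (SpaceTime d)) (n : ℕ) : stage Y n ⊆ Y := by
  cases n with
  | zero => exact empty_subset _
  | succ n => exact sdiff_subset

/-- Each complement in the recursion reverses inclusions, and there are two of them. -/
theorem stage_mono (Y : Set (SpaceTime d)) : Monotone (stage Y) := by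
  refine monotone_nat_of_le_succ fun n => ?_
  induction n with
  | zero => exact empty_subset _
  | succ n ih =>
    exact sdiff_subset_sdiff_right (related_mono subset_rfl
      (sdiff_subset_sdiff_right (related_mono subset_rfl ih)))

/-- The inner complement in `stage` consists of the balls not yet discarded, so a new round keeps
exactly the balls all of whose blockers are discarded by a ball of the previous round. This
expresses acceptance by countably many operations that preserve `HitMeas`. -/
theorem accepted_eq_iUnion_stage {Y : Set (SpaceTime d)} (h : LocFin Y) (h0 : ∀ y ∈ Y, 0 ≤ y.2) :
    accepted Y = ⋃ n, stage Y n := by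
  apply Subset.antisymm
  · have key : ∀ w b, Decision Y w b →
        ∃ n, (b = true → w ∈ stage Y n) ∧
          (b = false → w ∈ related (blockSet d) Y (stage Y n)) := by
      intro w b hd
      induction hd with
      | pack w hw hX ih =>
        choose! N hN using ih
        -- There are only finitely many blockers, so one round discards all of them.
        obtain ⟨m, hm⟩ := ((h.finite_blockers h0 w).image N).bddAbove
        refine ⟨m + 1, fun _ => ⟨hw, ?_⟩, by simp⟩
        rintro ⟨-, z, ⟨hz, hzn⟩, hb⟩
        have h1 := (hN z hz hb).2 rfl
        exact hzn (related_mono subset_rfl (stage_mono Y (hm ⟨z, ⟨hz, hb⟩, rfl⟩)) h1)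
      | discard w w' hw hw' hb hX ih =>
        obtain ⟨n, hn, -⟩ := ih
        exact ⟨n, by simp, fun _ => ⟨hw, w', hn rfl, hb⟩⟩
    intro w hw
    obtain ⟨n, hn, -⟩ := key w true hw
    exact mem_iUnion.2 ⟨n, hn rfl⟩
  · refine iUnion_subset fun n => ?_
    induction n with
    | zero => exact empty_subset _
    | succ n ih =>
      rintro y ⟨hy, hyn⟩
      refine .pack _ hy fun z hz hb => ?_
      by_contra hcon
      refine hyn ⟨hy, z, ⟨hz, ?_⟩, hb⟩
      rintro ⟨-, z', hz', hb'⟩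
      exact hcon (.discard _ z' hz (stage_subset Y n hz') hb' (ih hz'))

/-! ### Measurability of hitting events -/

/-- All events "`Z` meets the measurable set `A`" are measurable for `m`. -/
def HitMeas {Ω : Type*} (m : MeasurableSpace Ω) (Z : Ω → Set (SpaceTime d)) : Prop :=
  ∀ A : Set (SpaceTime d), MeasurableSet A → MeasurableSet[m] {ω | (Z ω ∩ A).Nonempty}

variable {Ω : Type*} {m : MeasurableSpace Ω}

theorem HitMeas.inter {Z : Ω → Set (SpaceTime d)} (h : HitMeas m Z) {N : Set (SpaceTime d)}
    (hN : MeasurableSet N) : HitMeas m fun ω => Z ω ∩ N := fun A hA => by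
  simpa only [inter_assoc] using h (N ∩ A) (hN.inter hA)

theorem HitMeas.union_const {Z : Ω → Set (SpaceTime d)} (h : HitMeas m Z)
    (F : Set (SpaceTime d)) : HitMeas m fun ω => Z ω ∪ F := fun A hA => by
  by_cases hF : (F ∩ A).Nonempty
  · have : {ω | ((Z ω ∪ F) ∩ A).Nonempty} = univ :=
      eq_univ_of_forall fun ω => hF.mono (inter_subset_inter_left _ subset_union_right)
    rw [this]
    exact MeasurableSet.univ
  · convert h A hA using 3 with ω
    rw [union_inter_distrib_right, not_nonempty_iff_eq_empty.1 hF, union_empty]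

/-- A point of `Y` outside `Z` has a basic neighbourhood `V` containing no other point of `Y`. There
`Y` is hit and `Z`, being part of `Y`, is missed. -/
theorem HitMeas.diff {Y Z : Ω → Set (SpaceTime d)} (hY : HitMeas m Y) (hZ : HitMeas m Z)
    (hfin : ∀ ω, LocFin (Y ω)) (hZY : ∀ ω, Z ω ⊆ Y ω) : HitMeas m fun ω => Y ω \ Z ω := by
  intro A hA
  have heq : {ω | ((Y ω \ Z ω) ∩ A).Nonempty} =
      ⋃ V ∈ TopologicalSpace.countableBasis (SpaceTime d),
        {ω | (Y ω ∩ (A ∩ V)).Nonempty} ∩ {ω | (Z ω ∩ (A ∩ V)).Nonempty}ᶜ := by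
    ext ω
    simp only [mem_ofPred_eq, mem_iUnion, mem_inter_iff, mem_compl_iff, exists_prop]
    constructor
    · rintro ⟨y, ⟨hy, hyZ⟩, hyA⟩
      obtain ⟨V, hV, hyV, hiso⟩ := (hfin ω).exists_isolating y
      refine ⟨V, hV, ⟨y, hy, hyA, hyV⟩, ?_⟩
      rintro ⟨z, hz, -, hzV⟩
      exact hyZ (hiso ⟨hZY ω hz, hzV⟩ ▸ hz)
    · rintro ⟨V, hV, ⟨y, hy, hyA, hyV⟩, hn⟩
      exact ⟨y, ⟨hy, fun hyZ => hn ⟨y, hyZ, hyA, hyV⟩⟩, hyA⟩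
  rw [heq]
  refine MeasurableSet.biUnion (TopologicalSpace.countable_countableBasis _) fun V hV => ?_
  have hVm : MeasurableSet V := (TopologicalSpace.isOpen_of_mem_countableBasis hV).measurableSet
  exact (hY _ (hA.inter hVm)).inter (hZ _ (hA.inter hVm)).compl

/-- An open relation is a countable union of basic boxes. -/
theorem HitMeas.related {Y Z : Ω → Set (SpaceTime d)} (hY : HitMeas m Y) (hZ : HitMeas m Z)
    {R : Set (SpaceTime d × SpaceTime d)} (hR : IsOpen R) :
    HitMeas m fun ω => related R (Y ω) (Z ω) := by
  intro A hA
  set 𝓑 := TopologicalSpace.countableBasis (SpaceTime d)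
  have heq : {ω | (RSA.related R (Y ω) (Z ω) ∩ A).Nonempty} =
      ⋃ V ∈ 𝓑, ⋃ V' ∈ 𝓑, ⋃ _ : V ×ˢ V' ⊆ R,
        {ω | (Z ω ∩ V).Nonempty} ∩ {ω | (Y ω ∩ (A ∩ V')).Nonempty} := by
    ext ω
    simp only [mem_ofPred_eq, mem_iUnion, mem_inter_iff, exists_prop]
    constructor
    · rintro ⟨y, ⟨hy, z, hz, hzy⟩, hyA⟩
      obtain ⟨u, v, hu, hv, hzu, hyv, huv⟩ := isOpen_prod_iff.1 hR z y hzy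
      obtain ⟨V, hV, hzV, hVu⟩ :=
        (TopologicalSpace.isBasis_countableBasis _).exists_subset_of_mem_open hzu hu
      obtain ⟨V', hV', hyV', hVv⟩ :=
        (TopologicalSpace.isBasis_countableBasis _).exists_subset_of_mem_open hyv hv
      exact ⟨V, hV, V', hV', (prod_mono hVu hVv).trans huv, ⟨z, hz, hzV⟩, y, hy, hyA, hyV'⟩
    · rintro ⟨V, hV, V', hV', hs, ⟨z, hz, hzV⟩, y, hy, hyA, hyV'⟩
      exact ⟨y, ⟨hy, z, hz, hs ⟨hzV, hyV'⟩⟩, hyA⟩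
  rw [heq]
  refine MeasurableSet.biUnion (TopologicalSpace.countable_countableBasis _) fun V hV =>
    MeasurableSet.biUnion (TopologicalSpace.countable_countableBasis _) fun V' hV' =>
      MeasurableSet.iUnion fun _ => ?_
  exact (hZ _ (TopologicalSpace.isOpen_of_mem_countableBasis hV).measurableSet).inter
    (hY _ (hA.inter (TopologicalSpace.isOpen_of_mem_countableBasis hV').measurableSet))

theorem HitMeas.accepted {Y : Ω → Set (SpaceTime d)} (hY : HitMeas m Y)
    (hfin : ∀ ω, LocFin (Y ω)) (h0 : ∀ ω, ∀ y ∈ Y ω, 0 ≤ y.2) :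
    HitMeas m fun ω => accepted (Y ω) := by
  have hst : ∀ n, HitMeas m fun ω => stage (Y ω) n := by
    intro n
    induction n with
    | zero => intro A _; simp [stage]
    | succ n ih =>
      refine hY.diff (hY.related (hY.diff (hY.related ih isOpen_blockSet) hfin ?_)
        isOpen_blockSet) hfin ?_
      all_goals exact fun ω y hy => hy.1
  intro A hA
  have : {ω | (RSA.accepted (Y ω) ∩ A).Nonempty} = ⋃ n, {ω | (stage (Y ω) n ∩ A).Nonempty} := by
    ext ω
    simp only [mem_ofPred_eq, accepted_eq_iUnion_stage (hfin ω) (h0 ω), iUnion_inter,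
      nonempty_iUnion, mem_iUnion]
  rw [this]
  exact MeasurableSet.iUnion fun n => hst n A hA

theorem HitMeas.two_le_encard {Y : Ω → Set (SpaceTime d)} (hY : HitMeas m Y)
    {A : Set (SpaceTime d)} (hA : MeasurableSet A) :
    MeasurableSet[m] {ω | 2 ≤ (Y ω ∩ A).encard} := by
  set 𝓑 := TopologicalSpace.countableBasis (SpaceTime d)
  have heq : {ω | 2 ≤ (Y ω ∩ A).encard} =
      ⋃ V ∈ 𝓑, ⋃ V' ∈ 𝓑, ⋃ _ : Disjoint V V',
        {ω | (Y ω ∩ (A ∩ V)).Nonempty} ∩ {ω | (Y ω ∩ (A ∩ V')).Nonempty} := by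
    ext ω
    simp only [mem_ofPred_eq, mem_iUnion, mem_inter_iff, exists_prop]
    constructor
    · intro h
      obtain ⟨y, y', hy, hy', hne⟩ := one_lt_encard_iff.1 (lt_of_lt_of_le (by norm_num) h)
      obtain ⟨u, v, hu, hv, hyu, hyv, huv⟩ := t2_separation hne
      obtain ⟨V, hV, hzV, hVu⟩ :=
        (TopologicalSpace.isBasis_countableBasis _).exists_subset_of_mem_open hyu hu
      obtain ⟨V', hV', hyV', hVv⟩ :=
        (TopologicalSpace.isBasis_countableBasis _).exists_subset_of_mem_open hyv hv
      exact ⟨V, hV, V', hV', huv.mono hVu hVv, ⟨y, hy.1, hy.2, hzV⟩, y', hy'.1, hy'.2, hyV'⟩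
    · rintro ⟨V, hV, V', hV', hs, ⟨z, hz, hzA, hzV⟩, y, hy, hyA, hyV'⟩
      have : 1 < (Y ω ∩ A).encard := one_lt_encard_iff.2
        ⟨z, y, ⟨hz, hzA⟩, ⟨hy, hyA⟩, fun h => disjoint_left.1 hs hzV (h ▸ hyV')⟩
      simpa [one_add_one_eq_two] using Order.add_one_le_of_lt this
  rw [heq]
  refine MeasurableSet.biUnion (TopologicalSpace.countable_countableBasis _) fun V hV =>
    MeasurableSet.biUnion (TopologicalSpace.countable_countableBasis _) fun V' hV' =>
      MeasurableSet.iUnion fun _ => ?_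
  exact (hY _ (hA.inter (TopologicalSpace.isOpen_of_mem_countableBasis hV).measurableSet)).inter
    (hY _ (hA.inter (TopologicalSpace.isOpen_of_mem_countableBasis hV').measurableSet))

theorem encard_eq_one_iff_hit {A : Set (SpaceTime d)} :
    A.encard = 1 ↔ A.Nonempty ∧ ¬ 2 ≤ A.encard := by
  rw [← one_le_encard_iff_nonempty, ← one_add_one_eq_two, not_le,
    ENat.lt_add_one_iff (by simp)]
  exact ⟨fun h => ⟨h.ge, h.le⟩, fun h => le_antisymm h.2 h.1⟩

theorem HitMeas.encard_eq_one {Y : Ω → Set (SpaceTime d)} (hY : HitMeas m Y)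
    {A : Set (SpaceTime d)} (hA : MeasurableSet A) :
    MeasurableSet[m] {ω | (Y ω ∩ A).encard = 1} := by
  have : {ω | (Y ω ∩ A).encard = 1} =
      {ω | (Y ω ∩ A).Nonempty} ∩ {ω | 2 ≤ (Y ω ∩ A).encard}ᶜ := by
    ext ω; simp only [mem_ofPred_eq, encard_eq_one_iff_hit]; rfl
  rw [this]
  exact (hY A hA).inter (hY.two_le_encard hA).compl

/-- The σ-algebra generated by the events that `Y` misses a measurable set. -/
@[reducible] def hitSigma (Y : Ω → Set (SpaceTime d)) : MeasurableSpace Ω :=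
  MeasurableSpace.generateFrom {s | ∃ A, MeasurableSet A ∧ s = {ω | Y ω ∩ A = ∅}}

theorem hitMeas_hitSigma (Y : Ω → Set (SpaceTime d)) : HitMeas (hitSigma Y) Y := by
  intro A hA
  have : {ω | (Y ω ∩ A).Nonempty} = {ω | Y ω ∩ A = ∅}ᶜ := by
    ext ω; simp [nonempty_iff_ne_empty]
  rw [this]
  exact (MeasurableSpace.measurableSet_generateFrom ⟨A, hA, rfl⟩ :
    MeasurableSet[hitSigma Y] _).compl

end

section

variable {d : ℕ} {Ω : Type*} [mΩ : MeasurableSpace Ω] {P : Measure Ω} [IsProbabilityMeasure P]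

/-! ### Basic properties of Poisson processes -/

/-- The form of all comparisons below: two events that agree off `C` differ in probability by at
most that of `C`. -/
theorem abs_measureReal_sub_le {A B C : Set Ω} (h1 : A ⊆ B ∪ C) (h2 : B ⊆ A ∪ C) :
    |P.real A - P.real B| ≤ P.real C := by
  have a1 := (measureReal_mono (μ := P) h1).trans (measureReal_union_le B C)
  have a2 := (measureReal_mono (μ := P) h2).trans (measureReal_union_le A C)
  rw [abs_le]
  constructor <;> linarith

namespace IsPoissonProcess

variable {μ : Measure (SpaceTime d)} {X : Ω → Set (SpaceTime d)}

theorem void_prob (hX : IsPoissonProcess P μ X) {B : Set (SpaceTime d)} (hB : MeasurableSet B)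
    (hμ : μ B ≠ ⊤) : P.real {ω | X ω ∩ B = ∅} = Real.exp (-μ.real B) := by
  simpa using hX.count_law B hB hμ 0

theorem hitMeas (hX : IsPoissonProcess P μ X) : HitMeas mΩ X := by
  intro A hA
  have : {ω | (X ω ∩ A).Nonempty} = (fun ω => (X ω ∩ A).encard) ⁻¹' {0}ᶜ := by
    ext ω; simp [nonempty_iff_ne_empty]
  rw [this]
  exact hX.measurable_count A hA (measurableSet_singleton _).compl

theorem hit_prob (hX : IsPoissonProcess P μ X) {B : Set (SpaceTime d)} (hB : MeasurableSet B)
    (hμ : μ B ≠ ⊤) : P.real {ω | (X ω ∩ B).Nonempty} = 1 - Real.exp (-μ.real B) := by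
  have : {ω | (X ω ∩ B).Nonempty} = {ω | X ω ∩ B = ∅}ᶜ := by
    ext ω; simp [nonempty_iff_ne_empty]
  rw [this, probReal_compl_eq_one_sub, hX.void_prob hB hμ]
  have := (hX.hitMeas B hB).compl
  convert this using 1
  ext ω; simp [nonempty_iff_ne_empty]

theorem hit_le (hX : IsPoissonProcess P μ X) {B : Set (SpaceTime d)} (hB : MeasurableSet B)
    (hμ : μ B ≠ ⊤) : P.real {ω | (X ω ∩ B).Nonempty} ≤ μ.real B := by
  rw [hX.hit_prob hB hμ]
  have := Real.add_one_le_exp (-μ.real B)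
  linarith

theorem one_prob (hX : IsPoissonProcess P μ X) {B : Set (SpaceTime d)} (hB : MeasurableSet B)
    (hμ : μ B ≠ ⊤) : P.real {ω | (X ω ∩ B).encard = 1} = Real.exp (-μ.real B) * μ.real B := by
  simpa using hX.count_law B hB hμ 1

theorem two_le_prob (hX : IsPoissonProcess P μ X) {B : Set (SpaceTime d)} (hB : MeasurableSet B)
    (hμ : μ B ≠ ⊤) : P.real {ω | 2 ≤ (X ω ∩ B).encard} ≤ μ.real B ^ 2 := by
  have h1 : {ω | (X ω ∩ B).Nonempty} =
      {ω | 2 ≤ (X ω ∩ B).encard} ∪ {ω | (X ω ∩ B).encard = 1} := by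
    ext ω
    simp only [mem_ofPred_eq, mem_union, encard_eq_one_iff_hit]
    constructor
    · intro h; by_cases h2 : 2 ≤ (X ω ∩ B).encard <;> simp [h, h2]
    · rintro (h | h)
      · exact one_le_encard_iff_nonempty.1 (le_trans (by norm_num) h)
      · exact h.1
  have h2 : Disjoint {ω | 2 ≤ (X ω ∩ B).encard} {ω | (X ω ∩ B).encard = 1} := by
    rw [disjoint_left]
    intro ω h h'
    exact (encard_eq_one_iff_hit.1 h').2 h
  have h3 := measureReal_union (μ := P) h2 (hX.hitMeas.encard_eq_one hB)
  rw [← h1, hX.hit_prob hB hμ, hX.one_prob hB hμ] at h3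
  set l := μ.real B
  have hl : 0 ≤ l := measureReal_nonneg
  have h4 := Real.add_one_le_exp (-l)
  have : P.real {ω | 2 ≤ (X ω ∩ B).encard} = 1 - Real.exp (-l) - Real.exp (-l) * l := by linarith
  rw [this]
  -- `1 - (1 + l) exp (-l) ≤ 1 - (1 + l) (1 - l) = l ^ 2`.
  nlinarith [mul_le_mul_of_nonneg_right h4 hl]

/-- The Poisson weights of the finite counts already sum to one, which leaves no mass for an
infinite count. -/
theorem ae_encard_ne_top (hX : IsPoissonProcess P μ X) {B : Set (SpaceTime d)}
    (hB : MeasurableSet B) (hμ : μ B ≠ ⊤) : ∀ᵐ ω ∂P, (X ω ∩ B).encard ≠ ⊤ := by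
  have hm : ∀ n : ℕ, MeasurableSet {ω | (X ω ∩ B).encard = n} := fun n =>
    hX.measurable_count B hB (measurableSet_singleton (n : ℕ∞))
  have hs : HasSum (fun n : ℕ => P.real {ω | (X ω ∩ B).encard = n}) 1 := by
    have := hasSum_one_poissonMeasure ⟨μ.real B, measureReal_nonneg⟩
    convert this using 2 with n
    exact hX.count_law B hB hμ n
  have hU : P (⋃ n : ℕ, {ω | (X ω ∩ B).encard = n}) = 1 := by
    rw [measure_iUnion _ hm]
    · have : ∀ n : ℕ, P {ω | (X ω ∩ B).encard = n} =
          ENNReal.ofReal (P.real {ω | (X ω ∩ B).encard = n}) := fun n => by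
        rw [ofReal_measureReal]
      simp_rw [this]
      rw [← ENNReal.ofReal_tsum_of_nonneg (fun _ => measureReal_nonneg) hs.summable, hs.tsum_eq]
      simp
    · intro i j hij
      rw [Function.onFun, disjoint_left]
      intro ω h h'
      exact hij (by exact_mod_cast (h.symm.trans h' : (i : ℕ∞) = j))
  rw [← prob_compl_eq_zero_iff (MeasurableSet.iUnion fun n => hm n)] at hU
  rw [ae_iff]
  refine measure_mono_null (fun ω hω => ?_) hU
  simp only [ne_eq, not_not, mem_ofPred_eq] at hω
  simp [hω]

/-- Measurability of the counts is a separate hypothesis because it does not pass to almost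
everywhere equal functions. -/
theorem congr_ae (hX : IsPoissonProcess P μ X) {Y : Ω → Set (SpaceTime d)}
    (hY : ∀ᵐ ω ∂P, Y ω = X ω)
    (hm : ∀ B, MeasurableSet B → Measurable fun ω => (Y ω ∩ B).encard) :
    IsPoissonProcess P μ Y where
  measurable_count := hm
  count_law B hB hμ n := by
    rw [← hX.count_law B hB hμ n]
    refine measureReal_congr ?_
    filter_upwards [hY] with ω hω
    exact propext (by change (Y ω ∩ B).encard = n ↔ (X ω ∩ B).encard = n; rw [hω])
  indep n B hB hd := by
    refine (hX.indep n B hB hd).congr fun i => ?_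
    filter_upwards [hY] with ω hω
    rw [hω]

theorem prob_iInter (hX : IsPoissonProcess P μ X) {k : ℕ} {B : Fin k → Set (SpaceTime d)}
    (hB : ∀ i, MeasurableSet (B i)) (hd : Pairwise fun i j => Disjoint (B i) (B j))
    (S : Fin k → Set ℕ∞) :
    P.real {ω | ∀ i, (X ω ∩ B i).encard ∈ S i} = ∏ i, P.real {ω | (X ω ∩ B i).encard ∈ S i} := by
  have := (hX.indep k B hB hd).measure_inter_preimage_eq_mul Finset.univ
    (sets := S) (fun i _ => MeasurableSet.of_discrete)
  simp only [Measure.real, ← ENNReal.toReal_prod]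
  refine congrArg ENNReal.toReal (Eq.trans ?_ this)
  congr 1
  ext ω; simp

theorem prob_all_hit (hX : IsPoissonProcess P μ X) {k : ℕ} {B : Fin k → Set (SpaceTime d)}
    (hB : ∀ i, MeasurableSet (B i)) (hd : Pairwise fun i j => Disjoint (B i) (B j)) :
    P.real {ω | ∀ i, (X ω ∩ B i).Nonempty} = ∏ i, P.real {ω | (X ω ∩ B i).Nonempty} := by
  simpa [nonempty_iff_ne_empty] using hX.prob_iInter hB hd fun _ => {0}ᶜ

theorem prob_all_hit_le (hX : IsPoissonProcess P μ X) {k : ℕ} {B : Fin k → Set (SpaceTime d)}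
    (hB : ∀ i, MeasurableSet (B i)) (hd : Pairwise fun i j => Disjoint (B i) (B j))
    (hμ : ∀ i, μ (B i) ≠ ⊤) :
    P.real {ω | ∀ i, (X ω ∩ B i).Nonempty} ≤ ∏ i, μ.real (B i) := by
  rw [hX.prob_all_hit hB hd]
  exact Finset.prod_le_prod (fun _ _ => measureReal_nonneg) fun i _ => hX.hit_le (hB i) (hμ i)

theorem prob_all_one (hX : IsPoissonProcess P μ X) {k : ℕ} {B : Fin k → Set (SpaceTime d)}
    (hB : ∀ i, MeasurableSet (B i)) (hd : Pairwise fun i j => Disjoint (B i) (B j))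
    (hμ : ∀ i, μ (B i) ≠ ⊤) :
    P.real {ω | ∀ i, (X ω ∩ B i).encard = 1} =
      Real.exp (-∑ i, μ.real (B i)) * ∏ i, μ.real (B i) := by
  have := hX.prob_iInter hB hd fun _ => {1}
  simp only [mem_singleton_iff] at this
  rw [this, ← Finset.sum_neg_distrib, Real.exp_sum, ← Finset.prod_mul_distrib]
  exact Finset.prod_congr rfl fun i _ => hX.one_prob (hB i) (hμ i)

/-- A double hit of `B j` costs the square of its intensity; one of the two factors completes the
product and the other is the gain. -/
theorem prob_all_hit_two_le (hX : IsPoissonProcess P μ X) {k : ℕ} {B : Fin k → Set (SpaceTime d)}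
    (hB : ∀ i, MeasurableSet (B i)) (hd : Pairwise fun i j => Disjoint (B i) (B j))
    (hμ : ∀ i, μ (B i) ≠ ⊤) (j : Fin k) :
    P.real {ω | (∀ i, (X ω ∩ B i).Nonempty) ∧ 2 ≤ (X ω ∩ B j).encard} ≤
      μ.real (B j) * ∏ i, μ.real (B i) := by
  classical
  have h := hX.prob_iInter hB hd (Function.update (fun _ => {0}ᶜ) j {n | 2 ≤ n})
  have hsub : {ω | (∀ i, (X ω ∩ B i).Nonempty) ∧ 2 ≤ (X ω ∩ B j).encard} ⊆
      {ω | ∀ i, (X ω ∩ B i).encard ∈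
        Function.update (fun _ => ({0}ᶜ : Set ℕ∞)) j {n | 2 ≤ n} i} := by
    rintro ω ⟨h1, h2⟩ i
    by_cases hij : i = j
    · subst hij; simpa using h2
    · simpa [hij] using (h1 i).ne_empty
  refine (measureReal_mono hsub).trans (h.le.trans ?_)
  rw [← Finset.mul_prod_erase _ _ (Finset.mem_univ j),
    ← Finset.mul_prod_erase _ (fun i => μ.real (B i)) (Finset.mem_univ j), ← mul_assoc, ← sq]
  refine mul_le_mul ?_ ?_ (Finset.prod_nonneg fun _ _ => measureReal_nonneg) (sq_nonneg _)
  · simpa using hX.two_le_prob (hB j) (hμ j)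
  · refine Finset.prod_le_prod (fun _ _ => measureReal_nonneg) fun i hi => ?_
    rw [Function.update_of_ne (Finset.ne_of_mem_erase hi)]
    simpa [nonempty_iff_ne_empty] using hX.hit_le (hB i) (hμ i)

theorem hitSigma_le (hX : IsPoissonProcess P μ X) {N : Set (SpaceTime d)} (hN : MeasurableSet N) :
    hitSigma (fun ω => X ω ∩ N) ≤ mΩ := by
  refine MeasurableSpace.generateFrom_le ?_
  rintro _ ⟨A, hA, rfl⟩
  have := ((hX.hitMeas.inter hN) A hA).compl
  convert this using 1
  ext ω; simp [not_nonempty_iff_eq_empty]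

/-- The restrictions of a Poisson process to disjoint sets are independent. -/
theorem indep_hitSigma (hX : IsPoissonProcess P μ X) {N N' : Set (SpaceTime d)}
    (hN : MeasurableSet N) (hN' : MeasurableSet N') (hd : Disjoint N N') :
    Indep (hitSigma fun ω => X ω ∩ N) (hitSigma fun ω => X ω ∩ N') P := by
  have hpi : ∀ M : Set (SpaceTime d), IsPiSystem
      {s | ∃ A, MeasurableSet A ∧ s = {ω | X ω ∩ M ∩ A = ∅}} := by
    rintro M _ ⟨A, hA, rfl⟩ _ ⟨A', hA', rfl⟩ -
    -- Missing two sets means missing their union. This makes the void events a π-system, and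
    -- independence can be checked on them.
    refine ⟨A ∪ A', hA.union hA', ?_⟩
    ext ω; simp [inter_union_distrib_left]
  refine IndepSets.indep (hX.hitSigma_le hN) (hX.hitSigma_le hN') (hpi N) (hpi N') rfl rfl ?_
  rw [IndepSets_iff]
  rintro _ _ ⟨A, hA, rfl⟩ ⟨A', hA', rfl⟩
  have hdis : Pairwise fun i j : Fin 2 => Disjoint (![N ∩ A, N' ∩ A'] i) (![N ∩ A, N' ∩ A'] j) := by
    have h1 : Disjoint (N ∩ A) (N' ∩ A') := hd.mono inter_subset_left inter_subset_left
    intro i j hij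
    fin_cases i <;> fin_cases j <;> simp_all [h1.symm]
  have h := hX.indep 2 ![N ∩ A, N' ∩ A']
    (by intro i; fin_cases i <;> simp [hN.inter hA, hN'.inter hA']) hdis
  have h2 := (h.indepFun (show (0 : Fin 2) ≠ 1 by decide)).measure_inter_preimage_eq_mul {0} {0}
    (measurableSet_singleton _) (measurableSet_singleton _)
  simpa [preimage, inter_assoc] using h2

end IsPoissonProcess

/-! ### Cells -/

/-- The coordinatewise integer part of a point. -/
def floorVec (x : EuclideanSpace ℝ (Fin d)) : Fin d → ℤ := fun i => ⌊x i⌋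

theorem measurable_floorVec : Measurable (floorVec (d := d)) :=
  measurable_pi_lambda _ fun i => Int.measurable_floor.comp (by fun_prop)

/-- The points with spatial part in one of the unit cells of `K` and time in `[a, b)`. -/
def slab (K : Finset (Fin d → ℤ)) (a b : ℝ) : Set (SpaceTime d) :=
  {z | floorVec z.1 ∈ K ∧ z.2 ∈ Ico a b}

theorem measurableSet_slab (K : Finset (Fin d → ℤ)) (a b : ℝ) : MeasurableSet (slab K a b) := by
  have h : MeasurableSet {z : SpaceTime d | floorVec z.1 ∈ K} :=
    (measurable_floorVec.comp measurable_fst) K.measurableSet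
  exact h.inter (measurable_snd measurableSet_Ico)

/-- The intensity of every unit cell and unit of time is at most one, and negative times do not
occur. -/
structure IntensityBound (μ : Measure (SpaceTime d)) : Prop where
  cell_le : ∀ (c : Fin d → ℤ) (a b : ℝ), μ (slab {c} a b) ≤ ENNReal.ofReal (b - a)
  neg_null : μ {z | z.2 < 0} = 0

theorem IntensityBound.slab_le {μ : Measure (SpaceTime d)} (hμ : IntensityBound μ)
    (K : Finset (Fin d → ℤ)) (a b : ℝ) : μ (slab K a b) ≤ K.card * ENNReal.ofReal (b - a) := by
  have : slab K a b ⊆ ⋃ c ∈ K, slab {c} a b := by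
    rintro z ⟨h1, h2⟩
    exact mem_biUnion h1 ⟨Finset.mem_singleton_self _, h2⟩
  refine (measure_mono this).trans ((measure_biUnion_finset_le _ _).trans ?_)
  refine (Finset.sum_le_sum fun c _ => hμ.cell_le c a b).trans ?_
  simp

theorem IntensityBound.slab_ne_top {μ : Measure (SpaceTime d)} (hμ : IntensityBound μ)
    (K : Finset (Fin d → ℤ)) (a b : ℝ) : μ (slab K a b) ≠ ⊤ :=
  ne_top_of_le_ne_top (by finiteness) (hμ.slab_le K a b)

theorem IntensityBound.real_slab_le {μ : Measure (SpaceTime d)} (hμ : IntensityBound μ)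
    (K : Finset (Fin d → ℤ)) {a b : ℝ} (hab : a ≤ b) : μ.real (slab K a b) ≤ K.card * (b - a) := by
  refine ENNReal.toReal_le_of_le_ofReal (by have := sub_nonneg.2 hab; positivity) ?_
  refine (hμ.slab_le K a b).trans_eq ?_
  rw [ENNReal.ofReal_mul (by positivity), ENNReal.ofReal_natCast]

/-- The cells whose indices differ from `c` by at most `r` in each coordinate. -/
def nearCells (c : Fin d → ℤ) (r : ℕ) : Finset (Fin d → ℤ) :=
  Fintype.piFinset fun i => Finset.Icc (c i - r) (c i + r)

theorem mem_nearCells {c c' : Fin d → ℤ} {r : ℕ} :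
    c' ∈ nearCells c r ↔ ∀ i, |c' i - c i| ≤ r := by
  simp only [nearCells, Fintype.mem_piFinset, Finset.mem_Icc, abs_le]
  exact forall_congr' fun i => by constructor <;> intro h <;> constructor <;> linarith [h.1, h.2]

theorem card_nearCells (c : Fin d → ℤ) (r : ℕ) : (nearCells c r).card = (2 * r + 1) ^ d := by
  simp only [nearCells, Fintype.card_piFinset, Int.card_Icc]
  rw [Finset.prod_congr rfl (g := fun _ => 2 * r + 1) (fun i _ => by omega)]
  simp

theorem floorVec_mem_nearCells {x y : EuclideanSpace ℝ (Fin d)} {r : ℕ} (h : dist y x ≤ r) :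
    floorVec y ∈ nearCells (floorVec x) r := by
  rw [mem_nearCells]
  intro i
  have h1 : |y i - x i| ≤ r := by
    have := (EuclideanSpace.dist_eq y x) ▸ h
    have h2 : dist (y i) (x i) ≤ dist y x := by
      rw [EuclideanSpace.dist_eq]
      exact Real.le_sqrt_of_sq_le
        (Finset.single_le_sum (f := fun i => dist (y i) (x i) ^ 2) (fun _ _ => sq_nonneg _)
          (Finset.mem_univ i))
    rw [← Real.dist_eq]; exact h2.trans h
  rw [abs_le] at h1 ⊢
  have a1 : ⌊y i⌋ ≤ ⌊x i + (r : ℤ)⌋ := Int.floor_mono (by push_cast; linarith [h1.2])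
  have a2 : ⌊x i⌋ ≤ ⌊y i + (r : ℤ)⌋ := Int.floor_mono (by push_cast; linarith [h1.1])
  rw [Int.floor_add_intCast] at a1 a2
  simp only [floorVec]
  constructor <;> linarith

theorem IntensityBound.closedBall_ne_top {μ : Measure (SpaceTime d)} (hμ : IntensityBound μ)
    (r : ℝ) : μ (Metric.closedBall 0 r) ≠ ⊤ := by
  obtain ⟨m, hm⟩ := exists_nat_ge r
  have : Metric.closedBall (0 : SpaceTime d) r ⊆
      {z | z.2 < 0} ∪ slab (nearCells (floorVec 0) m) 0 (m + 1) := by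
    intro z hz
    rw [mem_closedBall_zero_iff, Prod.norm_def, max_le_iff] at hz
    by_cases h0 : z.2 < 0
    · exact Or.inl h0
    · refine Or.inr ⟨floorVec_mem_nearCells (by rw [dist_zero_right]; linarith), not_lt.1 h0, ?_⟩
      have := (le_abs_self z.2).trans hz.2
      linarith
  refine ne_top_of_le_ne_top ?_ (measure_mono this)
  refine ne_top_of_le_ne_top ?_ (measure_union_le _ _)
  rw [hμ.neg_null, zero_add]
  exact hμ.slab_ne_top _ _ _

/-! ### Collisions in time -/

/-- The `s`-th of `M` equal time slots of `[0, T)`. -/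
def slot (K : Finset (Fin d → ℤ)) (T : ℝ) (M s : ℕ) : Set (SpaceTime d) :=
  slab K (T * s / M) (T * (s + 1) / M)

/-- The slot index depends on the time alone, so `K'` is left free: one index serves a single cell
and the large region used to detect collisions. -/
theorem exists_mem_slot {K : Finset (Fin d → ℤ)} {T : ℝ} {M : ℕ} (hM : 0 < M) {z : SpaceTime d}
    (hz : z ∈ slab K 0 T) :
    ⌊z.2 * M / T⌋₊ < M ∧
      ∀ K' : Finset (Fin d → ℤ), floorVec z.1 ∈ K' → z ∈ slot K' T M ⌊z.2 * M / T⌋₊ := by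
  obtain ⟨-, h0, hT⟩ := hz
  have hTpos : 0 < T := h0.trans_lt hT
  have hM' : (0 : ℝ) < M := by exact_mod_cast hM
  have hnn : 0 ≤ z.2 * M / T := by positivity
  refine ⟨(Nat.floor_lt hnn).2 ?_, fun K' hz => ⟨hz, ?_, ?_⟩⟩
  · rw [div_lt_iff₀ hTpos, mul_comm]; gcongr
  · have := Nat.floor_le hnn
    rw [le_div_iff₀ hTpos] at this
    rw [div_le_iff₀ hM']; linarith
  · have := Nat.lt_floor_add_one (z.2 * M / T)
    rw [div_lt_iff₀ hTpos] at this
    rw [lt_div_iff₀ hM']; linarith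

namespace IsPoissonProcess

variable {μ : Measure (SpaceTime d)} {X : Ω → Set (SpaceTime d)}

/-- Each of the `M` slots has mean at most `K.card * T / M` and holds two points with at most the
square of that probability. The sum vanishes as `M` grows. -/
theorem collision_le (hX : IsPoissonProcess P μ X) (hμ : IntensityBound μ)
    (K : Finset (Fin d → ℤ)) {T : ℝ} (hT : 0 ≤ T) {M : ℕ} (hM : 0 < M) :
    P.real {ω | ∃ s < M, 2 ≤ (X ω ∩ slot K T M s).encard} ≤ (K.card * T) ^ 2 / M := by
  have hM' : (0 : ℝ) < M := by exact_mod_cast hM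
  have h1 : {ω | ∃ s < M, 2 ≤ (X ω ∩ slot K T M s).encard} ⊆
      ⋃ s ∈ Finset.range M, {ω | 2 ≤ (X ω ∩ slot K T M s).encard} := by
    rintro ω ⟨s, hs, h⟩
    exact mem_biUnion (Finset.mem_coe.2 (Finset.mem_range.2 hs)) h
  refine (measureReal_mono h1 (measure_ne_top _ _)).trans ((measureReal_biUnion_finset_le _ _).trans ?_)
  have h2 : ∀ s ∈ Finset.range M,
      P.real {ω | 2 ≤ (X ω ∩ slot K T M s).encard} ≤ (K.card * T / M) ^ 2 := by
    intro s _
    refine (hX.two_le_prob (measurableSet_slab _ _ _) (hμ.slab_ne_top _ _ _)).trans ?_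
    refine pow_le_pow_left₀ measureReal_nonneg ?_ 2
    refine (hμ.real_slab_le K (by gcongr; linarith)).trans_eq ?_
    field_simp; ring
  refine (Finset.sum_le_sum h2).trans_eq ?_
  rw [Finset.sum_const, Finset.card_range, nsmul_eq_mul]
  field_simp

/-- Two points with equal times share a slot at every resolution `M`, so their probability is below
every collision bound. -/
theorem ae_times_ne (hX : IsPoissonProcess P μ X) (hμ : IntensityBound μ)
    (K : Finset (Fin d → ℤ)) {T : ℝ} (hT : 0 ≤ T) :
    ∀ᵐ ω ∂P, InjOn Prod.snd (X ω ∩ slab K 0 T) := by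
  rw [ae_iff]
  have hle : ∀ M : ℕ, 0 < M →
      P.real {ω | ¬ InjOn Prod.snd (X ω ∩ slab K 0 T)} ≤ (K.card * T) ^ 2 / M := by
    intro M hM
    refine (measureReal_mono ?_).trans (hX.collision_le hμ K hT hM)
    intro ω hω
    simp only [mem_ofPred_eq, InjOn, not_forall] at hω
    obtain ⟨y, hy, z, hz, hyz, hne⟩ := hω
    refine ⟨_, (exists_mem_slot hM hy.2).1, ?_⟩
    have : 1 < (X ω ∩ slot K T M ⌊y.2 * M / T⌋₊).encard := one_lt_encard_iff.2
      ⟨y, z, ⟨hy.1, (exists_mem_slot hM hy.2).2 K hy.2.1⟩,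
        ⟨hz.1, hyz ▸ (exists_mem_slot hM hz.2).2 K hz.2.1⟩, hne⟩
    simpa [one_add_one_eq_two] using Order.add_one_le_of_lt this
  have h0 : P.real {ω | ¬ InjOn Prod.snd (X ω ∩ slab K 0 T)} ≤ 0 := by
    refine ge_of_tendsto (tendsto_const_div_atTop_nhds_zero_nat ((K.card * T) ^ 2)) ?_
    filter_upwards [eventually_gt_atTop 0] with M hM using hle M hM
  exact (measureReal_eq_zero_iff).1 (le_antisymm h0 measureReal_nonneg)

end IsPoissonProcess

/-- The properties that hold for almost every realisation of the input. -/
structure Nice (Y : Set (SpaceTime d)) : Prop where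
  locFin : LocFin Y
  time_nonneg : ∀ y ∈ Y, 0 ≤ y.2
  time_injOn : InjOn Prod.snd Y

theorem nice_empty : Nice (∅ : Set (SpaceTime d)) :=
  ⟨fun r => by simp, by simp, by simp⟩

/-! ### Almost sure regularity of the input -/

namespace IsPoissonProcess

variable {μ : Measure (SpaceTime d)} {X : Ω → Set (SpaceTime d)}

theorem ae_nice (hX : IsPoissonProcess P μ X) (hμ : IntensityBound μ) :
    ∀ᵐ ω ∂P, Nice (X ω) := by
  have h1 : ∀ᵐ ω ∂P, ∀ m : ℕ, (X ω ∩ Metric.closedBall 0 m).encard ≠ ⊤ :=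
    ae_all_iff.2 fun m => hX.ae_encard_ne_top Metric.isClosed_closedBall.measurableSet
      (hμ.closedBall_ne_top m)
  have h2 : ∀ᵐ ω ∂P, ¬ (X ω ∩ {z | z.2 < 0}).Nonempty := by
    rw [ae_iff]
    simp only [not_not]
    have hB : MeasurableSet {z : SpaceTime d | z.2 < 0} := measurable_snd measurableSet_Iio
    have := hX.hit_le hB (by simp [hμ.neg_null])
    rw [measureReal_def μ, hμ.neg_null, ENNReal.toReal_zero] at this
    exact (measureReal_eq_zero_iff).1 (le_antisymm this measureReal_nonneg)
  have h3 : ∀ᵐ ω ∂P, ∀ m : ℕ, InjOn Prod.snd (X ω ∩ slab (nearCells 0 m) 0 m) :=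
    ae_all_iff.2 fun m => hX.ae_times_ne hμ _ (by positivity)
  filter_upwards [h1, h2, h3] with ω a1 a2 a3
  have hnn : ∀ y ∈ X ω, 0 ≤ y.2 := fun y hy => not_lt.1 fun h => a2 ⟨y, hy, h⟩
  refine ⟨fun r => ?_, hnn, ?_⟩
  · obtain ⟨m, hm⟩ := exists_nat_ge r
    exact (encard_ne_top_iff.1 (a1 m)).subset
      (inter_subset_inter_right _ (Metric.closedBall_subset_closedBall hm))
  · intro y hy z hz hyz
    obtain ⟨m, hm⟩ := exists_nat_gt (‖y.1‖ + ‖z.1‖ + |y.2|)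
    have key : ∀ v ∈ X ω, ‖v.1‖ ≤ m → v.2 < m → v ∈ X ω ∩ slab (nearCells 0 m) 0 m := by
      intro v hv h1 h2
      refine ⟨hv, ?_, hnn v hv, h2⟩
      have := floorVec_mem_nearCells (x := 0) (y := v.1) (r := m) (by rwa [dist_zero_right])
      convert this using 2
      ext i; simp [floorVec]
    have := norm_nonneg y.1
    have := norm_nonneg z.1
    have := le_abs_self y.2
    have := abs_nonneg y.2
    refine a3 m (key y hy (by linarith) (by linarith)) (key z hz (by linarith) ?_) hyz
    rw [← hyz]; linarith

/-- Every Poisson process has a version all of whose realisations are nice. -/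
theorem exists_nice_version (hX : IsPoissonProcess P μ X) (hμ : IntensityBound μ) :
    ∃ Y : Ω → Set (SpaceTime d), (∀ ω, Nice (Y ω)) ∧ (∀ᵐ ω ∂P, Y ω = X ω) ∧
      IsPoissonProcess P μ Y := by
  classical
  have hnull : P {ω | ¬ Nice (X ω)} = 0 := ae_iff.1 (hX.ae_nice hμ)
  -- The exceptional null set is enlarged to a measurable one, so that emptying the configuration on
  -- it keeps the counts measurable.
  set N := toMeasurable P {ω | ¬ Nice (X ω)} with hN
  have hNm : MeasurableSet N := measurableSet_toMeasurable _ _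
  have hN0 : P N = 0 := by rw [hN, measure_toMeasurable, hnull]
  set Y : Ω → Set (SpaceTime d) := fun ω => if ω ∈ N then ∅ else X ω with hY
  have hYX : ∀ᵐ ω ∂P, Y ω = X ω := by
    have : ∀ᵐ ω ∂P, ω ∉ N := measure_eq_zero_iff_ae_notMem.1 hN0
    filter_upwards [this] with ω hω
    simp [hY, hω]
  refine ⟨Y, fun ω => ?_, hYX, hX.congr_ae hYX fun B hB => ?_⟩
  · by_cases h : ω ∈ N
    · simp [hY, h, nice_empty]
    · simp only [hY, h, if_false]
      by_contra hcon
      exact h (subset_toMeasurable _ _ hcon)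
  · have : (fun ω => (Y ω ∩ B).encard) = fun ω => if ω ∈ N then 0 else (X ω ∩ B).encard := by
      ext ω; by_cases h : ω ∈ N <;> simp [hY, h]
    rw [this]
    exact Measurable.ite hNm measurable_const (hX.measurable_count B hB)

end IsPoissonProcess

theorem hitProb_congr_ae {X Y : Ω → Set (SpaceTime d)} (h : ∀ᵐ ω ∂P, Y ω = X ω)
    (U : Set (SpaceTime d)) {k : ℕ} (w : Fin k → SpaceTime d) (ε : Fin k → ℝ) :
    hitProb P Y U w ε = hitProb P X U w ε := by
  refine measureReal_congr ?_
  filter_upwards [h] with ω hω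
  refine propext ?_
  change (∀ i, (accepted (Y ω) ∩ (fun u => w i + ε i • u) '' U).Nonempty) ↔
    ∀ i, (accepted (X ω) ∩ (fun u => w i + ε i • u) '' U).Nonempty
  rw [hω]

end

section

variable {d : ℕ} {Ω : Type*} [mΩ : MeasurableSpace Ω] {P : Measure Ω} [IsProbabilityMeasure P]

/-! ### Chains of overlapping balls -/

/-- The points of `Y` reached from a point of `Y ∩ A` by `n` steps, each from a ball to an earlier
overlapping one. -/
def chainSet (Y A : Set (SpaceTime d)) : ℕ → Set (SpaceTime d)
  | 0 => Y ∩ A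
  | n + 1 => related {p | Blocks p.2 p.1} Y (chainSet Y A n)

theorem chainSet_mono {Y Y' : Set (SpaceTime d)} (h : Y ⊆ Y') (A : Set (SpaceTime d)) (n : ℕ) :
    chainSet Y A n ⊆ chainSet Y' A n := by
  induction n with
  | zero => exact inter_subset_inter_left _ h
  | succ n ih => exact related_mono h ih

theorem HitMeas.chainSet {m : MeasurableSpace Ω} {Y : Ω → Set (SpaceTime d)} (hY : HitMeas m Y)
    {A : Set (SpaceTime d)} (hA : MeasurableSet A) (n : ℕ) :
    HitMeas m fun ω => chainSet (Y ω) A n := by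
  induction n with
  | zero => exact hY.inter hA
  | succ n ih =>
    refine hY.related ih ?_
    exact isOpen_blockSet.preimage continuous_swap

theorem exists_chain {Y A : Set (SpaceTime d)} {n : ℕ} {z : SpaceTime d}
    (hz : z ∈ chainSet Y A n) : ∃ f : ℕ → SpaceTime d, f 0 ∈ A ∧ (∀ j ≤ n, f j ∈ Y) ∧
      (∀ j < n, Blocks (f (j + 1)) (f j)) ∧ f n = z := by
  induction n generalizing z with
  | zero =>
    refine ⟨fun _ => z, hz.2, fun j _ => hz.1, by simp, rfl⟩
  | succ n ih =>
    obtain ⟨hzY, y, hy, hb⟩ := hz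
    obtain ⟨f, h0, h1, h2, h3⟩ := ih hy
    refine ⟨fun j => if j ≤ n then f j else z, by simpa using h0, fun j hj => ?_, fun j hj => ?_,
      by simp⟩
    · by_cases hjn : j ≤ n
      · simpa [hjn] using h1 j hjn
      · simpa [hjn] using hzY
    · rcases Nat.lt_succ_iff_lt_or_eq.1 hj with hjn | rfl
      · have : j + 1 ≤ n := hjn
        simpa [this, hjn.le] using h2 j hjn
      · simpa [h3] using hb

open scoped Classical in
/-- The increasing sequences of length `N` in `Fin M`. -/
def increasing (N M : ℕ) : Finset (Fin N → Fin M) :=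
  Finset.univ.filter StrictMono

theorem mem_increasing {N M : ℕ} {σ : Fin N → Fin M} : σ ∈ increasing N M ↔ StrictMono σ := by
  simp [increasing]

/-- An increasing sequence is determined by its image. This binomial coefficient is the source of
the factorial in the chain bound. -/
theorem card_increasing_le (N M : ℕ) : (increasing N M).card ≤ M.choose N := by
  classical
  have h := Finset.card_le_card_of_injOn (s := increasing N M)
    (t := Finset.powersetCard N (Finset.univ : Finset (Fin M))) (fun σ => Finset.univ.image σ)
    (fun σ hσ => ?_) ?_
  · simpa using h
  · have := (mem_increasing.1 hσ).injective
    simp [Finset.card_image_of_injective _ this]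
  · intro σ hσ τ hτ hστ
    have h1 := mem_increasing.1 hσ
    have h2 := mem_increasing.1 hτ
    have hc : (Finset.univ.image σ).card = N := by
      simp [Finset.card_image_of_injective _ h1.injective]
    have e1 := Finset.orderEmbOfFin_unique hc (f := σ) (fun x => by simp) h1
    have e2 := Finset.orderEmbOfFin_unique hc (f := τ)
      (fun x => by
        change Finset.univ.image σ = Finset.univ.image τ at hστ
        rw [hστ]; simp) h2
    rw [e1, e2]

open scoped Classical in
/-- The sequences of `N` cells starting near `c`, with steps of at most three. -/
def cellPaths (c : Fin d → ℤ) (N : ℕ) : Finset (Fin N → Fin d → ℤ) :=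
  (Fintype.piFinset fun _ : Fin N => nearCells (0 : Fin d → ℤ) 3).image
    fun p j => c + ∑ i : Fin N, if i ≤ j then p i else 0

/-- Each step has `(2 * 3 + 1) ^ d` choices. The step size three covers both the start, at distance
less than 3 from the centre, and the steps between overlapping balls. -/
theorem card_cellPaths_le (c : Fin d → ℤ) (N : ℕ) : (cellPaths c N).card ≤ (7 ^ d) ^ N := by
  classical
  refine Finset.card_image_le.trans ?_
  simp [Fintype.card_piFinset, card_nearCells]

theorem mem_cellPaths {c : Fin d → ℤ} {N : ℕ} {g : ℕ → Fin d → ℤ}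
    (h0 : g 0 - c ∈ nearCells 0 3) (h : ∀ j, j + 1 < N → g (j + 1) - g j ∈ nearCells 0 3) :
    (fun j : Fin N => g j) ∈ cellPaths c N := by
  classical
  -- The increments of `g`, the first one taken relative to `c`; their partial sums telescope.
  set q : ℕ → Fin d → ℤ := fun i => g i - (if i = 0 then c else g (i - 1)) with hq
  have hsum : ∀ j, ∑ i ∈ Finset.range (j + 1), q i = g j - c := by
    intro j
    induction j with
    | zero => simp [hq]
    | succ j ih => rw [Finset.sum_range_succ, ih]; simp [hq]
  refine Finset.mem_image.2 ⟨fun i => q i, ?_, ?_⟩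
  · refine Fintype.mem_piFinset.2 fun i => ?_
    rcases i with ⟨i, hi⟩
    cases i with
    | zero => simpa [hq] using h0
    | succ i => simpa [hq] using h i hi
  · funext j
    have : ∑ i : Fin N, (if i ≤ j then q i else 0) = ∑ i ∈ Finset.range ((j : ℕ) + 1), q i := by
      have e : ∑ i : Fin N, (if i ≤ j then q i else 0) =
          ∑ i : Fin N, (if (i : ℕ) ≤ j then q i else 0) := rfl
      rw [e, Fin.sum_univ_eq_sum_range (fun i => if i ≤ (j : ℕ) then q i else 0) N,
        ← Finset.sum_filter]
      refine Finset.sum_congr ?_ fun _ _ => rfl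
      ext i; simp only [Finset.mem_filter, Finset.mem_range]
      have := j.2
      omega
    rw [this, hsum]; abel

theorem floorVec_sub_mem {x y : EuclideanSpace ℝ (Fin d)} (h : dist y x < 3) :
    floorVec y - floorVec x ∈ nearCells 0 3 := by
  have := floorVec_mem_nearCells (r := 3) (by exact_mod_cast h.le : dist y x ≤ (3 : ℕ))
  rw [mem_nearCells] at this ⊢
  simpa using this

theorem cellPaths_mem_nearCells {c : Fin d → ℤ} {N : ℕ} {g : Fin N → Fin d → ℤ}
    (hg : g ∈ cellPaths c N) (j : Fin N) : g j ∈ nearCells c (3 * N) := by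
  classical
  obtain ⟨p, hp, rfl⟩ := Finset.mem_image.1 hg
  rw [mem_nearCells]
  intro i
  have hp' : ∀ a, |p a i| ≤ 3 := fun a => by
    have := mem_nearCells.1 (Fintype.mem_piFinset.1 hp a) i
    simpa using this
  simp only [Pi.add_apply, Finset.sum_apply, add_sub_cancel_left]
  refine (Finset.abs_sum_le_sum_abs _ _).trans ?_
  refine (Finset.sum_le_card_nsmul _ _ 3 fun a _ => ?_).trans ?_
  · by_cases h : a ≤ j <;> simp [h, hp' a]
  · simp [mul_comm]

theorem disjoint_slot {K K' : Finset (Fin d → ℤ)} {T : ℝ} (hT : 0 ≤ T) {M s s' : ℕ}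
    (h : s ≠ s') : Disjoint (slot K T M s) (slot K' T M s') := by
  rw [disjoint_left]
  rintro z ⟨-, h1, h2⟩ ⟨-, h3, h4⟩
  rcases lt_or_gt_of_ne h with h | h
  · have : T * (s + 1) / M ≤ T * s' / M := by
      gcongr; exact_mod_cast h
    linarith
  · have : T * (s' + 1) / M ≤ T * s / M := by
      gcongr; exact_mod_cast h
    linarith

/-- Chains of `n + 1` balls have factorially small probability. -/
theorem IsPoissonProcess.chain_le {μ : Measure (SpaceTime d)} {X : Ω → Set (SpaceTime d)}
    (hX : IsPoissonProcess P μ X) (hμ : IntensityBound μ) (h0 : ∀ ω, ∀ y ∈ X ω, 0 ≤ y.2)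
    {T : ℝ} (hT : 0 ≤ T) {x : EuclideanSpace ℝ (Fin d)} {A : Set (SpaceTime d)}
    (hA : ∀ z ∈ A, dist z.1 x < 3 ∧ z.2 < T) (n : ℕ) :
    P.real {ω | (chainSet (X ω) A n).Nonempty} ≤ (7 ^ d * T) ^ (n + 1) / (n + 1).factorial := by
  set N := n + 1 with hN
  set c := floorVec x
  set K := nearCells c (3 * N)
  -- Time is cut into `M` slots. The error from two points in one slot disappears as `M` tends to
  -- infinity.
  have key : ∀ M : ℕ, 0 < M → P.real {ω | (chainSet (X ω) A n).Nonempty} ≤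
      (7 ^ d * T) ^ N / N.factorial + (K.card * T) ^ 2 / M := by
    intro M hM
    have hM' : (0 : ℝ) < M := by exact_mod_cast hM
    have hsub : {ω | (chainSet (X ω) A n).Nonempty} ⊆
        (⋃ g ∈ cellPaths c N, ⋃ σ ∈ increasing N M,
          {ω | ∀ j, (X ω ∩ slot {g j} T M (σ j.rev)).Nonempty}) ∪
        {ω | ∃ s < M, 2 ≤ (X ω ∩ slot K T M s).encard} := by
      rintro ω ⟨z, hz⟩
      obtain ⟨f, hfA, hfX, hfb, -⟩ := exists_chain hz
      by_cases hcol : ∃ s < M, 2 ≤ (X ω ∩ slot K T M s).encard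
      · exact Or.inr hcol
      refine Or.inl ?_
      have hcells : (fun j : Fin N => floorVec (f j).1) ∈ cellPaths c N := by
        refine mem_cellPaths (g := fun j => floorVec (f j).1) (floorVec_sub_mem (hA _ hfA).1)
          fun j hj => floorVec_sub_mem ?_
        have := (hfb j (by omega)).2
        linarith
      have htime : ∀ j ≤ n, (f j).2 < T := by
        intro j
        induction j with
        | zero => exact fun _ => (hA _ hfA).2
        | succ j ih => exact fun hj => (hfb j (by omega)).1.trans (ih (by omega))
      have hslab : ∀ j : Fin N, f j ∈ slab K 0 T := fun j =>
        ⟨cellPaths_mem_nearCells hcells j, h0 ω _ (hfX j (by omega)), htime j (by omega)⟩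
      set τ : ℕ → ℕ := fun j => ⌊(f j).2 * M / T⌋₊ with hτ
      have hτM : ∀ j : Fin N, τ j < M := fun j => (exists_mem_slot hM (hslab j)).1
      -- Times decrease along the chain, and without collisions consecutive balls lie in different
      -- slots. Reversal gives an increasing sequence.
      have hanti : StrictAnti fun j : Fin N => (⟨τ j, hτM j⟩ : Fin M) := by
        refine Fin.strictAnti_iff_succ_lt.2 fun j => ?_
        have hjb := hfb j j.2
        have hle : τ (j + 1) ≤ τ j := by
          simp only [hτ]
          have := hjb.1.le
          gcongr
        refine lt_of_le_of_ne hle fun heq => hcol ⟨τ j, hτM j.castSucc, ?_⟩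
        have heq' : τ (j + 1) = τ j := congrArg Fin.val heq
        have h1 := (exists_mem_slot hM (hslab j.castSucc)).2 K (hslab j.castSucc).1
        have h2 := (exists_mem_slot hM (hslab j.succ)).2 K (hslab j.succ).1
        have : 1 < (X ω ∩ slot K T M (τ j)).encard := one_lt_encard_iff.2
          ⟨f j, f (j + 1), ⟨hfX j (by omega), h1⟩, ⟨hfX (j + 1) (by omega), ?_⟩,
            fun h => hjb.1.ne (congrArg Prod.snd h.symm)⟩
        · simpa [one_add_one_eq_two] using Order.add_one_le_of_lt this
        · rw [← heq']; exact h2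
      refine mem_biUnion (Finset.mem_coe.2 hcells) (mem_biUnion
        (x := fun j : Fin N => (⟨τ j.rev, hτM j.rev⟩ : Fin M))
        (Finset.mem_coe.2 (mem_increasing.2 fun a b hab => hanti (Fin.rev_lt_rev.2 hab))) ?_)
      intro j
      refine ⟨f j, hfX j (by omega), ?_⟩
      have := (exists_mem_slot hM (hslab j)).2 {floorVec (f j).1} (Finset.mem_singleton_self _)
      simpa using this
    refine (measureReal_mono hsub (measure_ne_top _ _)).trans ((measureReal_union_le _ _).trans
      (add_le_add ?_ (hX.collision_le hμ K hT hM)))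
    -- For a prescribed path and prescribed distinct slots the visited boxes are disjoint, so the
    -- hits are independent.
    have hterm : ∀ g ∈ cellPaths c N, ∀ σ ∈ increasing N M,
        P.real {ω | ∀ j, (X ω ∩ slot {g j} T M (σ j.rev)).Nonempty} ≤ (T / M) ^ N := by
      intro g _ σ hσ
      refine (hX.prob_all_hit_le (fun j => measurableSet_slab _ _ _) (fun i j hij => ?_)
        fun j => hμ.slab_ne_top _ _ _).trans ?_
      · refine disjoint_slot hT fun h => hij ?_
        exact Fin.rev_injective ((mem_increasing.1 hσ).injective (Fin.val_injective h))
      · refine (Finset.prod_le_prod (fun _ _ => measureReal_nonneg) (g := fun _ => T / M)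
          fun j _ => ?_).trans_eq (by simp [div_pow])
        refine (hμ.real_slab_le _ (by gcongr; linarith)).trans_eq ?_
        rw [Finset.card_singleton]; field_simp; simp
    calc P.real (⋃ g ∈ cellPaths c N, ⋃ σ ∈ increasing N M,
          {ω | ∀ j, (X ω ∩ slot {g j} T M (σ j.rev)).Nonempty})
        ≤ ∑ g ∈ cellPaths c N, ∑ σ ∈ increasing N M, (T / M) ^ N := by
          refine (measureReal_biUnion_finset_le _ _).trans (Finset.sum_le_sum fun g hg => ?_)
          exact (measureReal_biUnion_finset_le _ _).trans
            (Finset.sum_le_sum fun σ hσ => hterm g hg σ hσ)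
      _ = (cellPaths c N).card * ((increasing N M).card * (T / M) ^ N) := by simp
      -- The choice of slots contributes at most `M ^ N / N!`, whose power of `M` cancels the slot
      -- length.
      _ ≤ (7 ^ d) ^ N * ((M : ℝ) ^ N / N.factorial * (T / M) ^ N) := by
          gcongr
          · exact_mod_cast card_cellPaths_le c N
          · exact le_trans (by exact_mod_cast card_increasing_le N M) (Nat.choose_le_pow_div N M)
      _ = (7 ^ d * T) ^ N / N.factorial := by
          rw [div_pow, mul_pow]; field_simp
  refine ge_of_tendsto (x := atTop (α := ℕ)) (b := _) ?_ ?_ (f := fun M : ℕ =>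
    (7 ^ d * T) ^ N / N.factorial + (K.card * T) ^ 2 / (M : ℝ))
  · simpa using (tendsto_const_div_atTop_nhds_zero_nat ((K.card * T : ℝ) ^ 2)).const_add
      ((7 ^ d * T) ^ N / (N.factorial : ℝ))
  · filter_upwards [eventually_gt_atTop 0] with M hM using key M hM

end

section

variable {d : ℕ} {Ω : Type*} [mΩ : MeasurableSpace Ω] {P : Measure Ω} [IsProbabilityMeasure P]

theorem Nice.mono {Y Z : Set (SpaceTime d)} (h : Nice Y) (hZ : Z ⊆ Y) : Nice Z :=
  ⟨h.locFin.mono hZ, fun y hy => h.time_nonneg y (hZ hy), h.time_injOn.mono hZ⟩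

/-! ### Replacing the points in small sets by fixed points -/

/-- If `X` has exactly one point in each of the well separated sets `B i` and no point for which it
matters where in `B i` this point is, then it may be moved to `w i`. -/
theorem accepted_replace {k : ℕ} {B bad : Fin k → Set (SpaceTime d)} {w : Fin k → SpaceTime d}
    (hw : ∀ i, w i ∈ B i)
    (hsep : ∀ i j, i ≠ j → ∀ y ∈ B i, ∀ z ∈ B j, 2 ≤ dist y.1 z.1)
    (hblock : ∀ i, ∀ z ∉ bad i, ∀ y ∈ B i,
      (Blocks z y ↔ Blocks z (w i)) ∧ (Blocks y z ↔ Blocks (w i) z))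
    {X : Set (SpaceTime d)} (hone : ∀ i, (X ∩ B i).encard = 1)
    (hbad : ∀ z ∈ X, z ∉ ⋃ i, B i → ∀ i, z ∉ bad i) :
    (∀ i, (accepted X ∩ B i).Nonempty) ↔
      ∀ i, w i ∈ accepted (X ∩ (⋃ i, B i)ᶜ ∪ range w) := by
  classical
  have hdisj : ∀ i j, ∀ z, z ∈ B i → z ∈ B j → i = j := by
    intro i j z hi hj
    by_contra hne
    have := hsep i j hne z hi z hj
    rw [dist_self] at this
    linarith
  choose y hy using fun i => encard_eq_one.1 (hone i)
  have hyX : ∀ i, y i ∈ X := fun i => ((hy i).symm ▸ mem_singleton _ : y i ∈ X ∩ B i).1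
  have hyB : ∀ i, y i ∈ B i := fun i => ((hy i).symm ▸ mem_singleton _ : y i ∈ X ∩ B i).2
  have hyu : ∀ i, ∀ z ∈ X, z ∈ B i → z = y i := fun i z hz hzB =>
    (hy i ▸ ⟨hz, hzB⟩ : z ∈ ({y i} : Set _))
  -- Every `B i` is collapsed to `w i`, and all other points stay fixed. It remains to see that `f`
  -- respects blocking on `X`.
  set f : SpaceTime d → SpaceTime d := fun z => if h : ∃ i, z ∈ B i then w h.choose else z with hf
  have hfB : ∀ i, ∀ z ∈ B i, f z = w i := by
    intro i z hz
    have h : ∃ i, z ∈ B i := ⟨i, hz⟩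
    simp only [hf, h, dif_pos]
    rw [hdisj _ _ z h.choose_spec hz]
  have hfn : ∀ z, (¬ ∃ i, z ∈ B i) → f z = z := fun z h => by simp only [hf, h, dif_neg,
    not_false_eq_true]
  have hcases : ∀ z, (∃ i, z ∈ B i) ∨ (z ∉ ⋃ i, B i) ∧ ¬ ∃ i, z ∈ B i := by
    intro z
    by_cases h : ∃ i, z ∈ B i
    · exact Or.inl h
    · exact Or.inr ⟨by simpa using h, h⟩
  have h1 : ∀ z ∈ X, f z ∈ X ∩ (⋃ i, B i)ᶜ ∪ range w := by
    intro z hz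
    rcases hcases z with ⟨i, hi⟩ | ⟨h, h'⟩
    · exact Or.inr ⟨i, (hfB i z hi).symm⟩
    · exact Or.inl (by rw [hfn z h']; exact ⟨hz, h⟩)
  have h2 : ∀ v ∈ X ∩ (⋃ i, B i)ᶜ ∪ range w, ∃ z ∈ X, f z = v := by
    rintro v (⟨hv, hvB⟩ | ⟨i, rfl⟩)
    · exact ⟨v, hv, hfn v (by simpa using hvB)⟩
    · exact ⟨y i, hyX i, hfB i _ (hyB i)⟩
  -- Within one `B i` both points are the same point, and between different ones there is no
  -- overlap. Mixed pairs are covered by `hblock`.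
  have h3 : ∀ z ∈ X, ∀ z' ∈ X, (Blocks z' z ↔ Blocks (f z') (f z)) := by
    intro z hz z' hz'
    rcases hcases z with ⟨i, hi⟩ | ⟨h, h'⟩ <;> rcases hcases z' with ⟨j, hj⟩ | ⟨g, g'⟩
    · rw [hfB i z hi, hfB j z' hj]
      by_cases hij : i = j
      · subst hij
        rw [hyu i z hz hi, hyu i z' hz' hj]
        exact iff_of_false (Blocks.irrefl _) (Blocks.irrefl _)
      · refine iff_of_false (fun hb => ?_) fun hb => ?_
        · exact absurd hb.2 (not_lt.2 (hsep j i (Ne.symm hij) z' hj z hi))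
        · exact absurd hb.2 (not_lt.2 (hsep j i (Ne.symm hij) _ (hw j) _ (hw i)))
    · rw [hfB i z hi, hfn z' g']
      exact (hblock i z' (hbad z' hz' g i) z hi).1
    · rw [hfn z h', hfB j z' hj]
      exact (hblock j z (hbad z hz h j) z' hj).2
    · rw [hfn z h', hfn z' g']
  refine forall_congr' fun i => ⟨?_, fun h => ?_⟩
  · rintro ⟨z, hz, hzB⟩
    have := Decision.map h1 h2 h3 hz
    rwa [hfB i z hzB] at this
  · exact ⟨y i, Decision.of_map h1 h2 h3 h (y i) (hyX i) (hfB i _ (hyB i)), hyB i⟩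

variable {μ : Measure (SpaceTime d)} {X : Ω → Set (SpaceTime d)}

theorem HitMeas.mem_accepted {m : MeasurableSpace Ω} {Y : Ω → Set (SpaceTime d)}
    (hY : HitMeas m Y) (hfin : ∀ ω, LocFin (Y ω)) (h0 : ∀ ω, ∀ y ∈ Y ω, 0 ≤ y.2)
    (w : SpaceTime d) : MeasurableSet[m] {ω | w ∈ RSA.accepted (Y ω)} := by
  have := hY.accepted hfin h0 {w} (measurableSet_singleton w)
  convert this using 2 with ω
  simp

/-- The probability of accepted points in the small sets `B i`, compared to the probability that
fixed points `w i` are accepted when they are added to the input. -/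
theorem IsPoissonProcess.hit_accepted_approx (hX : IsPoissonProcess P μ X)
    (hn : ∀ ω, Nice (X ω)) {k : ℕ} {B bad : Fin k → Set (SpaceTime d)}
    {w : Fin k → SpaceTime d} (hB : ∀ i, MeasurableSet (B i)) (hμB : ∀ i, μ (B i) ≠ ⊤)
    (hw : ∀ i, w i ∈ B i) (hw0 : ∀ i, 0 ≤ (w i).2)
    (hsep : ∀ i j, i ≠ j → ∀ y ∈ B i, ∀ z ∈ B j, 2 ≤ dist y.1 z.1)
    (hbad : ∀ i, MeasurableSet (bad i)) (hμbad : ∀ i, μ (bad i) ≠ ⊤)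
    (hblock : ∀ i, ∀ z ∉ bad i, ∀ y ∈ B i,
      (Blocks z y ↔ Blocks z (w i)) ∧ (Blocks y z ↔ Blocks (w i) z)) :
    |P.real {ω | ∀ i, (accepted (X ω) ∩ B i).Nonempty} -
        (∏ i, μ.real (B i)) * P.real {ω | ∀ i, w i ∈ accepted (X ω ∪ range w)}| ≤
      (∏ i, μ.real (B i)) * (3 * ∑ i, μ.real (B i) + ∑ i, μ.real (bad i)) := by
  have hdisj : Pairwise fun i j => Disjoint (B i) (B j) := by
    intro i j hij
    rw [disjoint_left]
    intro z hi hj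
    have := hsep i j hij z hi z hj
    rw [dist_self] at this
    linarith
  set U := ⋃ i, B i with hU
  have hUm : MeasurableSet U := MeasurableSet.iUnion hB
  set L := ∏ i, μ.real (B i) with hL
  set S := ∑ i, μ.real (B i) with hS
  have hL0 : 0 ≤ L := Finset.prod_nonneg fun _ _ => measureReal_nonneg
  have hS0 : 0 ≤ S := Finset.sum_nonneg fun _ _ => measureReal_nonneg
  set hit := {ω | ∀ i, (accepted (X ω) ∩ B i).Nonempty} with hhit
  set One := {ω | ∀ i, (X ω ∩ B i).encard = 1} with hOne
  set G := {ω | ∀ i, w i ∈ accepted (X ω ∪ range w)} with hG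
  set Gout := {ω | ∀ i, w i ∈ accepted (X ω ∩ Uᶜ ∪ range w)} with hGout
  have hOneP : P.real One = Real.exp (-S) * L := hX.prob_all_one hB hdisj hμB
  have hUB : ∀ ω i, X ω ∩ U ∩ B i = X ω ∩ B i := fun ω i => by
    rw [inter_assoc, inter_eq_self_of_subset_right (subset_iUnion B i)]
  have hOnem : MeasurableSet[hitSigma fun ω => X ω ∩ U] One := by
    have : One = ⋂ i, {ω | (X ω ∩ U ∩ B i).encard = 1} := by
      ext ω; simp only [hOne, mem_ofPred_eq, mem_iInter, hUB]
    rw [this]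
    exact MeasurableSet.iInter fun i => (hitMeas_hitSigma _).encard_eq_one (hB i)
  have hind := hX.indep_hitSigma hUm hUm.compl disjoint_compl_right
  have hindep : ∀ E, MeasurableSet[hitSigma fun ω => X ω ∩ Uᶜ] E →
      P.real (One ∩ E) = P.real One * P.real E := by
    intro E hE
    have := (Indep_iff _ _ _).1 hind One E hOnem hE
    simp only [Measure.real, this, ENNReal.toReal_mul]
  -- Cost of a second point in some `B j`. The final constant 3 collects this error, the factor `exp
  -- (-S)` in `e3`, and the forgetting of the restriction to `Uᶜ` in `e4` and `e5`.
  have e1 : |P.real hit - P.real (hit ∩ One)| ≤ L * S := by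
    refine (abs_measureReal_sub_le (P := P)
      (C := ⋃ j ∈ Finset.univ, {ω | (∀ i, (X ω ∩ B i).Nonempty) ∧ 2 ≤ (X ω ∩ B j).encard})
      ?_ ?_).trans ?_
    · intro ω hω
      by_cases h1 : ω ∈ One
      · exact Or.inl ⟨hω, h1⟩
      · refine Or.inr ?_
        have hne : ∀ i, (X ω ∩ B i).Nonempty := fun i =>
          (hω i).mono (inter_subset_inter_left _ (accepted_subset _))
        simp only [hOne, mem_ofPred_eq, encard_eq_one_iff_hit, not_forall] at h1
        obtain ⟨j, hj⟩ := h1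
        exact mem_biUnion (Finset.mem_univ j)
          ⟨hne, by by_contra h2; exact hj ⟨hne j, h2⟩⟩
    · exact inter_subset_left.trans subset_union_left
    · refine (measureReal_biUnion_finset_le _ _).trans ?_
      refine (Finset.sum_le_sum fun j _ => hX.prob_all_hit_two_le hB hdisj hμB j).trans_eq ?_
      rw [← Finset.sum_mul, mul_comm]
  -- Given `One`, moving the points can matter only if the input outside `U` meets a bad set. That
  -- event is independent of `One`, which preserves the factor `L`.
  have e2 : |P.real (hit ∩ One) - P.real (One ∩ Gout)| ≤ L * ∑ i, μ.real (bad i) := by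
    refine (abs_measureReal_sub_le (P := P)
      (C := One ∩ {ω | (X ω ∩ Uᶜ ∩ ⋃ i, bad i).Nonempty}) ?_ ?_).trans ?_
    · rintro ω ⟨h1, h2⟩
      by_cases h3 : (X ω ∩ Uᶜ ∩ ⋃ i, bad i).Nonempty
      · exact Or.inr ⟨h2, h3⟩
      · refine Or.inl ⟨h2, (accepted_replace hw hsep hblock h2 fun z hz hzU i hzb => ?_).1 h1⟩
        exact h3 ⟨z, ⟨hz, hzU⟩, mem_iUnion.2 ⟨i, hzb⟩⟩
    · rintro ω ⟨h2, h1⟩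
      by_cases h3 : (X ω ∩ Uᶜ ∩ ⋃ i, bad i).Nonempty
      · exact Or.inr ⟨h2, h3⟩
      · refine Or.inl ⟨(accepted_replace hw hsep hblock h2 fun z hz hzU i hzb => ?_).2 h1, h2⟩
        exact h3 ⟨z, ⟨hz, hzU⟩, mem_iUnion.2 ⟨i, hzb⟩⟩
    · rw [hindep _ (hitMeas_hitSigma (fun ω => X ω ∩ Uᶜ) _ (MeasurableSet.iUnion hbad)), hOneP]
      refine mul_le_mul ?_ ?_ measureReal_nonneg hL0
      · exact mul_le_of_le_one_left hL0 (Real.exp_le_one_iff.2 (neg_nonpos.2 hS0))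
      · refine (measureReal_mono (s₂ := ⋃ i ∈ Finset.univ, {ω | (X ω ∩ bad i).Nonempty}) ?_
          (measure_ne_top _ _)).trans ?_
        · rintro ω ⟨z, ⟨hz, -⟩, hzb⟩
          obtain ⟨i, hi⟩ := mem_iUnion.1 hzb
          exact mem_biUnion (Finset.mem_univ i) ⟨z, hz, hi⟩
        · exact (measureReal_biUnion_finset_le _ _).trans
            (Finset.sum_le_sum fun i _ => hX.hit_le (hbad i) (hμbad i))
  have e3 : |P.real (One ∩ Gout) - L * P.real Gout| ≤ L * S := by
    have hm : MeasurableSet[hitSigma fun ω => X ω ∩ Uᶜ] Gout := by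
      have : Gout = ⋂ i, {ω | w i ∈ accepted (X ω ∩ Uᶜ ∪ range w)} := by ext ω; simp [hGout]
      rw [this]
      refine MeasurableSet.iInter fun i =>
        ((hitMeas_hitSigma _).union_const (range w)).mem_accepted (fun ω => ?_) ?_ (w i)
      · exact ((hn ω).locFin.mono inter_subset_left).union_finite (finite_range w)
      · rintro ω y (hy | ⟨i, rfl⟩)
        · exact (hn ω).time_nonneg y hy.1
        · exact hw0 i
    rw [hindep _ hm, hOneP]
    have h1 := Real.add_one_le_exp (-S)
    have h2 : Real.exp (-S) ≤ 1 := Real.exp_le_one_iff.2 (neg_nonpos.2 hS0)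
    have h3 : (0 : ℝ) ≤ P.real Gout := measureReal_nonneg
    have h4 : P.real Gout ≤ 1 := measureReal_le_one
    have h5 : Real.exp (-S) * L * P.real Gout - L * P.real Gout =
        -(L * ((1 - Real.exp (-S)) * P.real Gout)) := by ring
    rw [h5, abs_neg, abs_of_nonneg (by have := sub_nonneg.2 h2; positivity)]
    gcongr
    calc (1 - Real.exp (-S)) * P.real Gout ≤ S * 1 := by
          gcongr; linarith
      _ = S := mul_one S
  have e4 : |P.real Gout - P.real G| ≤ S := by
    refine (abs_measureReal_sub_le (P := P)
      (C := ⋃ i ∈ Finset.univ, {ω | (X ω ∩ B i).Nonempty}) ?_ ?_).trans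
      ((measureReal_biUnion_finset_le _ _).trans
        (Finset.sum_le_sum fun i _ => hX.hit_le (hB i) (hμB i)))
    all_goals
      intro ω hω
      by_cases h : ω ∈ ⋃ i ∈ Finset.univ, {ω | (X ω ∩ B i).Nonempty}
      · exact Or.inr h
      · refine Or.inl ?_
        have h' : X ω ∩ Uᶜ = X ω := by
          refine inter_eq_left.2 fun z hz hzU => h ?_
          obtain ⟨i, hi⟩ := mem_iUnion.1 hzU
          exact mem_biUnion (Finset.mem_univ i) ⟨z, hz, hi⟩
        simpa only [hGout, hG, mem_ofPred_eq, h'] using hω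
  have e5 : |L * P.real Gout - L * P.real G| ≤ L * S := by
    rw [← mul_sub, abs_mul, abs_of_nonneg hL0]
    gcongr
  rw [abs_le] at *
  constructor <;> linarith [e1.1, e1.2, e2.1, e2.2, e3.1, e3.2, e5.1, e5.2]

/-! ### Localisation and approximate independence -/

theorem chainSet_dist_lt {Y A : Set (SpaceTime d)} {x : EuclideanSpace ℝ (Fin d)}
    (hA : ∀ a ∈ A, dist a.1 x < 3) {m : ℕ} {z : SpaceTime d} (hz : z ∈ chainSet Y A m) :
    dist z.1 x < 2 * m + 3 := by
  induction m generalizing z with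
  | zero => simpa using hA z hz.2
  | succ m ih =>
    obtain ⟨-, y, hy, hb⟩ := hz
    have h1 := ih hy
    have h2 : dist z.1 y.1 < 2 := hb.2
    have := dist_triangle z.1 y.1 x
    push_cast; linarith

/-- The points within distance three of `x` that arrive before time `T`. -/
def startSet (x : EuclideanSpace ℝ (Fin d)) (T : ℝ) : Set (SpaceTime d) :=
  {z | dist z.1 x < 3 ∧ z.2 < T}

theorem measurableSet_startSet (x : EuclideanSpace ℝ (Fin d)) (T : ℝ) :
    MeasurableSet (startSet x T) :=
  ((isOpen_lt (by fun_prop) (by fun_prop)).inter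
    (isOpen_lt (by fun_prop) (by fun_prop)) : IsOpen
      ({z : SpaceTime d | dist z.1 x < 3} ∩ {z | z.2 < T})).measurableSet

/-- The points within distance `R` of one of the centres `x i`, `i ∈ J`. -/
def neighbourhood {m : ℕ} (x : Fin m → EuclideanSpace ℝ (Fin d)) (J : Set (Fin m)) (R : ℝ) :
    Set (SpaceTime d) := {z | ∃ i ∈ J, dist z.1 (x i) < R}

theorem measurableSet_neighbourhood {m : ℕ} (x : Fin m → EuclideanSpace ℝ (Fin d))
    (J : Set (Fin m)) (R : ℝ) : MeasurableSet (neighbourhood x J R) := by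
  have : neighbourhood x J R = ⋃ i ∈ J, {z : SpaceTime d | dist z.1 (x i) < R} := by
    ext z; simp [neighbourhood]
  rw [this]
  exact (isOpen_biUnion fun i _ => isOpen_lt (by fun_prop) (by fun_prop)).measurableSet

/-- Without long chains, acceptance in the sets `B i`, `i ∈ J`, is determined near these sets. -/
theorem accepted_localize {m : ℕ} {B : Fin m → Set (SpaceTime d)}
    {x : Fin m → EuclideanSpace ℝ (Fin d)} {T : ℝ}
    (hB : ∀ i, ∀ y ∈ B i, dist y.1 (x i) ≤ 1 ∧ y.2 < T) {J : Set (Fin m)} {n : ℕ}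
    (hJ : ∀ i ∈ J, ∀ j ∉ J, 4 * (n : ℝ) + 4 ≤ dist (x i) (x j)) {X : Set (SpaceTime d)}
    (hch : ∀ i, ¬ (chainSet (X ∩ (⋃ i, B i)ᶜ) (startSet (x i) T) n).Nonempty)
    {i : Fin m} (hi : i ∈ J) :
    accepted X ∩ B i = accepted (X ∩ neighbourhood x J (2 * n + 2)) ∩ B i := by
  set Y := X ∩ (⋃ i, B i)ᶜ with hY
  -- The points of `X` in the small sets of the group, and those reached from its start sets in
  -- fewer than `n` steps that avoid all small sets. The absence of longer chains makes `S` closed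
  -- under taking blockers.
  set S := {z ∈ X | (∃ i ∈ J, z ∈ B i) ∨
    ∃ i ∈ J, ∃ q < n, z ∈ chainSet Y (startSet (x i) T) q} with hS
  have hn0 : (0 : ℝ) ≤ n := Nat.cast_nonneg n
  have hdist : ∀ z ∈ S, ∃ i ∈ J, dist z.1 (x i) < 2 * n + 2 ∧ dist z.1 (x i) ≤ 2 * n + 1 := by
    rintro z ⟨-, ⟨i, hi, hz⟩ | ⟨i, hi, q, hq, hz⟩⟩
    · have := (hB i z hz).1
      exact ⟨i, hi, by linarith, by linarith⟩
    · have h1 := chainSet_dist_lt (fun a ha => ha.1) hz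
      have h2 : (q : ℝ) + 1 ≤ n := by exact_mod_cast hq
      exact ⟨i, hi, by linarith, by linarith⟩
  have hclosed : ∀ y ∈ S, ∀ z ∈ X, Blocks z y → z ∈ S := by
    intro y hy z hz hb
    refine ⟨hz, ?_⟩
    by_cases hzU : z ∈ ⋃ i, B i
    · obtain ⟨j, hj⟩ := mem_iUnion.1 hzU
      refine Or.inl ⟨j, ?_, hj⟩
      -- A blocker in a small set of the other group would bring two centres within `(2 n + 1) + 2 +
      -- 1`, less than the assumed separation.
      by_contra hjJ
      obtain ⟨i, hi, -, h1⟩ := hdist y hy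
      have h2 := hJ i hi j hjJ
      have h3 := (hB j z hj).1
      have h4 : dist z.1 y.1 < 2 := hb.2
      have h5 := dist_triangle (x i) y.1 (x j)
      have h6 := dist_triangle y.1 z.1 (x j)
      rw [dist_comm (x i) y.1] at h5
      rw [dist_comm y.1 z.1] at h6
      linarith
    · have hzY : z ∈ Y := ⟨hz, hzU⟩
      refine Or.inr ?_
      rcases hy with ⟨-, ⟨i, hi, hyB⟩ | ⟨i, hi, q, hq, hyq⟩⟩
      · have h1 := hB i y hyB
        have h4 : dist z.1 y.1 < 2 := hb.2
        have h5 := dist_triangle z.1 y.1 (x i)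
        have hz0 : z ∈ chainSet Y (startSet (x i) T) 0 :=
          ⟨hzY, by linarith, hb.1.trans h1.2⟩
        -- Here `q = 0` must be less than `n`; for `n = 0` the point `z` is itself a forbidden
        -- chain.
        refine ⟨i, hi, 0, Nat.pos_of_ne_zero fun h0 => ?_, hz0⟩
        exact hch i (by rw [h0]; exact ⟨z, hz0⟩)
      · have hz1 : z ∈ chainSet Y (startSet (x i) T) (q + 1) := ⟨hzY, y, hyq, hb⟩
        refine ⟨i, hi, q + 1, lt_of_le_of_ne hq fun h0 => ?_, hz1⟩
        exact hch i (by rw [← h0]; exact ⟨z, hz1⟩)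
  have hSN : S ⊆ X ∩ neighbourhood x J (2 * n + 2) := fun z hz => by
    obtain ⟨i, hi, h, -⟩ := hdist z hz
    exact ⟨hz.1, i, hi, h⟩
  have hiff : ∀ z ∈ S, z ∈ accepted X ↔ z ∈ accepted (X ∩ neighbourhood x J (2 * n + 2)) :=
    fun z hz => (decision_iff_of_backwardClosed (fun z hz => hz.1) hclosed hz true).trans
      (decision_iff_of_backwardClosed hSN (fun y hy z hz hb => hclosed y hy z hz.1 hb) hz
        true).symm
  ext z
  constructor
  · rintro ⟨hz, hzB⟩
    exact ⟨(hiff z ⟨accepted_subset _ hz, Or.inl ⟨i, hi, hzB⟩⟩).1 hz, hzB⟩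
  · rintro ⟨hz, hzB⟩
    exact ⟨(hiff z ⟨(accepted_subset _ hz).1, Or.inl ⟨i, hi, hzB⟩⟩).2 hz, hzB⟩

/-- Long chains are unlikely, also when points in the sets `B (e i)` are prescribed. -/
theorem IsPoissonProcess.hit_chain_le (hX : IsPoissonProcess P μ X) (hμ : IntensityBound μ)
    (hn : ∀ ω, Nice (X ω)) {m : ℕ} {B : Fin m → Set (SpaceTime d)}
    (hB : ∀ i, MeasurableSet (B i)) (hμB : ∀ i, μ (B i) ≠ ⊤)
    (hdisj : Pairwise fun i j => Disjoint (B i) (B j)) {T : ℝ} (hT : 0 ≤ T)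
    (x : Fin m → EuclideanSpace ℝ (Fin d)) (n : ℕ) {k : ℕ} {e : Fin k → Fin m}
    (he : Function.Injective e) :
    P.real ({ω | ∀ i, (X ω ∩ B (e i)).Nonempty} ∩
        {ω | ∃ i, (chainSet (X ω ∩ (⋃ i, B i)ᶜ) (startSet (x i) T) n).Nonempty}) ≤
      (∏ i, μ.real (B (e i))) * (m * ((7 ^ d * T) ^ (n + 1) / (n + 1).factorial)) := by
  set U := ⋃ i, B i with hU
  have hUm : MeasurableSet U := MeasurableSet.iUnion hB
  have h1 : MeasurableSet[hitSigma fun ω => X ω ∩ U] {ω | ∀ i, (X ω ∩ B (e i)).Nonempty} := by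
    have : {ω | ∀ i, (X ω ∩ B (e i)).Nonempty} = ⋂ i, {ω | (X ω ∩ U ∩ B (e i)).Nonempty} := by
      ext ω
      simp only [mem_ofPred_eq, mem_iInter]
      refine forall_congr' fun i => ?_
      rw [inter_assoc, inter_eq_self_of_subset_right (subset_iUnion B (e i))]
    rw [this]
    exact MeasurableSet.iInter fun i => hitMeas_hitSigma _ _ (hB _)
  have h2 : MeasurableSet[hitSigma fun ω => X ω ∩ Uᶜ]
      {ω | ∃ i, (chainSet (X ω ∩ Uᶜ) (startSet (x i) T) n).Nonempty} := by
    have : {ω | ∃ i, (chainSet (X ω ∩ Uᶜ) (startSet (x i) T) n).Nonempty} =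
        ⋃ i, {ω | (chainSet (X ω ∩ Uᶜ) (startSet (x i) T) n ∩ univ).Nonempty} := by
      ext ω; simp
    rw [this]
    exact MeasurableSet.iUnion fun i =>
      (hitMeas_hitSigma (fun ω => X ω ∩ Uᶜ)).chainSet (measurableSet_startSet _ _) n _
        MeasurableSet.univ
  -- The chains avoid `U`, so they are independent of the hits inside `U` and the product of
  -- intensities factors out.
  have hind := (Indep_iff _ _ _).1
    (hX.indep_hitSigma hUm hUm.compl disjoint_compl_right) _ _ h1 h2
  rw [measureReal_def, hind, ENNReal.toReal_mul]
  refine mul_le_mul ?_ ?_ ENNReal.toReal_nonneg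
    (Finset.prod_nonneg fun _ _ => measureReal_nonneg)
  · exact hX.prob_all_hit_le (fun i => hB _) (fun i j hij => hdisj (he.ne hij)) fun i => hμB _
  · have hsub : {ω | ∃ i, (chainSet (X ω ∩ Uᶜ) (startSet (x i) T) n).Nonempty} ⊆
        ⋃ i ∈ Finset.univ, {ω | (chainSet (X ω) (startSet (x i) T) n).Nonempty} := by
      rintro ω ⟨i, hi⟩
      exact mem_biUnion (Finset.mem_univ i) (hi.mono (chainSet_mono inter_subset_left _ _))
    refine (measureReal_mono hsub (measure_ne_top _ _)).trans
      ((measureReal_biUnion_finset_le _ _).trans ?_)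
    refine (Finset.sum_le_sum fun i _ => hX.chain_le hμ (fun ω => (hn ω).time_nonneg) hT
      (fun z hz => hz) n).trans_eq ?_
    simp

/-- Approximate independence of acceptance in two distant groups of small sets. -/
theorem IsPoissonProcess.cluster_approx (hX : IsPoissonProcess P μ X) (hμ : IntensityBound μ)
    (hn : ∀ ω, Nice (X ω)) {k l : ℕ} {B : Fin (k + l) → Set (SpaceTime d)}
    (hB : ∀ i, MeasurableSet (B i)) (hμB : ∀ i, μ (B i) ≠ ⊤)
    (hdisj : Pairwise fun i j => Disjoint (B i) (B j)) {T : ℝ} (hT : 0 ≤ T)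
    {x : Fin (k + l) → EuclideanSpace ℝ (Fin d)}
    (hBx : ∀ i, ∀ y ∈ B i, dist y.1 (x i) ≤ 1 ∧ y.2 < T) {n : ℕ}
    (hx : ∀ i j, 4 * (n : ℝ) + 4 ≤ dist (x (Fin.castAdd l i)) (x (Fin.natAdd k j))) :
    |P.real {ω | ∀ i, (accepted (X ω) ∩ B i).Nonempty} -
        P.real {ω | ∀ i, (accepted (X ω) ∩ B (Fin.castAdd l i)).Nonempty} *
        P.real {ω | ∀ j, (accepted (X ω) ∩ B (Fin.natAdd k j)).Nonempty}| ≤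
      (∏ i, μ.real (B i)) *
        (3 * (k + l) * ((7 ^ d * T) ^ (n + 1) / (n + 1).factorial)) := by
  set b := (7 ^ d * T) ^ (n + 1) / ((n + 1).factorial : ℝ) with hb
  set Ch := {ω | ∃ i, (chainSet (X ω ∩ (⋃ i, B i)ᶜ) (startSet (x i) T) n).Nonempty} with hCh
  set J : Set (Fin (k + l)) := range (Fin.castAdd l) with hJ
  set J' : Set (Fin (k + l)) := range (Fin.natAdd k) with hJ'
  have hJJ : ∀ j, j ∉ J → j ∈ J' := by
    intro j hj
    induction j using Fin.addCases with
    | left i => exact absurd ⟨i, rfl⟩ hj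
    | right i => exact ⟨i, rfl⟩
  have hJJ' : ∀ j, j ∉ J' → j ∈ J := by
    intro j hj
    by_contra h
    exact hj (hJJ j h)
  set R : ℝ := 2 * n + 2 with hR
  set N := neighbourhood x J R with hN
  set N' := neighbourhood x J' R with hN'
  set E := {ω | ∀ i, (accepted (X ω) ∩ B (Fin.castAdd l i)).Nonempty} with hE
  set E' := {ω | ∀ j, (accepted (X ω) ∩ B (Fin.natAdd k j)).Nonempty} with hE'
  set L := {ω | ∀ i, (accepted (X ω ∩ N) ∩ B (Fin.castAdd l i)).Nonempty} with hL
  set L' := {ω | ∀ j, (accepted (X ω ∩ N') ∩ B (Fin.natAdd k j)).Nonempty} with hL'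
  have hEE : {ω | ∀ i, (accepted (X ω) ∩ B i).Nonempty} = E ∩ E' := by
    ext ω
    constructor
    · exact fun h => ⟨fun i => h _, fun j => h _⟩
    · rintro ⟨h1, h2⟩ i
      induction i using Fin.addCases with
      | left i => exact h1 i
      | right j => exact h2 j
  have hxJ : ∀ i ∈ J, ∀ j ∉ J, 4 * (n : ℝ) + 4 ≤ dist (x i) (x j) := by
    rintro _ ⟨i, rfl⟩ j hj
    obtain ⟨j, rfl⟩ := hJJ j hj
    exact hx i j
  have hxJ' : ∀ i ∈ J', ∀ j ∉ J', 4 * (n : ℝ) + 4 ≤ dist (x i) (x j) := by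
    rintro _ ⟨i, rfl⟩ j hj
    obtain ⟨j, rfl⟩ := hJJ' j hj
    rw [dist_comm]
    exact hx j i
  have hloc : ∀ ω, ω ∉ Ch → (ω ∈ E ↔ ω ∈ L) := by
    intro ω hω
    refine forall_congr' fun i => ?_
    rw [accepted_localize hBx hxJ (fun i hi => hω ⟨i, hi⟩) (mem_range_self i)]
  have hloc' : ∀ ω, ω ∉ Ch → (ω ∈ E' ↔ ω ∈ L') := by
    intro ω hω
    refine forall_congr' fun i => ?_
    rw [accepted_localize hBx hxJ' (fun i hi => hω ⟨i, hi⟩) (mem_range_self i)]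
  set H := {ω | ∀ i, (X ω ∩ B (Fin.castAdd l i)).Nonempty} with hH
  set H' := {ω | ∀ j, (X ω ∩ B (Fin.natAdd k j)).Nonempty} with hH'
  have hEH : E ⊆ H := fun ω h i => (h i).mono (inter_subset_inter_left _ (accepted_subset _))
  have hEH' : E' ⊆ H' := fun ω h i => (h i).mono (inter_subset_inter_left _ (accepted_subset _))
  have hLH : L ⊆ H := fun ω h i => (h i).mono
    (inter_subset_inter_left _ ((accepted_subset _).trans inter_subset_left))
  have hLH' : L' ⊆ H' := fun ω h i => (h i).mono
    (inter_subset_inter_left _ ((accepted_subset _).trans inter_subset_left))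
  set p := ∏ i, μ.real (B (Fin.castAdd l i)) with hp
  set p' := ∏ j, μ.real (B (Fin.natAdd k j)) with hp'
  have hp0 : 0 ≤ p := Finset.prod_nonneg fun _ _ => measureReal_nonneg
  have hp0' : 0 ≤ p' := Finset.prod_nonneg fun _ _ => measureReal_nonneg
  have hprod : ∏ i, μ.real (B i) = p * p' := Fin.prod_univ_add _
  set c := ((k + l : ℕ) : ℝ) * b with hc
  have hb0 : 0 ≤ b := by positivity
  have hc0 : 0 ≤ c := by positivity
  have hinj : Function.Injective (Fin.castAdd l : Fin k → Fin (k + l)) :=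
    Fin.castAdd_injective k l
  have hinj' : Function.Injective (Fin.natAdd k : Fin l → Fin (k + l)) :=
    Fin.natAdd_injective l k
  have c1 : P.real (H ∩ Ch) ≤ p * c := hX.hit_chain_le hμ hn hB hμB hdisj hT x n hinj
  have c2 : P.real (H' ∩ Ch) ≤ p' * c := hX.hit_chain_le hμ hn hB hμB hdisj hT x n hinj'
  have c3 : P.real (H ∩ H' ∩ Ch) ≤ p * p' * c := by
    have := hX.hit_chain_le hμ hn hB hμB hdisj hT x n (e := id) Function.injective_id
    simp only [id] at this
    rw [← hprod]
    convert this using 3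
    ext ω
    constructor
    · rintro ⟨h1, h2⟩ i
      induction i using Fin.addCases with
      | left i => exact h1 i
      | right j => exact h2 j
    · exact fun h => ⟨fun i => h _, fun j => h _⟩
  have d1 : |P.real E - P.real L| ≤ p * c := by
    refine (abs_measureReal_sub_le (P := P) (C := H ∩ Ch) ?_ ?_).trans c1
    all_goals
      intro ω hω
      by_cases h : ω ∈ Ch
    · exact Or.inr ⟨hEH hω, h⟩
    · exact Or.inl ((hloc ω h).1 hω)
    · exact Or.inr ⟨hLH hω, h⟩
    · exact Or.inl ((hloc ω h).2 hω)
  have d2 : |P.real E' - P.real L'| ≤ p' * c := by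
    refine (abs_measureReal_sub_le (P := P) (C := H' ∩ Ch) ?_ ?_).trans c2
    all_goals
      intro ω hω
      by_cases h : ω ∈ Ch
    · exact Or.inr ⟨hEH' hω, h⟩
    · exact Or.inl ((hloc' ω h).1 hω)
    · exact Or.inr ⟨hLH' hω, h⟩
    · exact Or.inl ((hloc' ω h).2 hω)
  have d3 : |P.real (E ∩ E') - P.real (L ∩ L')| ≤ p * p' * c := by
    refine (abs_measureReal_sub_le (P := P) (C := H ∩ H' ∩ Ch) ?_ ?_).trans c3
    all_goals
      intro ω hω
      by_cases h : ω ∈ Ch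
    · exact Or.inr ⟨⟨hEH hω.1, hEH' hω.2⟩, h⟩
    · exact Or.inl ⟨(hloc ω h).1 hω.1, (hloc' ω h).1 hω.2⟩
    · exact Or.inr ⟨⟨hLH hω.1, hLH' hω.2⟩, h⟩
    · exact Or.inl ⟨(hloc ω h).2 hω.1, (hloc' ω h).2 hω.2⟩
  have hNm := measurableSet_neighbourhood x J R
  have hNm' := measurableSet_neighbourhood x J' R
  -- The separation `4 n + 4` is twice the radius `2 n + 2`.
  have hNN : Disjoint N N' := by
    rw [disjoint_left]
    rintro z ⟨_, ⟨i, rfl⟩, h1⟩ ⟨_, ⟨j, rfl⟩, h2⟩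
    have h3 := hx i j
    have h4 := dist_triangle_left (x (Fin.castAdd l i)) (x (Fin.natAdd k j)) z.1
    rw [hR] at h1 h2
    linarith
  have hLm : MeasurableSet[hitSigma fun ω => X ω ∩ N] L := by
    have : L = ⋂ i, {ω | (accepted (X ω ∩ N) ∩ B (Fin.castAdd l i)).Nonempty} := by
      ext ω; simp [hL]
    rw [this]
    exact MeasurableSet.iInter fun i => (hitMeas_hitSigma _).accepted
      (fun ω => ((hn ω).mono inter_subset_left).locFin)
      (fun ω => ((hn ω).mono inter_subset_left).time_nonneg) _ (hB _)
  have hLm' : MeasurableSet[hitSigma fun ω => X ω ∩ N'] L' := by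
    have : L' = ⋂ i, {ω | (accepted (X ω ∩ N') ∩ B (Fin.natAdd k i)).Nonempty} := by
      ext ω; simp [hL']
    rw [this]
    exact MeasurableSet.iInter fun i => (hitMeas_hitSigma _).accepted
      (fun ω => ((hn ω).mono inter_subset_left).locFin)
      (fun ω => ((hn ω).mono inter_subset_left).time_nonneg) _ (hB _)
  have hLL : P.real (L ∩ L') = P.real L * P.real L' := by
    have := (Indep_iff _ _ _).1 (hX.indep_hitSigma hNm hNm' hNN) L L' hLm hLm'
    simp only [Measure.real, this, ENNReal.toReal_mul]
  have b1 : P.real E ≤ p := (measureReal_mono hEH).trans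
    (hX.prob_all_hit_le (fun i => hB _) (fun i j hij => hdisj (hinj.ne hij)) fun i => hμB _)
  have b2 : P.real L' ≤ p' := (measureReal_mono hLH').trans
    (hX.prob_all_hit_le (fun i => hB _) (fun i j hij => hdisj (hinj'.ne hij)) fun i => hμB _)
  have hE0 : 0 ≤ P.real E := measureReal_nonneg
  have hL0 : 0 ≤ P.real L' := measureReal_nonneg
  rw [hEE, hprod]
  -- Three replacements of true events by localised ones, each costing at most `p * p' * c`; this
  -- gives the factor 3.
  have split : P.real (E ∩ E') - P.real E * P.real E' =
      (P.real (E ∩ E') - P.real (L ∩ L')) + (P.real L - P.real E) * P.real L' +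
        P.real E * (P.real L' - P.real E') := by rw [hLL]; ring
  rw [split]
  refine (abs_add_three _ _ _).trans ?_
  rw [abs_mul, abs_mul, abs_of_nonneg hL0, abs_of_nonneg hE0, abs_sub_comm (P.real L),
    abs_sub_comm (P.real L')]
  have f1 : |P.real E - P.real L| * P.real L' ≤ p * c * p' :=
    mul_le_mul d1 b2 hL0 (by positivity)
  have f2 : P.real E * |P.real E' - P.real L'| ≤ p * (p' * c) :=
    mul_le_mul b1 d2 (abs_nonneg _) hp0
  have : p * p' * (3 * (k + l) * b) = p * p' * c + p * c * p' + p * (p' * c) := by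
    rw [hc]; push_cast; ring
  rw [this]
  linarith

end

section

variable {d : ℕ} {Ω : Type*} [mΩ : MeasurableSpace Ω] {P : Measure Ω} [IsProbabilityMeasure P]

/-! ### Correlation functions for a general shape of the small sets -/

/-- The set `w + ε • U`. -/
def tile (U : Set (SpaceTime d)) (w : SpaceTime d) (ε : ℝ) : Set (SpaceTime d) :=
  (fun u => w + ε • u) '' U

/-- The correlation function with respect to the sets `w + ε • U` of nominal volume `v ε`. -/
def HasCorrelation (P : Measure Ω) (X : Ω → Set (SpaceTime d)) (U : Set (SpaceTime d))
    (v : ℝ → ℝ) (k : ℕ) (w : Fin k → SpaceTime d) (r : ℝ) : Prop :=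
  Tendsto (fun ε : Fin k → ℝ => hitProb P X U w ε / ∏ i, v (ε i))
    (𝓝[{ε | ∀ i, 0 < ε i}] 0) (𝓝 r)

theorem HasCorrelation.congr_ae {X Y : Ω → Set (SpaceTime d)} (h : ∀ᵐ ω ∂P, Y ω = X ω)
    {U : Set (SpaceTime d)} {v : ℝ → ℝ} {k : ℕ} {w : Fin k → SpaceTime d} {r : ℝ} :
    HasCorrelation P Y U v k w r ↔ HasCorrelation P X U v k w r := by
  simp only [HasCorrelation, hitProb_congr_ae h]

/-- What the existence and clustering of correlation functions use about the intensity `μ` and the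
shape `U`. -/
structure InputModel (μ : Measure (SpaceTime d)) (U : Set (SpaceTime d)) (v : ℝ → ℝ) : Prop where
  intensity : IntensityBound μ
  zero_mem : (0 : SpaceTime d) ∈ U
  norm_le : ∀ u ∈ U, ‖u‖ ≤ 1
  measurable_tile : ∀ w ε, 0 < ε → MeasurableSet (tile U w ε)
  pos : ∀ ε, 0 < ε → 0 < v ε
  tendsto_zero : Tendsto v (𝓝[>] 0) (𝓝 0)
  le : ∀ w ε, 0 < ε → μ (tile U w ε) ≤ ENNReal.ofReal (v ε)
  ratio : ∀ w : SpaceTime d, 0 ≤ w.2 →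
    ∃ ρ, Tendsto (fun ε => μ.real (tile U w ε) / v ε) (𝓝[>] 0) (𝓝 ρ)
  bad : ∀ w : SpaceTime d, ∃ bad : ℝ → Set (SpaceTime d),
    (∀ ε, 0 < ε → MeasurableSet (bad ε) ∧ μ (bad ε) ≠ ⊤ ∧ ∀ z ∉ bad ε, ∀ y ∈ tile U w ε,
      (Blocks z y ↔ Blocks z w) ∧ (Blocks y z ↔ Blocks w z)) ∧
    Tendsto (fun ε => μ.real (bad ε)) (𝓝[>] 0) (𝓝 0)

namespace InputModel

variable {μ : Measure (SpaceTime d)} {U : Set (SpaceTime d)} {v : ℝ → ℝ}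
  {X : Ω → Set (SpaceTime d)}

theorem mem_tile (M : InputModel μ U v) (w : SpaceTime d) (ε : ℝ) : w ∈ tile U w ε :=
  ⟨0, M.zero_mem, by simp⟩

theorem dist_le (M : InputModel μ U v) {w y : SpaceTime d} {ε : ℝ} (hε : 0 < ε)
    (hy : y ∈ tile U w ε) : dist y w ≤ ε := by
  obtain ⟨u, hu, rfl⟩ := hy
  have := M.norm_le u hu
  simp only [dist_eq_norm, add_sub_cancel_left, norm_smul, Real.norm_eq_abs, abs_of_pos hε]
  exact mul_le_of_le_one_right hε.le this

theorem dist_fst_le (M : InputModel μ U v) {w y : SpaceTime d} {ε : ℝ} (hε : 0 < ε)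
    (hy : y ∈ tile U w ε) : dist y.1 w.1 ≤ ε :=
  (le_max_left _ _).trans (M.dist_le hε hy)

theorem abs_snd_le (M : InputModel μ U v) {w y : SpaceTime d} {ε : ℝ} (hε : 0 < ε)
    (hy : y ∈ tile U w ε) : |y.2 - w.2| ≤ ε :=
  (le_max_right _ _).trans (M.dist_le hε hy)

theorem ne_top (M : InputModel μ U v) (w : SpaceTime d) {ε : ℝ} (hε : 0 < ε) :
    μ (tile U w ε) ≠ ⊤ := ne_top_of_le_ne_top ENNReal.ofReal_ne_top (M.le w ε hε)

theorem real_le (M : InputModel μ U v) (w : SpaceTime d) {ε : ℝ} (hε : 0 < ε) :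
    μ.real (tile U w ε) ≤ v ε := ENNReal.toReal_le_of_le_ofReal (M.pos ε hε).le (M.le w ε hε)

theorem tendsto_real (M : InputModel μ U v) (w : SpaceTime d) :
    Tendsto (fun ε => μ.real (tile U w ε)) (𝓝[>] 0) (𝓝 0) := by
  refine tendsto_of_tendsto_of_tendsto_of_le_of_le' tendsto_const_nhds M.tendsto_zero ?_ ?_
  · exact Eventually.of_forall fun _ => measureReal_nonneg
  · filter_upwards [self_mem_nhdsWithin] with ε hε using M.real_le w hε

theorem eventually_small {k : ℕ} {e : ℝ} (he : 0 < e) :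
    ∀ᶠ ε : Fin k → ℝ in 𝓝[{ε | ∀ i, 0 < ε i}] 0, ∀ i, 0 < ε i ∧ ε i < e := by
  have h1 : ∀ᶠ ε : Fin k → ℝ in 𝓝[{ε | ∀ i, 0 < ε i}] 0, ∀ i, 0 < ε i := self_mem_nhdsWithin
  have h2 : ∀ᶠ ε : Fin k → ℝ in 𝓝[{ε | ∀ i, 0 < ε i}] 0, ∀ i, ε i < e := by
    refine eventually_all.2 fun i => mem_nhdsWithin_of_mem_nhds ?_
    exact ((continuous_apply i).tendsto (0 : Fin k → ℝ)).eventually (gt_mem_nhds he)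
  filter_upwards [h1, h2] with ε a b i using ⟨a i, b i⟩

theorem tendsto_coord {k : ℕ} (i : Fin k) :
    Tendsto (fun ε : Fin k → ℝ => ε i) (𝓝[{ε | ∀ i, 0 < ε i}] 0) (𝓝[>] 0) := by
  refine tendsto_nhdsWithin_iff.2 ⟨?_, ?_⟩
  · exact ((continuous_apply i).tendsto (0 : Fin k → ℝ)).mono_left nhdsWithin_le_nhds
  · filter_upwards [self_mem_nhdsWithin] with ε hε using hε i

/-- Once a joint limit is known to exist, it may be computed along equal radii; all bounds on
correlation values use only these. -/
theorem tendsto_diag (k : ℕ) :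
    Tendsto (fun (e : ℝ) (_ : Fin k) => e) (𝓝[>] 0) (𝓝[{ε | ∀ i, 0 < ε i}] 0) := by
  refine tendsto_nhdsWithin_iff.2 ⟨?_, ?_⟩
  · exact (tendsto_pi_nhds.2 fun _ => tendsto_id).mono_left nhdsWithin_le_nhds
  · filter_upwards [self_mem_nhdsWithin] with ε hε using fun _ => hε

theorem exists_disjoint (M : InputModel μ U v) {w w' : SpaceTime d} (h : w ≠ w') :
    ∃ e > 0, ∀ ε ε', 0 < ε → ε < e → 0 < ε' → ε' < e →
      Disjoint (tile U w ε) (tile U w' ε') := by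
  refine ⟨dist w w' / 2, by simpa using dist_pos.2 h, fun ε ε' h1 h2 h3 h4 => ?_⟩
  rw [disjoint_left]
  intro y hy hy'
  have a := M.dist_le h1 hy
  have b := M.dist_le h3 hy'
  have := dist_triangle_left w w' y
  linarith

theorem eventually_disjoint (M : InputModel μ U v) {k : ℕ} {w : Fin k → SpaceTime d}
    (hw : Function.Injective w) :
    ∀ᶠ ε : Fin k → ℝ in 𝓝[{ε | ∀ i, 0 < ε i}] 0,
      Pairwise fun i j => Disjoint (tile U (w i) (ε i)) (tile U (w j) (ε j)) := by
  simp only [Pairwise]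
  refine eventually_all.2 fun i => eventually_all.2 fun j => ?_
  by_cases hij : i = j
  · exact Eventually.of_forall fun _ h => absurd hij h
  · obtain ⟨e, he, h⟩ := M.exists_disjoint (hw.ne hij)
    filter_upwards [eventually_small he] with ε hε _
    exact h _ _ (hε i).1 (hε i).2 (hε j).1 (hε j).2

/-- Overlapping balls are never both accepted. -/
theorem correlation_zero (M : InputModel μ U v) (hn : ∀ ω, Nice (X ω)) {k : ℕ}
    {w : Fin k → SpaceTime d} (hw : Function.Injective w) {i j : Fin k} (hij : i ≠ j)
    (hd : dist (w i).1 (w j).1 < 2) : HasCorrelation P X U v k w 0 := by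
  refine tendsto_const_nhds.congr' ?_
  filter_upwards [M.eventually_disjoint hw,
    eventually_small (e := (2 - dist (w i).1 (w j).1) / 2) (by linarith)] with ε h1 h2
  have : {ω | ∀ i, (accepted (X ω) ∩ (fun u => w i + ε i • u) '' U).Nonempty} = ∅ := by
    refine eq_empty_of_forall_notMem fun ω hω => ?_
    obtain ⟨y, hy, hyB⟩ := hω i
    obtain ⟨z, hz, hzB⟩ := hω j
    have a := M.dist_fst_le (h2 i).1 hyB
    have b := M.dist_fst_le (h2 j).1 hzB
    have c := dist_triangle4 y.1 (w i).1 (w j).1 z.1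
    rw [dist_comm (w j).1] at c
    have ht := accepted_time_eq hy hz (by linarith [(h2 i).2, (h2 j).2])
    have hyz := (hn ω).time_injOn (accepted_subset _ hy) (accepted_subset _ hz) ht
    exact disjoint_left.1 (h1 hij) hyB (hyz ▸ hzB)
  simp [hitProb, this]

theorem prod_tile_le (M : InputModel μ U v) {k : ℕ} (w : Fin k → SpaceTime d) {ε : Fin k → ℝ}
    (hε : ∀ i, 0 < ε i) : ∏ i, μ.real (tile U (w i) (ε i)) ≤ ∏ i, v (ε i) :=
  Finset.prod_le_prod (fun _ _ => measureReal_nonneg) fun i _ => M.real_le _ (hε i)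

/-- Existence of the correlation functions. -/
theorem exists_correlation (M : InputModel μ U v) (hX : IsPoissonProcess P μ X)
    (hn : ∀ ω, Nice (X ω)) {k : ℕ} {w : Fin k → SpaceTime d} (hw : Function.Injective w)
    (hw0 : ∀ i, 0 ≤ (w i).2)
    (hsep : ∀ i j, i ≠ j → dist (w i).1 (w j).1 < 2 ∨
      ∃ e > 0, ∀ ε ε', 0 < ε → ε < e → 0 < ε' → ε' < e →
        ∀ y ∈ tile U (w i) ε, ∀ z ∈ tile U (w j) ε', 2 ≤ dist y.1 z.1) :
    ∃ r, HasCorrelation P X U v k w r := by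
  by_cases hover : ∃ i j, i ≠ j ∧ dist (w i).1 (w j).1 < 2
  · obtain ⟨i, j, hij, hd⟩ := hover
    exact ⟨0, M.correlation_zero hn hw hij hd⟩
  push Not at hover
  choose ρ hρ using fun i => M.ratio (w i) (hw0 i)
  choose bad hbad hbad0 using fun i => M.bad (w i)
  set F : Filter (Fin k → ℝ) := 𝓝[{ε | ∀ i, 0 < ε i}] 0 with hF
  -- The probability of acceptance when the points `w i` are inserted. The limit is `(∏ i, ρ i) *
  -- g`.
  set g := P.real {ω | ∀ i, w i ∈ accepted (X ω ∪ range w)}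
  have hsepF : ∀ᶠ ε in F, ∀ i j, i ≠ j →
      ∀ y ∈ tile U (w i) (ε i), ∀ z ∈ tile U (w j) (ε j), 2 ≤ dist y.1 z.1 := by
    refine eventually_all.2 fun i => eventually_all.2 fun j => ?_
    by_cases hij : i = j
    · exact Eventually.of_forall fun _ h => absurd hij h
    · obtain ⟨e, he, h⟩ := (hsep i j hij).resolve_left (not_lt.2 (hover i j hij))
      filter_upwards [eventually_small he] with ε hε _
      exact h _ _ (hε i).1 (hε i).2 (hε j).1 (hε j).2
  have h1 : Tendsto (fun ε : Fin k → ℝ => (∏ i, μ.real (tile U (w i) (ε i)) / v (ε i)) * g) F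
      (𝓝 ((∏ i, ρ i) * g)) :=
    (tendsto_finsetProd _ fun i _ => (hρ i).comp (tendsto_coord i)).mul_const g
  have h2 : Tendsto (fun ε : Fin k → ℝ => 3 * ∑ i, μ.real (tile U (w i) (ε i)) +
      ∑ i, μ.real (bad i (ε i))) F (𝓝 0) := by
    have a := (tendsto_finsetSum (f := fun (i : Fin k) (ε : Fin k → ℝ) =>
      μ.real (tile U (w i) (ε i))) Finset.univ
      fun i _ => (M.tendsto_real (w i)).comp (tendsto_coord i)).const_mul 3
    have b := tendsto_finsetSum (f := fun (i : Fin k) (ε : Fin k → ℝ) =>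
      μ.real (bad i (ε i))) Finset.univ fun i _ => (hbad0 i).comp (tendsto_coord i)
    simpa using a.add b
  refine ⟨_, (tendsto_iff_of_dist ?_).1 h1⟩
  refine squeeze_zero' (Eventually.of_forall fun _ => dist_nonneg) ?_ h2
  filter_upwards [hsepF, eventually_small one_pos] with ε hs hε
  have happ := hX.hit_accepted_approx hn (fun i => M.measurable_tile (w i) (ε i) (hε i).1)
    (fun i => M.ne_top _ (hε i).1) (fun i => M.mem_tile _ _) hw0 hs
    (fun i => (hbad i _ (hε i).1).1) (fun i => (hbad i _ (hε i).1).2.1)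
    (fun i => (hbad i _ (hε i).1).2.2)
  have hv : 0 < ∏ i, v (ε i) := Finset.prod_pos fun i _ => M.pos _ (hε i).1
  have hle := M.prod_tile_le w fun i => (hε i).1
  rw [Real.dist_eq, abs_sub_comm, Finset.prod_div_distrib, div_mul_eq_mul_div, ← sub_div, abs_div,
    abs_of_pos hv, div_le_iff₀ hv]
  refine happ.trans ?_
  rw [mul_comm _ (∏ i, v (ε i))]
  refine mul_le_mul_of_nonneg_right hle ?_
  have : ∀ i, 0 ≤ μ.real (tile U (w i) (ε i)) := fun _ => measureReal_nonneg
  have : ∀ i, 0 ≤ μ.real (bad i (ε i)) := fun _ => measureReal_nonneg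
  positivity

theorem eventually_diag {k : ℕ} {p : (Fin k → ℝ) → Prop}
    (h : ∀ᶠ ε in 𝓝[{ε | ∀ i, 0 < ε i}] 0, p ε) : ∀ᶠ e : ℝ in 𝓝[>] 0, p fun _ => e :=
  (tendsto_diag k).eventually h

theorem hitProb_le (M : InputModel μ U v) (hX : IsPoissonProcess P μ X) {k : ℕ}
    {w : Fin k → SpaceTime d} (hw : Function.Injective w) :
    ∀ᶠ ε : Fin k → ℝ in 𝓝[{ε | ∀ i, 0 < ε i}] 0, hitProb P X U w ε ≤ ∏ i, v (ε i) := by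
  filter_upwards [M.eventually_disjoint hw, eventually_small one_pos] with ε h1 hε
  refine le_trans ?_ (M.prod_tile_le w fun i => (hε i).1)
  refine le_trans (measureReal_mono ?_ (measure_ne_top _ _))
    (hX.prob_all_hit_le (fun i => M.measurable_tile (w i) (ε i) (hε i).1) h1
      fun i => M.ne_top _ (hε i).1)
  exact fun ω h i => (h i).mono (inter_subset_inter_left _ (accepted_subset _))

theorem correlation_nonneg (M : InputModel μ U v) {k : ℕ} {w : Fin k → SpaceTime d} {r : ℝ}
    (hr : HasCorrelation P X U v k w r) : 0 ≤ r := by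
  refine ge_of_tendsto (hr.comp (tendsto_diag k)) ?_
  filter_upwards [self_mem_nhdsWithin] with e he
  exact div_nonneg measureReal_nonneg (Finset.prod_nonneg fun i _ => (M.pos e he).le)

theorem correlation_le (M : InputModel μ U v) {k : ℕ} {w : Fin k → SpaceTime d} {r c : ℝ}
    (hr : HasCorrelation P X U v k w r)
    (h : ∀ᶠ e : ℝ in 𝓝[>] 0, hitProb P X U w (fun _ => e) ≤ c * ∏ _i : Fin k, v e) : r ≤ c := by
  refine le_of_tendsto (hr.comp (tendsto_diag k)) ?_
  filter_upwards [self_mem_nhdsWithin, h] with e he h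
  -- A negative `c` would contradict `h`, as probabilities are nonnegative and the nominal volumes
  -- are positive.
  exact div_le_of_le_mul₀ (Finset.prod_nonneg fun i _ => (M.pos e he).le)
    (le_of_not_gt fun hc => absurd h (not_le.2 (lt_of_lt_of_le (mul_neg_of_neg_of_pos hc
      (Finset.prod_pos fun i _ => M.pos e he)) measureReal_nonneg))) h

theorem correlation_le_one (M : InputModel μ U v) (hX : IsPoissonProcess P μ X) {k : ℕ}
    {w : Fin k → SpaceTime d} (hw : Function.Injective w) {r : ℝ}
    (hr : HasCorrelation P X U v k w r) : r ≤ 1 := by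
  refine M.correlation_le hr ?_
  simpa using eventually_diag (M.hitProb_le hX hw)

/-- The estimate for small tiles divided by their volumes. The time bound is `T + 1` because tiles
of radius below 1 may reach beyond `T`. -/
theorem cluster_le (M : InputModel μ U v) (hX : IsPoissonProcess P μ X) (hn : ∀ ω, Nice (X ω))
    {k l : ℕ} {w : Fin k → SpaceTime d} {w' : Fin l → SpaceTime d}
    (hw : Function.Injective (Fin.append w w')) {T : ℝ} (hT : 0 ≤ T)
    (hwT : ∀ i, (Fin.append w w' i).2 ≤ T) {n : ℕ}
    (hd : ∀ i j, 4 * (n : ℝ) + 4 ≤ dist (w i).1 (w' j).1) {r r₁ r₂ : ℝ}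
    (hr : HasCorrelation P X U v (k + l) (Fin.append w w') r)
    (hr₁ : HasCorrelation P X U v k w r₁) (hr₂ : HasCorrelation P X U v l w' r₂) :
    |r - r₁ * r₂| ≤ 3 * (k + l) * ((7 ^ d * (T + 1)) ^ (n + 1) / (n + 1).factorial) := by
  have hlim := ((hr.comp (tendsto_diag _)).sub
    ((hr₁.comp (tendsto_diag _)).mul (hr₂.comp (tendsto_diag _)))).abs
  refine le_of_tendsto hlim ?_
  filter_upwards [eventually_diag (M.eventually_disjoint hw), self_mem_nhdsWithin,
    mem_nhdsWithin_of_mem_nhds (gt_mem_nhds one_pos)] with e hdis he he1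
  have he : 0 < e := he
  have happ := hX.cluster_approx M.intensity hn (k := k) (l := l)
    (B := fun i => tile U (Fin.append w w' i) e)
    (fun i => M.measurable_tile _ e he) (fun i => M.ne_top _ he) hdis (T := T + 1) (by linarith)
    (x := fun i => (Fin.append w w' i).1)
    (fun i y hy => ⟨(M.dist_fst_le he hy).trans he1.le, by
      have := (abs_le.1 (M.abs_snd_le he hy)).2
      have := hwT i
      have : e < 1 := he1
      linarith⟩) (n := n) (by simpa using hd)
  simp only [Fin.append_left, Fin.append_right] at happ
  set b := 3 * ((k : ℝ) + l) * ((7 ^ d * (T + 1)) ^ (n + 1) / (n + 1).factorial)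
  have hb : 0 ≤ b := by positivity
  have hle := M.prod_tile_le (Fin.append w w') (ε := fun _ => e) fun _ => he
  have hv : 0 < v e := M.pos e he
  simp only [Function.comp_apply, Finset.prod_const, Finset.card_univ, Fintype.card_fin]
    at hle ⊢
  rw [div_mul_div_comm, ← pow_add, ← sub_div, abs_div, abs_of_pos (pow_pos hv (k + l)),
    div_le_iff₀ (pow_pos hv _)]
  refine happ.trans ?_
  rw [mul_comm b]
  exact mul_le_mul_of_nonneg_right hle hb

end InputModel

/-- From factorial decay of the errors in space and exponential decay in time to exponential decay
in space-time. -/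
theorem exists_exp_bound {D K Q : ℝ} (hD : 1 ≤ D) (hK : 0 ≤ K) (hQ : 0 ≤ Q) :
    ∃ A > 0, ∃ C > 0, ∀ q δ T : ℝ, 0 ≤ T → q ≤ K * Real.exp (-T) →
      (∀ n : ℕ, 4 * (n : ℝ) + 4 ≤ δ - T →
        q ≤ Q * ((D * (T + 1)) ^ (n + 1) / (n + 1).factorial)) →
      q ≤ A * Real.exp (-(C * δ)) := by
  -- With `T < c * δ` and `δ ≥ δ₀`, each of the two terms of `D * T + D` is at most `exp (-2) * δ /
  -- 32`. The base is then at most `exp (-2) * (n + 1)` for `n = ⌊δ / 16⌋₊`.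
  set c := Real.exp (-2) / (32 * D) with hc
  set δ₀ := 32 * D * Real.exp 2 with hδ₀
  have hc0 : 0 < c := by positivity
  have hexp2 : (1 : ℝ) ≤ Real.exp 2 := Real.one_le_exp (by norm_num)
  have hexpm2 : Real.exp (-2) ≤ 1 := Real.exp_le_one_iff.2 (by norm_num)
  have hδ₀32 : 32 ≤ δ₀ := by rw [hδ₀]; nlinarith
  have hc32 : c ≤ 1 / 32 := by
    rw [hc, div_le_div_iff₀ (by positivity) (by norm_num)]; nlinarith
  -- The terms of `A` serve, in order: late times, large spatial separation, `δ < δ₀`, and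
  -- positivity of `A`.
  refine ⟨K + Q + K * Real.exp (c * δ₀) + 1, by positivity, c, hc0, ?_⟩
  intro q δ T hT h1 h2
  set E := Real.exp (-(c * δ)) with hE
  have hE0 : 0 < E := Real.exp_pos _
  have hlast : 0 ≤ K * Real.exp (c * δ₀) * E := by positivity
  have hKE : 0 ≤ K * E := by positivity
  have hQE : 0 ≤ Q * E := by positivity
  have expand : (K + Q + K * Real.exp (c * δ₀) + 1) * E =
      K * E + Q * E + K * Real.exp (c * δ₀) * E + E := by ring
  rw [expand]
  by_cases hδ : δ < δ₀
  · have : q ≤ K * Real.exp (c * δ₀) * E := by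
      rw [mul_assoc, ← Real.exp_add]
      refine h1.trans (mul_le_mul_of_nonneg_left (Real.exp_le_exp.2 ?_) hK)
      nlinarith
    linarith
  push Not at hδ
  by_cases hTc : c * δ ≤ T
  · have : q ≤ K * E := h1.trans (mul_le_mul_of_nonneg_left (Real.exp_le_exp.2 (by linarith)) hK)
    linarith
  push Not at hTc
  have hδpos : 0 < δ := by linarith
  set n := ⌊δ / 16⌋₊ with hn
  have hn1 : (n : ℝ) ≤ δ / 16 := Nat.floor_le (by positivity)
  have hn2 : δ / 16 < n + 1 := Nat.lt_floor_add_one _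
  have h3 := h2 n (by nlinarith)
  have hN0 : (0 : ℝ) < (n : ℝ) + 1 := by positivity
  have hbase : D * (T + 1) ≤ Real.exp (-2) * (n + 1) := by
    have a1 : D * (T + 1) ≤ D * (c * δ + 1) := by gcongr
    have a2 : D * c * 32 = Real.exp (-2) := by rw [hc]; field_simp
    have a3 : D * 32 ≤ Real.exp (-2) * δ := by
      have : Real.exp (-2) * δ₀ = 32 * D := by
        rw [hδ₀]
        have : Real.exp (-2) * Real.exp 2 = 1 := by rw [← Real.exp_add]; simp
        linear_combination (32 * D) * this
      have := mul_le_mul_of_nonneg_left hδ (Real.exp_pos (-2)).le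
      linarith
    have a4 : Real.exp (-2) * (δ / 16) ≤ Real.exp (-2) * (n + 1) := by gcongr
    nlinarith
  -- The factorial absorbs the power at the cost of `exp (n + 1)`; the factor `exp (-2)` in the base
  -- leaves `exp (-(n + 1))`.
  have hfac : ((n : ℝ) + 1) ^ (n + 1) / (n + 1).factorial ≤ Real.exp (n + 1) :=
    Real.pow_div_factorial_le_exp _ hN0.le (n + 1)
  have h4 : (D * (T + 1)) ^ (n + 1) / (n + 1).factorial ≤ E := by
    calc (D * (T + 1)) ^ (n + 1) / ((n + 1).factorial : ℝ)
        ≤ (Real.exp (-2) * (n + 1)) ^ (n + 1) / (n + 1).factorial := by gcongr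
      _ = Real.exp (-2) ^ (n + 1) * (((n : ℝ) + 1) ^ (n + 1) / (n + 1).factorial) := by
          rw [mul_pow, mul_div_assoc]
      _ ≤ Real.exp (-2) ^ (n + 1) * Real.exp (n + 1) := by gcongr
      _ = Real.exp (-(n + 1)) := by
          rw [← Real.exp_nat_mul, ← Real.exp_add]; congr 1; push_cast; ring
      _ ≤ E := Real.exp_le_exp.2 (by nlinarith)
  have : q ≤ Q * E := h3.trans (mul_le_mul_of_nonneg_left h4 hQ)
  linarith

/-- Exponential clustering, given that late acceptance is unlikely. -/
theorem InputModel.exponentiallyClusters {μ : Measure (SpaceTime d)} {U : Set (SpaceTime d)}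
    {v : ℝ → ℝ} {X : Ω → Set (SpaceTime d)} (M : InputModel μ U v)
    (hX : IsPoissonProcess P μ X) (hn : ∀ ω, Nice (X ω)) {K : ℝ} (hK : 0 ≤ K)
    (hdecay : ∀ (k : ℕ) (w : Fin k → SpaceTime d), Function.Injective w → (∀ i, 0 ≤ (w i).2) →
      ∀ i, ∀ᶠ e : ℝ in 𝓝[>] 0,
        hitProb P X U w (fun _ => e) ≤ K * Real.exp (-(w i).2) * ∏ _j : Fin k, v e) :
    ExponentiallyClusters (HasCorrelation P X U v) := by
  intro k l hk hl
  obtain ⟨A, hA, C, hC, hbound⟩ := exists_exp_bound (D := 7 ^ d) (K := K) (Q := 3 * (k + l))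
    (one_le_pow₀ (by norm_num)) hK (by positivity)
  refine ⟨A, hA, C, hC, fun w w' hw0 hw0' hinj r r₁ r₂ hr hr₁ hr₂ => ?_⟩
  have hinj1 : Function.Injective w := fun i j hij => by
    have := @hinj (Fin.castAdd l i) (Fin.castAdd l j) (by simpa using hij)
    exact Fin.castAdd_injective _ _ this
  have hinj2 : Function.Injective w' := fun i j hij => by
    have := @hinj (Fin.natAdd k i) (Fin.natAdd k j) (by simpa using hij)
    exact Fin.natAdd_injective _ _ this
  have happ0 : ∀ i, 0 ≤ (Fin.append w w' i).2 := by
    intro i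
    induction i using Fin.addCases with
    | left i => simpa using hw0 i
    | right i => simpa using hw0' i
  have : Nonempty (Fin (k + l)) := ⟨⟨0, by omega⟩⟩
  obtain ⟨i₀, hi₀⟩ := Finite.exists_max fun i => (Fin.append w w' i).2
  set T := (Fin.append w w' i₀).2 with hT
  have hwT : ∀ i, (w i).2 ≤ T := fun i => by simpa using hi₀ (Fin.castAdd l i)
  have hwT' : ∀ i, (w' i).2 ≤ T := fun i => by simpa using hi₀ (Fin.natAdd k i)
  have hr0 := M.correlation_nonneg hr
  have hr0₁ := M.correlation_nonneg hr₁
  have hr0₂ := M.correlation_nonneg hr₂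
  have hr1₁ := M.correlation_le_one hX hinj1 hr₁
  have hr1₂ := M.correlation_le_one hX hinj2 hr₂
  refine hbound _ _ T (happ0 i₀) ?_ fun n hnT => ?_
  · have h1 : r ≤ K * Real.exp (-T) := M.correlation_le hr (hdecay _ _ hinj happ0 i₀)
    -- The latest point belongs to one of the groups; the correlation of the other is at most 1.
    have h2 : r₁ * r₂ ≤ K * Real.exp (-T) := by
      obtain ⟨j, hj⟩ | ⟨j, hj⟩ : (∃ j, i₀ = Fin.castAdd l j) ∨ ∃ j, i₀ = Fin.natAdd k j := by
        induction i₀ using Fin.addCases with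
        | left i => exact Or.inl ⟨i, rfl⟩
        | right i => exact Or.inr ⟨i, rfl⟩
      · have : T = (w j).2 := by rw [hT, hj, Fin.append_left]
        rw [this]
        exact (mul_le_of_le_one_right hr0₁ hr1₂).trans
          (M.correlation_le hr₁ (hdecay _ _ hinj1 hw0 j))
      · have : T = (w' j).2 := by rw [hT, hj, Fin.append_right]
        rw [this]
        exact (mul_le_of_le_one_left hr0₂ hr1₁).trans
          (M.correlation_le hr₂ (hdecay _ _ hinj2 hw0' j))
    have h3 : 0 ≤ r₁ * r₂ := mul_nonneg hr0₁ hr0₂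
    rw [abs_le]
    constructor <;> linarith
  · refine M.cluster_le hX hn hinj (happ0 i₀) hi₀ (fun i j => hnT.trans ?_) hr hr₁ hr₂
    have h1 : tupleDist w w' ≤ euclDist (w i) (w' j) :=
      ciInf_le (Finite.bddBelow_range fun p : Fin k × Fin l => euclDist (w p.1) (w' p.2)) (i, j)
    -- All times lie in `[0, T]`, so the spatial distance is at least the space-time distance minus
    -- `T`.
    have h2 : euclDist (w i) (w' j) ≤ dist (w i).1 (w' j).1 + T := by
      have a1 := hw0 i
      have a2 := hw0' j
      have a3 := hwT i
      have a4 := hwT' j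
      have a5 : (0 : ℝ) ≤ dist (w i).1 (w' j).1 := dist_nonneg
      have a6 : 0 ≤ T := happ0 i₀
      refine Real.sqrt_le_iff.2 ⟨by linarith, ?_⟩
      have a7 : ((w i).2 - (w' j).2) ^ 2 ≤ T ^ 2 :=
        sq_le_sq' (by linarith) (by linarith)
      nlinarith [mul_nonneg a5 a6]
    linarith

end

section

variable {d : ℕ} {Ω : Type*} [mΩ : MeasurableSpace Ω] {P : Measure Ω} [IsProbabilityMeasure P]

/-! ### Points whose blocking relation is sensitive to small displacements -/

/-- The points near `w` whose arrival time is within `ε` of the one of `w`. -/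
def timeBad (w : SpaceTime d) (ε : ℝ) : Set (SpaceTime d) :=
  {z | |z.2 - w.2| ≤ ε ∧ dist z.1 w.1 ≤ 2 + ε}

/-- The points whose distance in space from `w` is within `ε` of the interaction range. -/
def sphereBad (w : SpaceTime d) (ε : ℝ) : Set (SpaceTime d) :=
  {z | |dist z.1 w.1 - 2| ≤ ε}

theorem measurableSet_timeBad (w : SpaceTime d) (ε : ℝ) : MeasurableSet (timeBad w ε) :=
  ((isClosed_le (by fun_prop) (by fun_prop)).inter
    (isClosed_le (by fun_prop) (by fun_prop)) : IsClosed
      ({z : SpaceTime d | |z.2 - w.2| ≤ ε} ∩ {z | dist z.1 w.1 ≤ 2 + ε})).measurableSet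

theorem measurableSet_sphereBad (w : SpaceTime d) (ε : ℝ) : MeasurableSet (sphereBad w ε) :=
  (isClosed_le (by fun_prop) (by fun_prop) :
    IsClosed {z : SpaceTime d | |dist z.1 w.1 - 2| ≤ ε}).measurableSet

/-- The upper end is `w.2 + 2 * ε` because slabs are half open while the times in `timeBad` fill a
closed interval. -/
theorem timeBad_subset_slab (w : SpaceTime d) {ε : ℝ} (hε : 0 < ε) {N : ℕ} (hN : 2 + ε ≤ N) :
    timeBad w ε ⊆ slab (nearCells (floorVec w.1) N) (w.2 - ε) (w.2 + 2 * ε) := by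
  rintro z ⟨h1, h2⟩
  rw [abs_le] at h1
  exact ⟨floorVec_mem_nearCells (h2.trans hN), by linarith, by linarith⟩

theorem IntensityBound.timeBad_ne_top {μ : Measure (SpaceTime d)} (hμ : IntensityBound μ)
    (w : SpaceTime d) {ε : ℝ} (hε : 0 < ε) : μ (timeBad w ε) ≠ ⊤ := by
  obtain ⟨N, hN⟩ := exists_nat_ge (2 + ε)
  exact ne_top_of_le_ne_top (hμ.slab_ne_top _ _ _) (measure_mono (timeBad_subset_slab w hε hN))

theorem IntensityBound.tendsto_timeBad {μ : Measure (SpaceTime d)} (hμ : IntensityBound μ)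
    (w : SpaceTime d) : Tendsto (fun ε => μ.real (timeBad w ε)) (𝓝[>] 0) (𝓝 0) := by
  have hlim : Tendsto (fun ε : ℝ => ((nearCells (floorVec w.1) 3).card : ℝ) * (3 * ε))
      (𝓝[>] 0) (𝓝 0) := by
    have : Tendsto (fun ε : ℝ => ((nearCells (floorVec w.1) 3).card : ℝ) * (3 * ε))
        (𝓝 0) (𝓝 (((nearCells (floorVec w.1) 3).card : ℝ) * (3 * 0))) := by
      apply Continuous.tendsto; fun_prop
    simpa using this.mono_left nhdsWithin_le_nhds
  refine squeeze_zero' (Eventually.of_forall fun _ => measureReal_nonneg) ?_ hlim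
  filter_upwards [self_mem_nhdsWithin, mem_nhdsWithin_of_mem_nhds (gt_mem_nhds one_pos)]
    with ε hε hε1
  have hε : 0 < ε := hε
  have hε1 : ε < 1 := hε1
  refine (measureReal_mono (timeBad_subset_slab w hε (N := 3) (by push_cast; linarith))
    (hμ.slab_ne_top _ _ _)).trans ?_
  refine (hμ.real_slab_le _ (by linarith)).trans_eq ?_
  ring

/-- Only the order of times is settled here. The comparison of distances is a hypothesis, since it
is free for vertical displacements and needs `sphereBad` for general ones. -/
theorem blocks_iff_of_notMem_timeBad {w y z : SpaceTime d} {ε : ℝ} (hy2 : |y.2 - w.2| ≤ ε)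
    (hd : dist z.1 y.1 < 2 ↔ dist z.1 w.1 < 2) (hε : 0 < ε) (hz : z ∉ timeBad w ε) :
    (Blocks z y ↔ Blocks z w) ∧ (Blocks y z ↔ Blocks w z) := by
  simp only [Blocks, dist_comm y.1, dist_comm w.1, hd]
  by_cases h2 : dist z.1 w.1 < 2
  · have h1 : ¬ |z.2 - w.2| ≤ ε := fun h => hz ⟨h, by linarith⟩
    rw [abs_le] at h1 hy2
    simp only [h2, and_true]
    rcases le_or_gt z.2 w.2 with h | h
    · have : z.2 - w.2 < -ε := by
        by_contra hc; push Not at hc; exact h1 ⟨hc, by linarith⟩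
      exact ⟨⟨fun _ => by linarith, fun _ => by linarith⟩,
        ⟨fun _ => by linarith, fun _ => by linarith⟩⟩
    · have : ε < z.2 - w.2 := by
        by_contra hc; push Not at hc; exact h1 ⟨by linarith, hc⟩
      exact ⟨⟨fun _ => by linarith, fun _ => by linarith⟩,
        ⟨fun _ => by linarith, fun _ => by linarith⟩⟩
  · simp [h2]

theorem dist_lt_two_iff_of_notMem_sphereBad {w y z : SpaceTime d} {ε : ℝ}
    (hy : dist y.1 w.1 ≤ ε) (hz : z ∉ sphereBad w ε) :
    dist z.1 y.1 < 2 ↔ dist z.1 w.1 < 2 := by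
  have h1 : ¬ |dist z.1 w.1 - 2| ≤ ε := hz
  have h2 := dist_triangle z.1 y.1 w.1
  have h3 := dist_triangle z.1 w.1 y.1
  rw [dist_comm w.1 y.1] at h3
  rw [abs_le] at h1
  have h0 : 0 ≤ dist y.1 w.1 := dist_nonneg
  constructor
  · intro h
    by_contra hc
    exact h1 ⟨by linarith, by linarith⟩
  · intro h
    by_contra hc
    exact h1 ⟨by linarith, by linarith⟩

/-! ### The continuum -/

theorem isAddHaarMeasure_spaceTime : (volume : Measure (SpaceTime d)).IsAddHaarMeasure :=
  inferInstanceAs ((volume : Measure (EuclideanSpace ℝ (Fin d))).prod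
    (volume : Measure ℝ)).IsAddHaarMeasure

open scoped Pointwise in
theorem volume_tile (V : Set (SpaceTime d)) (w : SpaceTime d) {ε : ℝ} (hε : 0 < ε) :
    volume (tile V w ε) = ENNReal.ofReal (ε ^ (d + 1)) * volume V := by
  have := isAddHaarMeasure_spaceTime (d := d)
  have h1 : tile V w ε = (fun u => w + u) '' (ε • V) := by
    rw [tile, ← image_smul, image_image]
  have h2 : Module.finrank ℝ (SpaceTime d) = d + 1 := by simp [SpaceTime]
  rw [h1, image_add_left, measure_preimage_add, Measure.addHaar_smul, h2,
    abs_of_pos (pow_pos hε _)]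

theorem continuous_euclDist (w : SpaceTime d) : Continuous fun z => euclDist z w := by
  unfold euclDist; fun_prop

theorem isClosed_unitBall : IsClosed (unitBall d) :=
  isClosed_le (continuous_euclDist 0) continuous_const

theorem norm_le_of_mem_unitBall {u : SpaceTime d} (hu : u ∈ unitBall d) : ‖u‖ ≤ 1 := by
  have hu : euclDist u 0 ≤ 1 := hu
  unfold euclDist at hu
  replace hu := (Real.sqrt_le_iff.1 hu).2
  simp only [Prod.fst_zero, dist_zero_right, Prod.snd_zero, sub_zero] at hu
  rw [Prod.norm_def, Real.norm_eq_abs]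
  refine max_le ?_ ?_
  · nlinarith [norm_nonneg u.1, sq_nonneg u.2]
  · rw [← sq_le_one_iff_abs_le_one]; nlinarith [sq_nonneg ‖u.1‖]

theorem volume_unitBall_ne_top : volume (unitBall d) ≠ ⊤ := by
  have := isAddHaarMeasure_spaceTime (d := d)
  refine ne_top_of_le_ne_top (measure_closedBall_lt_top (x := (0 : SpaceTime d)) (r := 1)).ne
    (measure_mono fun u hu => ?_)
  rw [mem_closedBall_zero_iff]
  exact norm_le_of_mem_unitBall hu

theorem volume_unitBall_pos : 0 < volume.real (unitBall d) := by
  have := isAddHaarMeasure_spaceTime (d := d)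
  refine ENNReal.toReal_pos (ne_of_gt ?_) volume_unitBall_ne_top
  have hopen : IsOpen {u : SpaceTime d | euclDist u 0 < 1} :=
    isOpen_lt (continuous_euclDist 0) continuous_const
  refine lt_of_lt_of_le (hopen.measure_pos volume ⟨0, ?_⟩)
    (measure_mono fun u (hu : euclDist u 0 < 1) => show euclDist u 0 ≤ 1 from hu.le)
  change euclDist 0 0 < 1
  simp [euclDist]

open scoped Pointwise in
theorem measurableSet_tile {U : Set (SpaceTime d)} (hU : MeasurableSet U) (w : SpaceTime d)
    (ε : ℝ) : MeasurableSet (tile U w ε) := by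
  have h1 : tile U w ε = (fun u => w + u) '' (ε • U) := by
    rw [tile, ← image_smul, image_image]
  rw [h1, image_add_left]
  exact measurable_const_add _ (hU.const_smul₀ ε)

theorem continuumIntensity_eq (d : ℕ) (τ : ℝ) : continuumIntensity d τ =
    (volume : Measure (SpaceTime d)).restrict {z | z.2 ∈ Icc 0 τ} := by
  have := Measure.prod_restrict (μ := (volume : Measure (EuclideanSpace ℝ (Fin d))))
    (ν := (volume : Measure ℝ)) univ (Icc 0 τ)
  rw [Measure.restrict_univ] at this
  rw [continuumIntensity, this, ← Measure.volume_eq_prod]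
  congr 1
  ext z; simp

theorem volume_cell (c : Fin d → ℤ) :
    volume {x : EuclideanSpace ℝ (Fin d) | floorVec x ∈ ({c} : Finset _)} = 1 := by
  have h : {x : EuclideanSpace ℝ (Fin d) | floorVec x ∈ ({c} : Finset _)} =
      WithLp.ofLp ⁻¹' (univ.pi fun i => Ico (c i : ℝ) (c i + 1)) := by
    ext x
    simp only [Finset.mem_singleton, mem_ofPred_eq, mem_preimage, mem_univ_pi, mem_Ico, funext_iff,
      floorVec, Int.floor_eq_iff]
  rw [h, (PiLp.volume_preserving_ofLp (Fin d)).measure_preimage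
    (MeasurableSet.univ_pi fun i => measurableSet_Ico).nullMeasurableSet, Real.volume_pi_Ico]
  simp

theorem slab_eq_prod (K : Finset (Fin d → ℤ)) (a b : ℝ) :
    slab K a b = {x | floorVec x ∈ K} ×ˢ Ico a b := rfl

theorem intensityBound_continuum (d : ℕ) (τ : ℝ) : IntensityBound (continuumIntensity d τ) where
  cell_le c a b := by
    rw [slab_eq_prod, continuumIntensity, Measure.prod_prod, volume_cell, one_mul]
    exact (Measure.restrict_apply_le _ _).trans (by simp)
  neg_null := by
    have : {z : SpaceTime d | z.2 < 0} = univ ×ˢ Iio 0 := by ext z; simp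
    rw [this, continuumIntensity, Measure.prod_prod, Measure.restrict_apply measurableSet_Iio]
    have : Iio (0 : ℝ) ∩ Icc 0 τ = ∅ := by
      ext t; simp only [mem_inter_iff, mem_Iio, mem_Icc, mem_empty_iff_false]; grind
    simp [this]

/-- The shells shrink to a null sphere of radius 2. They are unbounded in time, so finiteness relies
on the finite horizon. -/
theorem tendsto_sphereBad (τ : ℝ) (w : SpaceTime d) :
    (∀ ε, continuumIntensity d τ (sphereBad w ε) ≠ ⊤) ∧
      Tendsto (fun ε => (continuumIntensity d τ).real (sphereBad w ε)) (𝓝[>] 0) (𝓝 0) := by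
  set A : ℝ → Set (EuclideanSpace ℝ (Fin d)) := fun ε => {x | |dist x w.1 - 2| ≤ ε} with hA
  have hprod : ∀ ε, continuumIntensity d τ (sphereBad w ε) =
      volume (A ε) * (volume.restrict (Icc (0 : ℝ) τ)) univ := by
    intro ε
    have : sphereBad w ε = A ε ×ˢ univ := by ext z; simp [sphereBad, hA]
    rw [this, continuumIntensity, Measure.prod_prod]
  have hfin : ∀ ε, volume (A ε) ≠ ⊤ := fun ε => by
    refine ne_top_of_le_ne_top (measure_closedBall_lt_top (x := w.1) (r := 2 + ε)).ne
      (measure_mono fun x hx => ?_)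
    have := (abs_le.1 (show |dist x w.1 - 2| ≤ ε from hx)).2
    rw [Metric.mem_closedBall]; linarith
  have hfin2 : (volume.restrict (Icc (0 : ℝ) τ)) univ ≠ ⊤ := by simp
  have hlim : Tendsto (fun ε => volume (A ε)) (𝓝[>] 0) (𝓝 0) := by
    have h := tendsto_measure_biInter_gt (μ := volume) (s := A) (a := 0) (fun r _ => ?_)
      (fun i j _ hij x hx => le_trans hx hij) ⟨1, one_pos, hfin 1⟩
    · have hs : ⋂ r, ⋂ (_ : r > 0), A r = Metric.sphere w.1 2 := by
        ext x
        simp only [mem_iInter, Metric.mem_sphere, hA, mem_ofPred_eq]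
        constructor
        · intro h
          have : |dist x w.1 - 2| ≤ 0 := le_of_forall_pos_le_add fun ε hε => by
            simpa using h ε hε
          linarith [abs_nonpos_iff.1 this]
        · intro h r hr
          simpa [h] using hr.le
      rw [hs, Measure.addHaar_sphere_of_ne_zero _ _ two_ne_zero] at h
      exact h
    · exact (isClosed_le (by fun_prop) (by fun_prop) :
        IsClosed (A r)).measurableSet.nullMeasurableSet
  refine ⟨fun ε => by rw [hprod]; exact ENNReal.mul_ne_top (hfin ε) hfin2, ?_⟩
  have h1 : Tendsto (fun ε => volume (A ε) * (volume.restrict (Icc (0 : ℝ) τ)) univ)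
      (𝓝[>] 0) (𝓝 (0 * (volume.restrict (Icc (0 : ℝ) τ)) univ)) :=
    ENNReal.Tendsto.mul_const hlim (Or.inr hfin2)
  have h2 := (ENNReal.tendsto_toReal (by simp)).comp h1
  simp only [zero_mul, ENNReal.toReal_zero] at h2
  refine h2.congr fun ε => ?_
  simp [Measure.real, hprod]

/-- After rescaling, a small ball cut by the time window has a fixed shape: the whole ball, a half
ball at time 0 or `τ`, or nothing beyond `τ`. The ratio of intensity to volume is then constant for
small `ε`. -/
theorem tile_inter_slice {τ : ℝ} (hτ : 0 < τ) {w : SpaceTime d} (hw : 0 ≤ w.2) :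
    ∃ H : Set (SpaceTime d), ∀ᶠ ε : ℝ in 𝓝[>] 0,
      tile (unitBall d) w ε ∩ {z | z.2 ∈ Icc 0 τ} = tile (unitBall d ∩ H) w ε := by
  refine ⟨{u | (w.2 = 0 → 0 ≤ u.2) ∧ (w.2 = τ → u.2 ≤ 0) ∧ w.2 ≤ τ}, ?_⟩
  have e1 : ∀ᶠ ε : ℝ in 𝓝[>] 0, ε < τ := mem_nhdsWithin_of_mem_nhds (gt_mem_nhds hτ)
  have e2 : ∀ᶠ ε : ℝ in 𝓝[>] 0, w.2 ≠ 0 → ε < w.2 := by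
    by_cases h : w.2 = 0
    · simp [h]
    · filter_upwards [mem_nhdsWithin_of_mem_nhds
        (gt_mem_nhds (lt_of_le_of_ne hw (Ne.symm h)))] with ε hε _ using hε
  have e3 : ∀ᶠ ε : ℝ in 𝓝[>] 0, w.2 ≠ τ → ε < |w.2 - τ| := by
    by_cases h : w.2 = τ
    · simp [h]
    · filter_upwards [mem_nhdsWithin_of_mem_nhds
        (gt_mem_nhds (abs_pos.2 (sub_ne_zero.2 h)))] with ε hε _ using hε
  filter_upwards [e1, e2, e3, self_mem_nhdsWithin] with ε h1 h2 h3 hε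
  have hε : 0 < ε := hε
  have key : ∀ u ∈ unitBall d, (w + ε • u).2 ∈ Icc 0 τ ↔
      (w.2 = 0 → 0 ≤ u.2) ∧ (w.2 = τ → u.2 ≤ 0) ∧ w.2 ≤ τ := by
    intro u hu
    have hu2 : |u.2| ≤ 1 := (le_max_right _ _).trans (norm_le_of_mem_unitBall hu)
    rw [abs_le] at hu2
    have hs1 : -ε ≤ ε * u.2 := by nlinarith
    have hs2 : ε * u.2 ≤ ε := by nlinarith
    have hval : (w + ε • u).2 = w.2 + ε * u.2 := by simp
    rw [hval, mem_Icc]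
    rcases lt_trichotomy w.2 τ with hlt | heq | hgt
    · have h3' := h3 hlt.ne
      rw [abs_of_neg (by linarith)] at h3'
      have hright : w.2 + ε * u.2 ≤ τ := by linarith
      simp only [hright, and_true, hlt.ne, hlt.le, false_implies]
      by_cases h0 : w.2 = 0
      · simp [h0, hε]
      · simp only [h0, false_implies, iff_true]
        linarith [h2 h0]
    · have h2' := h2 (by linarith)
      have hleft : 0 ≤ w.2 + ε * u.2 := by linarith
      have h0 : w.2 ≠ 0 := by linarith
      constructor
      · rintro ⟨-, h⟩
        refine ⟨fun h' => absurd h' h0, fun _ => ?_, heq.le⟩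
        by_contra hc
        push Not at hc
        have := mul_pos hε hc
        linarith
      · rintro ⟨-, h, -⟩
        have := mul_nonpos_of_nonneg_of_nonpos hε.le (h heq)
        exact ⟨hleft, by linarith⟩
    · have h3' := h3 hgt.ne'
      rw [abs_of_pos (by linarith)] at h3'
      refine iff_of_false (fun h => ?_) (fun h => ?_)
      · linarith [h.2]
      · linarith [h.2.2]
  ext z
  constructor
  · rintro ⟨⟨u, hu, rfl⟩, hz⟩
    exact ⟨u, ⟨hu, (key u hu).1 hz⟩, rfl⟩
  · rintro ⟨u, ⟨hu, hH⟩, rfl⟩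
    exact ⟨⟨u, hu, rfl⟩, (key u hu).2 hH⟩

theorem inputModel_continuum {τ : ℝ} (hτ : 0 < τ) :
    InputModel (continuumIntensity d τ) (unitBall d)
      (fun ε => ε ^ (d + 1) * volume.real (unitBall d)) where
  intensity := intensityBound_continuum d τ
  zero_mem := by simp [unitBall, euclDist]
  norm_le u hu := norm_le_of_mem_unitBall hu
  measurable_tile w ε hε := measurableSet_tile isClosed_unitBall.measurableSet w ε
  pos ε hε := mul_pos (pow_pos hε _) volume_unitBall_pos
  tendsto_zero := by
    have : Tendsto (fun ε : ℝ => ε ^ (d + 1) * volume.real (unitBall d)) (𝓝 0)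
        (𝓝 (0 ^ (d + 1) * volume.real (unitBall d))) := by
      apply Continuous.tendsto; fun_prop
    simpa using this.mono_left nhdsWithin_le_nhds
  le w ε hε := by
    rw [continuumIntensity_eq]
    refine (Measure.restrict_apply_le _ _).trans_eq ?_
    rw [volume_tile _ _ hε, ENNReal.ofReal_mul (pow_pos hε _).le, ofReal_measureReal
      volume_unitBall_ne_top]
  ratio w hw := by
    obtain ⟨H, hH⟩ := tile_inter_slice hτ hw
    refine ⟨volume.real (unitBall d ∩ H) / volume.real (unitBall d), ?_⟩
    refine tendsto_const_nhds.congr' ?_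
    filter_upwards [hH, self_mem_nhdsWithin] with ε hε hε0
    have hε0 : 0 < ε := hε0
    rw [continuumIntensity_eq, measureReal_def (μ := Measure.restrict _ _),
      Measure.restrict_apply (measurableSet_tile isClosed_unitBall.measurableSet w ε), hε,
      volume_tile _ _ hε0, ENNReal.toReal_mul, ENNReal.toReal_ofReal (pow_pos hε0 _).le]
    rw [mul_div_mul_left _ _ (pow_pos hε0 _).ne', measureReal_def]
  bad w := by
    have hI := intensityBound_continuum d τ
    obtain ⟨hfin, hlim⟩ := tendsto_sphereBad τ w
    refine ⟨fun ε => timeBad w ε ∪ sphereBad w ε, fun ε hε => ⟨?_, ?_, ?_⟩, ?_⟩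
    · exact (measurableSet_timeBad w ε).union (measurableSet_sphereBad w ε)
    · exact measure_union_ne_top (hI.timeBad_ne_top w hε) (hfin ε)
    · rintro z hz y ⟨u, hu, rfl⟩
      have hn := norm_le_of_mem_unitBall hu
      have hd : ‖ε • u‖ ≤ ε := by
        rw [norm_smul, Real.norm_eq_abs, abs_of_pos hε]
        exact mul_le_of_le_one_right hε.le hn
      refine blocks_iff_of_notMem_timeBad (ε := ε) ?_
        (dist_lt_two_iff_of_notMem_sphereBad (ε := ε) ?_ fun h => hz (Or.inr h)) hε
        fun h => hz (Or.inl h)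
      · simpa using (le_max_right _ _).trans hd
      · simpa [dist_eq_norm] using (le_max_left _ _).trans hd
    · refine squeeze_zero (fun _ => measureReal_nonneg) (fun ε => measureReal_union_le _ _) ?_
      simpa using (hI.tendsto_timeBad w).add hlim

/-- No decay has to be proved: up to time `τ` the prefactor is at least 1 and the trivial bound
suffices, and beyond `τ` small tiles have no intensity. -/
theorem continuum_decay {τ : ℝ} (hτ : 0 < τ) {X : Ω → Set (SpaceTime d)}
    (hX : IsPoissonProcess P (continuumIntensity d τ) X) (k : ℕ) (w : Fin k → SpaceTime d)
    (hw : Function.Injective w) (i : Fin k) :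
    ∀ᶠ e : ℝ in 𝓝[>] 0, hitProb P X (unitBall d) w (fun _ => e) ≤
      Real.exp τ * Real.exp (-(w i).2) *
        ∏ _j : Fin k, (e ^ (d + 1) * volume.real (unitBall d)) := by
  have M := inputModel_continuum (d := d) hτ
  have hpos : ∀ e : ℝ, 0 < e → 0 ≤ ∏ _j : Fin k, (e ^ (d + 1) * volume.real (unitBall d)) :=
    fun e he => Finset.prod_nonneg fun _ _ => (M.pos e he).le
  by_cases h : (w i).2 ≤ τ
  · filter_upwards [InputModel.eventually_diag (M.hitProb_le hX hw), self_mem_nhdsWithin]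
      with e he he0
    refine he.trans (le_mul_of_one_le_left (hpos e he0) ?_)
    rw [← Real.exp_add]
    exact Real.one_le_exp (by linarith)
  · push Not at h
    filter_upwards [mem_nhdsWithin_of_mem_nhds (gt_mem_nhds (sub_pos.2 h)), self_mem_nhdsWithin]
      with e he he0
    have he0 : 0 < e := he0
    have he : e < (w i).2 - τ := he
    have hz : continuumIntensity d τ (tile (unitBall d) (w i) e) = 0 := by
      rw [continuumIntensity_eq, Measure.restrict_apply (M.measurable_tile _ _ he0)]
      convert measure_empty (μ := (volume : Measure (SpaceTime d)))
      refine eq_empty_of_forall_notMem fun z hz => ?_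
      have h1 := (abs_le.1 (M.abs_snd_le he0 hz.1)).1
      have h2 : z.2 ≤ τ := hz.2.2
      linarith
    have h1 := hX.hit_le (M.measurable_tile (w i) _ he0) (by simp [hz])
    rw [measureReal_def (continuumIntensity d τ), hz, ENNReal.toReal_zero] at h1
    refine le_trans (le_trans (measureReal_mono (fun ω hω => ?_) (measure_ne_top _ _)) h1) ?_
    · exact (hω i).mono (inter_subset_inter_left _ (accepted_subset _))
    · have := hpos e he0
      positivity

/-! ### The lattice -/

theorem latticePoint_injective : Function.Injective (latticePoint (d := d)) := by
  intro z z' h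
  ext i
  have := congrArg (fun x : EuclideanSpace ℝ (Fin d) => x i) h
  simpa [latticePoint] using this

/-- The number of lattice points in a set. -/
def latticeCount (d : ℕ) (A : Set (EuclideanSpace ℝ (Fin d))) : ENNReal :=
  ∑' z : Fin d → ℤ, Measure.dirac (latticePoint z) A

theorem latticeIntensity_prod {A : Set (EuclideanSpace ℝ (Fin d))} (hA : MeasurableSet A)
    {I : Set ℝ} (hI : MeasurableSet I) :
    latticeIntensity d (A ×ˢ I) = latticeCount d A * volume (I ∩ Ici 0) := by
  rw [latticeIntensity, Measure.sum_apply _ (hA.prod hI), latticeCount, ← ENNReal.tsum_mul_right]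
  refine tsum_congr fun z => ?_
  rw [Measure.prod_prod, Measure.restrict_apply hI]

theorem latticeCount_cell_le (c : Fin d → ℤ) : latticeCount d {x | floorVec x = c} ≤ 1 := by
  have hm : MeasurableSet {x : EuclideanSpace ℝ (Fin d) | floorVec x = c} :=
    measurable_floorVec (measurableSet_singleton c)
  rw [latticeCount, tsum_eq_single c]
  · exact prob_le_one
  · intro z hz
    rw [Measure.dirac_apply' _ hm, indicator_of_notMem]
    intro h
    refine hz (funext fun i => ?_)
    have := congrFun (show floorVec (latticePoint z) = c from h) i
    simpa [floorVec, latticePoint] using this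

theorem latticeCount_singleton (x : EuclideanSpace ℝ (Fin d)) :
    latticeCount d {x} = 0 ∨ latticeCount d {x} = 1 := by
  by_cases h : ∃ z, latticePoint z = x
  · obtain ⟨z, rfl⟩ := h
    right
    rw [latticeCount, tsum_eq_single z]
    · simp
    · intro z' hz'
      rw [Measure.dirac_apply' _ (measurableSet_singleton _), indicator_of_notMem]
      exact fun h => hz' (latticePoint_injective h)
  · left
    push Not at h
    rw [latticeCount, ENNReal.tsum_eq_zero]
    intro z
    rw [Measure.dirac_apply' _ (measurableSet_singleton _), indicator_of_notMem]
    exact fun h' => h z h'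

theorem intensityBound_lattice (d : ℕ) : IntensityBound (latticeIntensity d) where
  cell_le c a b := by
    have : slab {c} a b = {x | floorVec x = c} ×ˢ Ico a b := by
      rw [slab_eq_prod]; simp
    have hm : MeasurableSet {x : EuclideanSpace ℝ (Fin d) | floorVec x = c} :=
      measurable_floorVec (measurableSet_singleton c)
    rw [this, latticeIntensity_prod hm measurableSet_Ico]
    refine (mul_le_mul' (latticeCount_cell_le c) (measure_mono inter_subset_left)).trans ?_
    simp
  neg_null := by
    have h1 : {z : SpaceTime d | z.2 < 0} = univ ×ˢ Iio 0 := by ext z; simp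
    have h2 : Iio (0 : ℝ) ∩ Ici 0 = ∅ := by
      ext t; simp only [mem_inter_iff, mem_Iio, mem_Ici, mem_empty_iff_false]; grind
    rw [h1, latticeIntensity_prod MeasurableSet.univ measurableSet_Iio, h2]
    simp

theorem tile_timeInterval (w : SpaceTime d) {ε : ℝ} (hε : 0 < ε) :
    tile (timeInterval d) w ε = {w.1} ×ˢ Icc (w.2 - ε / 2) (w.2 + ε / 2) := by
  ext z
  constructor
  · rintro ⟨u, ⟨h1, h2, h3⟩, rfl⟩
    refine ⟨by simp [h1], ?_⟩
    simp only [Prod.snd_add, Prod.smul_snd, smul_eq_mul, mem_Icc]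
    constructor <;> nlinarith
  · rintro ⟨h1, h2, h3⟩
    refine ⟨(0, (z.2 - w.2) / ε), ⟨rfl, ?_, ?_⟩, ?_⟩
    · rw [le_div_iff₀ hε]; linarith
    · rw [div_le_iff₀ hε]; linarith
    · have h1 : z.1 = w.1 := h1
      refine Prod.ext (by simp [h1]) ?_
      simp only [Prod.snd_add, Prod.smul_snd, smul_eq_mul]
      field_simp; ring

theorem inputModel_lattice (d : ℕ) :
    InputModel (latticeIntensity d) (timeInterval d) (fun ε => ε) where
  intensity := intensityBound_lattice d
  zero_mem := ⟨rfl, by simp; norm_num⟩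
  norm_le u hu := by
    obtain ⟨h1, h2, h3⟩ := hu
    rw [Prod.norm_def, h1, norm_zero, Real.norm_eq_abs]
    exact max_le zero_le_one (abs_le.2 ⟨by linarith, by linarith⟩)
  measurable_tile w ε hε := by
    rw [tile_timeInterval w hε]
    exact (measurableSet_singleton _).prod measurableSet_Icc
  pos ε hε := hε
  tendsto_zero := tendsto_id.mono_left nhdsWithin_le_nhds
  le w ε hε := by
    rw [tile_timeInterval w hε, latticeIntensity_prod (measurableSet_singleton _)
      measurableSet_Icc]
    have h1 : latticeCount d {w.1} ≤ 1 := by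
      rcases latticeCount_singleton w.1 with h | h <;> simp [h]
    refine (mul_le_mul' h1 (measure_mono inter_subset_left)).trans ?_
    rw [one_mul, Real.volume_Icc]
    exact ENNReal.ofReal_le_ofReal (by linarith)
  ratio w hw := by
    have hval : ∀ ε : ℝ, 0 < ε → (latticeIntensity d).real (tile (timeInterval d) w ε) =
        (latticeCount d {w.1}).toReal *
          (volume (Icc (w.2 - ε / 2) (w.2 + ε / 2) ∩ Ici 0)).toReal := fun ε hε => by
      rw [tile_timeInterval w hε, measureReal_def, latticeIntensity_prod
        (measurableSet_singleton _) measurableSet_Icc, ENNReal.toReal_mul]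
    -- At time 0 half of the interval lies at negative times, whence the factor `1 / 2`.
    rcases hw.eq_or_lt with h0 | hpos
    · refine ⟨(latticeCount d {w.1}).toReal * (1 / 2), tendsto_const_nhds.congr' ?_⟩
      filter_upwards [self_mem_nhdsWithin] with ε hε
      have hε : 0 < ε := hε
      have hI : Icc (w.2 - ε / 2) (w.2 + ε / 2) ∩ Ici 0 = Icc 0 (ε / 2) := by
        ext t; simp only [mem_inter_iff, mem_Icc, mem_Ici]
        constructor
        · rintro ⟨⟨a, b⟩, c⟩; constructor <;> linarith
        · rintro ⟨a, b⟩; exact ⟨⟨by linarith, by linarith⟩, a⟩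
      rw [hval ε hε, hI, Real.volume_Icc, sub_zero, ENNReal.toReal_ofReal (by linarith)]
      field_simp
    · refine ⟨(latticeCount d {w.1}).toReal, tendsto_const_nhds.congr' ?_⟩
      filter_upwards [self_mem_nhdsWithin, mem_nhdsWithin_of_mem_nhds (gt_mem_nhds hpos)]
        with ε hε hεw
      have hε : 0 < ε := hε
      have hεw : ε < w.2 := hεw
      have hI : Icc (w.2 - ε / 2) (w.2 + ε / 2) ∩ Ici 0 = Icc (w.2 - ε / 2) (w.2 + ε / 2) :=
        inter_eq_left.2 fun t ht => by
          have := ht.1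
          rw [mem_Ici]; linarith
      rw [hval ε hε, hI, Real.volume_Icc, ENNReal.toReal_ofReal (by linarith)]
      field_simp; ring
  bad w := by
    have hI := intensityBound_lattice d
    refine ⟨fun ε => timeBad w ε, fun ε hε => ⟨measurableSet_timeBad w ε,
      hI.timeBad_ne_top w hε, fun z hz y hy => ?_⟩, hI.tendsto_timeBad w⟩
    rw [tile_timeInterval w hε] at hy
    obtain ⟨h1, h2, h3⟩ := hy
    have h1 : y.1 = w.1 := h1
    exact blocks_iff_of_notMem_timeBad (abs_le.2 ⟨by linarith, by linarith⟩) (by rw [h1]) hε hz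

/-- `V` may meet the sets `B i`; removing them restores independence and costs at most their total
intensity in the exponent. -/
theorem IsPoissonProcess.hit_void_le {μ : Measure (SpaceTime d)} {X : Ω → Set (SpaceTime d)}
    (hX : IsPoissonProcess P μ X) {k : ℕ} {B : Fin k → Set (SpaceTime d)}
    (hB : ∀ i, MeasurableSet (B i)) (hμB : ∀ i, μ (B i) ≠ ⊤)
    (hdisj : Pairwise fun i j => Disjoint (B i) (B j)) {V : Set (SpaceTime d)}
    (hV : MeasurableSet V) (hμV : μ V ≠ ⊤) :
    P.real {ω | (∀ i, (X ω ∩ B i).Nonempty) ∧ X ω ∩ V = ∅} ≤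
      (∏ i, μ.real (B i)) * Real.exp (-(μ.real V - ∑ i, μ.real (B i))) := by
  set U := ⋃ i, B i with hU
  have hUm : MeasurableSet U := MeasurableSet.iUnion hB
  have h1 : MeasurableSet[hitSigma fun ω => X ω ∩ U] {ω | ∀ i, (X ω ∩ B i).Nonempty} := by
    have : {ω | ∀ i, (X ω ∩ B i).Nonempty} = ⋂ i, {ω | (X ω ∩ U ∩ B i).Nonempty} := by
      ext ω
      simp only [mem_ofPred_eq, mem_iInter]
      refine forall_congr' fun i => ?_
      rw [inter_assoc, inter_eq_self_of_subset_right (subset_iUnion B i)]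
    rw [this]
    exact MeasurableSet.iInter fun i => hitMeas_hitSigma _ _ (hB _)
  have h2 : MeasurableSet[hitSigma fun ω => X ω ∩ Uᶜ] {ω | X ω ∩ Uᶜ ∩ V = ∅} :=
    MeasurableSpace.measurableSet_generateFrom ⟨V, hV, rfl⟩
  have hind := (Indep_iff _ _ _).1
    (hX.indep_hitSigma hUm hUm.compl disjoint_compl_right) _ _ h1 h2
  have hsub : {ω | (∀ i, (X ω ∩ B i).Nonempty) ∧ X ω ∩ V = ∅} ⊆
      {ω | ∀ i, (X ω ∩ B i).Nonempty} ∩ {ω | X ω ∩ Uᶜ ∩ V = ∅} := by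
    rintro ω ⟨a, b⟩
    refine ⟨a, subset_empty_iff.1 ?_⟩
    rw [← b]
    exact inter_subset_inter_left _ inter_subset_left
  refine (measureReal_mono hsub (measure_ne_top _ _)).trans ?_
  rw [measureReal_def, hind, ENNReal.toReal_mul]
  refine mul_le_mul (hX.prob_all_hit_le hB hdisj hμB) ?_ ENNReal.toReal_nonneg
    (Finset.prod_nonneg fun _ _ => measureReal_nonneg)
  have h3 : {ω | X ω ∩ Uᶜ ∩ V = ∅} = {ω | X ω ∩ (Uᶜ ∩ V) = ∅} := by simp only [inter_assoc]
  have h4 : μ (Uᶜ ∩ V) ≠ ⊤ := ne_top_of_le_ne_top hμV (measure_mono inter_subset_right)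
  have h5 := hX.void_prob (hUm.compl.inter hV) h4
  rw [h3, ← measureReal_def, h5]
  refine Real.exp_le_exp.2 (neg_le_neg ?_)
  have hUfin : μ U ≠ ⊤ := by
    refine ne_top_of_le_ne_top ?_ (measure_iUnion_fintype_le μ B)
    exact ENNReal.sum_ne_top.2 fun i _ => hμB i
  have h6 : μ.real V ≤ μ.real (Uᶜ ∩ V) + μ.real U := by
    refine (measureReal_mono (s₂ := (Uᶜ ∩ V) ∪ U) (fun z hz => ?_)
      (measure_union_ne_top h4 hUfin)).trans (measureReal_union_le _ _)
    by_cases h : z ∈ U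
    · exact Or.inr h
    · exact Or.inl ⟨h, hz⟩
  have h7 : μ.real U ≤ ∑ i, μ.real (B i) := measureReal_iUnion_fintype_le B
  linarith

/-- An accepted ball is the first arrival at its site, so the column below its tile is empty, which
costs `exp (-(w i).2)` up to corrections. These are `e / 2` from the tile and `k * e` from overlaps;
their sum is below 1 for `e < 1 / (k + 1)`, whence `Real.exp 1`. -/
theorem lattice_decay {X : Ω → Set (SpaceTime d)}
    (hX : IsPoissonProcess P (latticeIntensity d) X) (k : ℕ) (w : Fin k → SpaceTime d)
    (hw : Function.Injective w) (i : Fin k) :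
    ∀ᶠ e : ℝ in 𝓝[>] 0, hitProb P X (timeInterval d) w (fun _ => e) ≤
      Real.exp 1 * Real.exp (-(w i).2) * ∏ _j : Fin k, e := by
  have M := inputModel_lattice d
  have hk : (0 : ℝ) < 1 / (k + 1) := by positivity
  filter_upwards [InputModel.eventually_diag (M.eventually_disjoint hw), self_mem_nhdsWithin,
    mem_nhdsWithin_of_mem_nhds (gt_mem_nhds hk)] with e hdis he he1
  have he : 0 < e := he
  have he1 : e < 1 / (k + 1) := he1
  rw [lt_div_iff₀ (by positivity)] at he1
  have hle := M.prod_tile_le w (ε := fun _ => e) fun _ => he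
  have hprod0 : (0 : ℝ) ≤ ∏ _j : Fin k, e := Finset.prod_nonneg fun _ _ => he.le
  set B : Fin k → Set (SpaceTime d) := fun j => tile (timeInterval d) (w j) e with hB
  have hBm : ∀ j, MeasurableSet (B j) := fun j => M.measurable_tile _ _ he
  have hBf : ∀ j, latticeIntensity d (B j) ≠ ⊤ := fun j => M.ne_top _ he
  set V : Set (SpaceTime d) := {(w i).1} ×ˢ Ico 0 ((w i).2 - e / 2) with hV
  have hVm : MeasurableSet V := (measurableSet_singleton _).prod measurableSet_Ico
  have hVμ : latticeIntensity d V =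
      latticeCount d {(w i).1} * ENNReal.ofReal ((w i).2 - e / 2) := by
    rw [hV, latticeIntensity_prod (measurableSet_singleton _) measurableSet_Ico,
      inter_eq_left.2 fun t ht => ht.1, Real.volume_Ico, sub_zero]
  have hVf : latticeIntensity d V ≠ ⊤ := by
    rw [hVμ]
    rcases latticeCount_singleton (w i).1 with h | h <;> simp [h]
  have hsub : {ω | ∀ j, (accepted (X ω) ∩ (fun u => w j + e • u) '' timeInterval d).Nonempty} ⊆
      {ω | (∀ j, (X ω ∩ B j).Nonempty) ∧ X ω ∩ V = ∅} := by
    intro ω hω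
    refine ⟨fun j => (hω j).mono (inter_subset_inter_left _ (accepted_subset _)), ?_⟩
    refine eq_empty_of_forall_notMem fun z hz => ?_
    obtain ⟨y, hy, hyB⟩ := hω i
    have hyB' : y ∈ tile (timeInterval d) (w i) e := hyB
    rw [tile_timeInterval _ he] at hyB'
    have h1 : y.1 = (w i).1 := hyB'.1
    have h2 : z.1 = (w i).1 := hz.2.1
    exact Decision.no_earlier_at_centre hy hz.1 (h2.trans h1.symm)
      (lt_of_lt_of_le hz.2.2.2 hyB'.2.1)
  refine (measureReal_mono hsub (measure_ne_top _ _)).trans ?_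
  refine (hX.hit_void_le hBm hBf hdis hVm hVf).trans ?_
  -- Off the lattice the column carries no intensity, but neither does the tile, so the product
  -- vanishes.
  rcases latticeCount_singleton (w i).1 with h | h
  · have hz : (latticeIntensity d).real (B i) = 0 := by
      rw [measureReal_def, show B i = _ from tile_timeInterval _ he, latticeIntensity_prod
        (measurableSet_singleton _) measurableSet_Icc, h, zero_mul, ENNReal.toReal_zero]
    rw [Finset.prod_eq_zero (Finset.mem_univ i) hz, zero_mul]
    positivity
  · have hVr : (w i).2 - e / 2 ≤ (latticeIntensity d).real V := by
      rw [measureReal_def, hVμ, h, one_mul]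
      rw [ENNReal.toReal_ofReal']
      exact le_max_left _ _
    have hS : ∑ j, (latticeIntensity d).real (B j) ≤ k * e := by
      refine (Finset.sum_le_sum fun j _ => M.real_le (w j) he).trans_eq ?_
      simp
    rw [mul_comm, ← Real.exp_add]
    refine mul_le_mul (Real.exp_le_exp.2 ?_) hle
      (Finset.prod_nonneg fun _ _ => measureReal_nonneg) (Real.exp_pos _).le
    nlinarith

/-! ### Transfer to the two concrete inputs -/

theorem continuumCorrelation_eq (X : Ω → Set (SpaceTime d)) : ContinuumCorrelation P X =
    HasCorrelation P X (unitBall d) (fun ε => ε ^ (d + 1) * volume.real (unitBall d)) := rfl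

theorem latticeCorrelation_eq (X : Ω → Set (SpaceTime d)) :
    LatticeCorrelation P X = HasCorrelation P X (timeInterval d) (fun ε => ε) := rfl

theorem hasCorrelation_congr {X Y : Ω → Set (SpaceTime d)} (h : ∀ᵐ ω ∂P, Y ω = X ω)
    (U : Set (SpaceTime d)) (v : ℝ → ℝ) : HasCorrelation P X U v = HasCorrelation P Y U v := by
  funext k w r
  exact propext (HasCorrelation.congr_ae h).symm

end

end RSA

end

theorem proposition3p3 (d : ℕ) (hd : 1 ≤ d) {Ω : Type*} [MeasurableSpace Ω]
    (P : Measure Ω) [IsProbabilityMeasure P] :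
    (∀ τ : ℝ, 0 < τ → ∀ X : Ω → Set (RSA.SpaceTime d),
      RSA.IsPoissonProcess P (RSA.continuumIntensity d τ) X →
        (∀ k : ℕ, 1 ≤ k → ∀ w : Fin k → RSA.SpaceTime d, (∀ i, 0 ≤ (w i).2) →
          Function.Injective w → (∀ i j, i ≠ j → dist (w i).1 (w j).1 ≠ 2) →
          ∃ r : ℝ, RSA.ContinuumCorrelation P X k w r) ∧
        RSA.ExponentiallyClusters (RSA.ContinuumCorrelation P X)) ∧
    (∀ X : Ω → Set (RSA.SpaceTime d),
      RSA.IsPoissonProcess P (RSA.latticeIntensity d) X →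
        (∀ k : ℕ, 1 ≤ k → ∀ w : Fin k → RSA.SpaceTime d, (∀ i, 0 ≤ (w i).2) →
          Function.Injective w → ∃ r : ℝ, RSA.LatticeCorrelation P X k w r) ∧
        RSA.ExponentiallyClusters (RSA.LatticeCorrelation P X)) := by
  constructor
  · intro τ hτ X hX
    have M := RSA.inputModel_continuum (d := d) hτ
    obtain ⟨Y, hn, hYX, hY⟩ := hX.exists_nice_version M.intensity
    rw [RSA.continuumCorrelation_eq, RSA.hasCorrelation_congr hYX]
    refine ⟨fun k _ w hw0 hw hne => ?_, ?_⟩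
    · refine M.exists_correlation hY hn hw hw0 fun i j hij => ?_
      rcases lt_or_gt_of_ne (hne i j hij) with h | h
      · exact Or.inl h
      -- Each of the two tiles may use up half of the excess of the distance over 2.
      · refine Or.inr ⟨(dist (w i).1 (w j).1 - 2) / 2, by linarith, ?_⟩
        intro ε ε' h1 h2 h3 h4 y hy z hz
        have a := M.dist_fst_le h1 hy
        have b := M.dist_fst_le h3 hz
        have c := dist_triangle4 (w i).1 y.1 z.1 (w j).1
        rw [dist_comm (w i).1 y.1] at c
        linarith
    · exact M.exponentiallyClusters hY hn (Real.exp_pos τ).le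
        fun k w hw _ i => RSA.continuum_decay hτ hY k w hw i
  · intro X hX
    have M := RSA.inputModel_lattice d
    obtain ⟨Y, hn, hYX, hY⟩ := hX.exists_nice_version M.intensity
    rw [RSA.latticeCorrelation_eq, RSA.hasCorrelation_congr hYX]
    refine ⟨fun k _ w hw0 hw => ?_, ?_⟩
    · refine M.exists_correlation hY hn hw hw0 fun i j hij => ?_
      rcases lt_or_ge (dist (w i).1 (w j).1) 2 with h | h
      · exact Or.inl h
      -- Lattice tiles are vertical, so distance exactly 2 is harmless and the bound 1 on the radii
      -- is arbitrary.
      · refine Or.inr ⟨1, one_pos, fun ε ε' h1 _ h3 _ y hy z hz => ?_⟩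
        rw [RSA.tile_timeInterval _ h1] at hy
        rw [RSA.tile_timeInterval _ h3] at hz
        have a : y.1 = (w i).1 := hy.1
        have b : z.1 = (w j).1 := hz.1
        rwa [a, b]
    · exact M.exponentiallyClusters hY hn (Real.exp_pos 1).le
        fun k w hw _ i => RSA.lattice_decay hY k w hw i
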